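/- Let $N\ge 1$. Functions, kernels and measures below may be real- or complex-valued. For $f:\mathbb R^N\to\mathbb C$ and $\varepsilon>0$ put $f_\varepsilon(x)=\varepsilon^{-N}f(x/\varepsilon)$; put $|||g|||_{M^1}=\sup_{\lambda>0}\lambda\,\mathscr L^N(\{|g|>\lambda\})$ for measurable $g$; $B_1$ is the unit ball centred at the origin. A *singular kernel of fundamental type* is a tempered distribution $K$ on $\mathbb R^N$ with $\widehat K\in L^\infty(\mathbb R^N)$ whose restriction to $\mathbb R^N\setminus\{0\}$ is a $C^1$ function, again denoted $K$, such that for some constants $C_0,C_1,A_2\ge 0$ $$|K(x)|\le \frac{C_0}{|x|^N},\qquad |\nabla K(x)|\le \frac{C_1}{|x|^{N+1}}\quad (x\ne0),\qquad \Bigl|\int_{R_1<|x|<R_2}K(x)\,dx\Bigr|\le A_2\quad (0<R_1<R_2<\infty).$$ For $u\in L^2(\mathbb R^N)$ the function $Su=K*u\in L^2(\mathbb R^N)$ is defined by $\widehat{Su}=\widehat K\,\widehat u$. For a finite measure $u$, $Su$ is the tempered distribution $\langle Su,\varphi\rangle=\int \widetilde S\varphi\,du$, $\varphi\in\mathcal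 S(\mathbb R^N)$, where $\widetilde S\varphi$ is the continuous function with Fourier transform $\widehat K(-\xi)\widehat\varphi(\xi)$. Let $K$ be a singular kernel of fundamental type, with constants $C_0,C_1$ as above, and let $\{\rho^\nu\}_\nu\subset L^\infty(\mathbb R^N)$ be a family (with an arbitrary index set) such that $\rho^\nu=0$ a.e. outside $B_1$ and $\|\rho^\nu\|_{L^1}\le Q_1$ for all $\nu$. Assume that for all $\varepsilon>0$ and all $\nu$ the convolution $(\varepsilon^NK(\varepsilon\,\cdot))*\rho^\nu$ (which is in $L^2$) belongs to $C_b(\mathbb R^N)$, with $$\bigl\|(\varepsilon^NK(\varepsilon\,\cdot))*\rho^\nu\bigr\|_{C_b(\mathbb R^N)}\le Q_2 .$$ For $v\in L^1_{\rm loc}(\mathbb R^N)$ put $M_{\{\rho^\nu\}}(v)(x)=\sup_\nu\sup_{\varepsilon>0}|(\rho^\nu_\varepsilon*v)(x)|\in[0,\infty]$; if all $\rho^\nu$ are in $C_c^\infty(\mathbb R^N)$ and $v$ is a distribution, put $M_{\{\rho^\nu\}}(v)(x)=\sup_\nu\sup_{\varepsilon>0}|\langle v,\rho^\nu_\varepsilon(x-\cdot)\rangle|$.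 Then there are constants $C_N$ and $C_N'$, depending only on $N$, such that the following hold (the maximal functions being measurable). (i) For every $u\in L^1\cap L^2(\mathbb R^N)$, $$|||M_{\{\rho^\nu\}}(Su)|||_{M^1}\le C_N\bigl(Q_2+Q_1(C_0+C_1+\|\widehat K\|_{L^\infty})\bigr)\|u\|_{L^1}.$$ (ii) If in addition $\{\rho^\nu\}\subset C_c^\infty(\mathbb R^N)$, then for every finite (signed or complex) measure $u$ on $\mathbb R^N$, with $\|u\|$ its total variation and with the same constant $C_N$, $$|||M_{\{\rho^\nu\}}(Su)|||_{M^1}\le C_N\bigl(Q_2+Q_1(C_0+C_1+\|\widehat K\|_{L^\infty})\bigr)\|u\|.$$ (iii) If $Q_3=\sup_\nu\|\rho^\nu\|_{L^\infty}$ is finite, then for every $u\in L^2(\mathbb R^N)$, $$\|M_{\{\rho^\nu\}}(Su)\|_{L^2}\le C_N'\,Q_3\,\|\widehat K\|_{L^\infty}\,\|u\|_{L^2}.$$ -/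

import Mathlib

open MeasureTheory FourierTransform SchwartzMap
open scoped ENNReal NNReal

noncomputable section

namespace SingularMaximal

/-- The Euclidean space `ℝ^N`. -/
abbrev RN (N : ℕ) : Type := EuclideanSpace ℝ (Fin N)

variable {N : ℕ}

/-! ### Convolution with a tempered distribution whose Fourier transform is bounded -/

/-- The Fourier transform of the tempered distribution `K` is a function in `L^∞`. -/
def HasBoundedSymbol (K : 𝓢'(RN N, ℂ)) : Prop :=
  ∃ m : Lp ℂ ∞ (volume : Measure (RN N)), 𝓕 K = Lp.toTemperedDistribution m

open Classical in
/-- The Fourier transform of `K` as an element of `L^∞` (and `0` if it is not bounded). -/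
def symbol (K : 𝓢'(RN N, ℂ)) : Lp ℂ ∞ (volume : Measure (RN N)) :=
  if h : HasBoundedSymbol K then h.choose else 0

theorem fourier_eq_symbol {K : 𝓢'(RN N, ℂ)} (h : HasBoundedSymbol K) :
    𝓕 K = Lp.toTemperedDistribution (symbol K) := by
  rw [symbol, dif_pos h]
  exact h.choose_spec

/-- The operator `u ↦ K * u` on `L²`, in the sense of multiplication in the Fourier variable. -/
def convL2 (K : 𝓢'(RN N, ℂ)) (u : Lp ℂ 2 (volume : Measure (RN N))) :
    Lp ℂ 2 (volume : Measure (RN N)) :=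
  𝓕⁻ (symbol K • 𝓕 u : Lp ℂ 2 (volume : Measure (RN N)))

/-- For a Schwartz function `φ`, the convolution `K * φ` is the inverse Fourier transform of the
integrable function `K̂ φ̂`; this is its continuous representative, defined at every point. -/
def convSchwartz (K : 𝓢'(RN N, ℂ)) (φ : 𝓢(RN N, ℂ)) : RN N → ℂ :=
  𝓕⁻ (fun ξ => symbol K ξ * 𝓕 φ ξ)

/-- The tempered distribution `|c|^N K(c ·)`, for `c ≠ 0`:
its value at `φ` is `⟨K, φ(· / c)⟩`. -/
def rescale (c : ℝ) (hc : c ≠ 0) (K : 𝓢'(RN N, ℂ)) : 𝓢'(RN N, ℂ) :=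
  PointwiseConvergenceCLM.precomp ℂ
    (SchwartzMap.compCLMOfContinuousLinearEquiv ℂ
      (ContinuousLinearEquiv.smulLeft (Units.mk0 c hc)⁻¹ : RN N ≃L[ℝ] RN N)) K

/-- The reflected kernel `x ↦ K(-x)`. -/
def reflect (K : 𝓢'(RN N, ℂ)) : 𝓢'(RN N, ℂ) :=
  rescale (-1) (by norm_num) K

/-! ### Singular kernels of fundamental type -/

/-- The tempered distribution `K` is a singular kernel of fundamental type, with constants
`C₀`, `C₁` in the bounds on `K` and on its gradient: its Fourier transform is bounded, and its
restriction to `ℝ^N ∖ {0}` is the function `k` (whose value at `0` is irrelevant), which is `C^1`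
and satisfies the size, gradient and cancellation conditions. -/
structure IsFundamentalKernel (K : 𝓢'(RN N, ℂ)) (k : RN N → ℂ) (C₀ C₁ : ℝ) : Prop where
  boundedSymbol : HasBoundedSymbol K
  restriction : ∀ φ : 𝓢(RN N, ℂ), HasCompactSupport φ → (0 : RN N) ∉ tsupport φ →
    K φ = ∫ x, k x * φ x
  contDiffOn : ContDiffOn ℝ 1 k {0}ᶜ
  nonneg_zero : 0 ≤ C₀
  size : ∀ x : RN N, x ≠ 0 → ‖k x‖ ≤ C₀ / ‖x‖ ^ N
  nonneg_one : 0 ≤ C₁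
  gradient : ∀ x : RN N, x ≠ 0 → ‖fderiv ℝ k x‖ ≤ C₁ / ‖x‖ ^ (N + 1)
  cancellation : ∃ A₂ : ℝ, 0 ≤ A₂ ∧ ∀ R₁ R₂ : ℝ, 0 < R₁ → R₁ < R₂ →
    ‖∫ x in {x : RN N | R₁ < ‖x‖ ∧ ‖x‖ < R₂}, k x‖ ≤ A₂

/-! ### The singular integral of a finite measure -/

/-- The total variation of a complex measure is finite. -/
instance isFiniteMeasure_variation {X : Type*} [MeasurableSpace X] (μ : ComplexMeasure X) :
    IsFiniteMeasure μ.variation := by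
  have h : μ.variation ≤ (ComplexMeasure.re μ).totalVariation
      + (ComplexMeasure.im μ).totalVariation := by
    refine VectorMeasure.variation_le_of_forall_enorm_le fun s hs => ?_
    rw [Measure.add_apply]
    refine le_trans ?_ (add_le_add (SignedMeasure.enorm_le_totalVariation _ s)
      (SignedMeasure.enorm_le_totalVariation _ s))
    rw [← ofReal_norm, ← ofReal_norm, ← ofReal_norm,
      ← ENNReal.ofReal_add (norm_nonneg _) (norm_nonneg _)]
    exact ENNReal.ofReal_le_ofReal (Complex.norm_le_abs_re_add_abs_im (μ s))
  exact isFiniteMeasure_of_le _ h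

theorem integrable_symbol_mul (K : 𝓢'(RN N, ℂ)) (φ : 𝓢(RN N, ℂ)) :
    Integrable (fun ξ => symbol K ξ * φ ξ) := by
  have h := (φ.memLp 1 (volume : Measure (RN N))).mul (Lp.memLp (symbol K)) (r := 1)
  exact memLp_one_iff_integrable.1 h

theorem continuous_convSchwartz (K : 𝓢'(RN N, ℂ)) (φ : 𝓢(RN N, ℂ)) :
    Continuous (convSchwartz K φ) := by
  have h : Continuous (𝓕 (fun ξ => symbol K ξ * 𝓕 φ ξ)) :=
    VectorFourier.fourierIntegral_continuous Real.continuous_fourierChar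
      (by exact continuous_inner) (integrable_symbol_mul K (𝓕 φ))
  have h' : convSchwartz K φ = fun x => 𝓕 (fun ξ => symbol K ξ * 𝓕 φ ξ) (-x) :=
    funext fun x => Real.fourierInv_eq_fourier_neg _ x
  rw [h']
  exact h.comp continuous_neg

theorem norm_convSchwartz_le (K : 𝓢'(RN N, ℂ)) (φ : 𝓢(RN N, ℂ)) (x : RN N) :
    ‖convSchwartz K φ x‖ ≤ ‖symbol K‖ * ‖(𝓕 φ).toLp 1 (volume : Measure (RN N))‖ := by
  rw [convSchwartz, Real.fourierInv_eq, SchwartzMap.norm_toLp_one, ← integral_const_mul]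
  refine norm_integral_le_of_norm_le ((SchwartzMap.integrable _).norm.const_mul _) ?_
  filter_upwards [ae_le_eLpNormEssSup (f := symbol K) (μ := (volume : Measure (RN N)))] with ξ hξ
  rw [Circle.norm_smul, norm_mul]
  gcongr
  rw [Lp.norm_def, ← ENNReal.ofReal_le_iff_le_toReal (Lp.eLpNorm_ne_top _), ofReal_norm,
    eLpNorm_exponent_top]
  exact hξ

theorem convSchwartz_add (K : 𝓢'(RN N, ℂ)) (φ ψ : 𝓢(RN N, ℂ)) :
    convSchwartz K (φ + ψ) = convSchwartz K φ + convSchwartz K ψ := by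
  funext x
  have h : ∀ θ : 𝓢(RN N, ℂ),
      Integrable (fun ξ => Real.fourierChar (inner ℝ ξ x) • (symbol K ξ * 𝓕 θ ξ)) := fun θ => by
    refine (integrable_symbol_mul K (𝓕 θ)).congr' ?_ (Filter.Eventually.of_forall fun ξ => ?_)
    · refine AEStronglyMeasurable.smul ?_ (integrable_symbol_mul K (𝓕 θ)).aestronglyMeasurable
      have hx : Continuous fun ξ : RN N => inner ℝ ξ x := continuous_id.inner continuous_const
      exact (continuous_subtype_val.comp
        (Real.continuous_fourierChar.comp hx)).aestronglyMeasurable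
    · simp only [Circle.norm_smul]
  simp only [convSchwartz, Pi.add_apply, Real.fourierInv_eq]
  rw [← integral_add (h φ) (h ψ)]
  refine integral_congr_ae (Filter.Eventually.of_forall fun ξ => ?_)
  simp only [FourierTransform.fourier_add, add_apply, mul_add, smul_add]

theorem convSchwartz_smul (K : 𝓢'(RN N, ℂ)) (c : ℂ) (φ : 𝓢(RN N, ℂ)) :
    convSchwartz K (c • φ) = c • convSchwartz K φ := by
  funext x
  simp only [convSchwartz, Pi.smul_apply, Real.fourierInv_eq]
  rw [← integral_smul]
  refine integral_congr_ae (Filter.Eventually.of_forall fun ξ => ?_)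
  simp only [FourierTransform.fourier_smul, smul_apply, smul_eq_mul, Circle.smul_def]
  ring

theorem integrable_convSchwartz (K : 𝓢'(RN N, ℂ)) (φ : 𝓢(RN N, ℂ)) (μ : ComplexMeasure (RN N)) :
    Integrable (convSchwartz K φ) μ.variation :=
  Integrable.of_bound (continuous_convSchwartz K φ).aestronglyMeasurable _
    (Filter.Eventually.of_forall (norm_convSchwartz_le K φ))

/-- The linear form `φ ↦ ∫ (K(-·) * φ) du` on Schwartz functions, for a finite (complex)
measure `u`. -/
def convMeasureLinear (K : 𝓢'(RN N, ℂ)) (u : ComplexMeasure (RN N)) : 𝓢(RN N, ℂ) →ₗ[ℂ] ℂ where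
  toFun φ := VectorMeasure.integral u (convSchwartz (reflect K) φ) (ContinuousLinearMap.mul ℝ ℂ)
  map_add' φ ψ := by
    rw [convSchwartz_add]
    exact VectorMeasure.integral_add (integrable_convSchwartz _ φ u)
      (integrable_convSchwartz _ ψ u)
  map_smul' c φ := by
    rw [convSchwartz_smul]
    refine setToFun_smul _ (fun c s x => ?_) c _
    simp only [VectorMeasure.transpose, smul_eq_mul]
    exact mul_assoc c x (u s)

theorem continuous_convMeasureLinear (K : 𝓢'(RN N, ℂ)) (u : ComplexMeasure (RN N)) :
    Continuous (convMeasureLinear K u) := by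
  have hL : Continuous fun φ : 𝓢(RN N, ℂ) =>
      ‖symbol (reflect K)‖ * ‖(𝓕 φ).toLp 1 (volume : Measure (RN N))‖
        * ‖ContinuousLinearMap.mul ℝ ℂ‖ * u.variation.real Set.univ := by
    have h1 : Continuous fun φ : 𝓢(RN N, ℂ) => (𝓕 φ).toLp 1 (volume : Measure (RN N)) :=
      SchwartzMap.continuous_toLp.comp (fourierCLM ℂ 𝓢(RN N, ℂ)).continuous
    fun_prop
  refine continuous_of_continuousAt_zero (convMeasureLinear K u) ?_
  rw [ContinuousAt, map_zero]
  refine squeeze_zero_norm (fun φ => VectorMeasure.norm_integral_le_of_norm_le_const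
    (Filter.Eventually.of_forall (norm_convSchwartz_le (reflect K) φ))) ?_
  convert hL.tendsto 0 using 2
  have h0 : (𝓕 (0 : 𝓢(RN N, ℂ))).toLp 1 (volume : Measure (RN N)) = 0 :=
    map_zero ((SchwartzMap.toLpCLM ℂ ℂ 1 (volume : Measure (RN N))).comp
      (fourierCLM ℂ 𝓢(RN N, ℂ)))
  rw [h0, norm_zero, mul_zero, zero_mul, zero_mul]

/-- For a finite (complex) measure `u`, the tempered distribution `Su = K * u` given by
`⟨Su, φ⟩ = ∫ (K(-·) * φ) du`. -/
def convMeasure (K : 𝓢'(RN N, ℂ)) (u : ComplexMeasure (RN N)) : 𝓢'(RN N, ℂ) :=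
  ContinuousLinearMap.toPointwiseConvergenceCLM _ _ _ _
    { toLinearMap := convMeasureLinear K u
      cont := continuous_convMeasureLinear K u }

theorem convMeasure_apply (K : 𝓢'(RN N, ℂ)) (u : ComplexMeasure (RN N)) (φ : 𝓢(RN N, ℂ)) :
    convMeasure K u φ = VectorMeasure.integral u (convSchwartz (reflect K) φ)
        (ContinuousLinearMap.mul ℝ ℂ) := rfl

/-! ### Maximal functions -/

/-- The dilation `f_ε(x) = ε^{-N} f(x / ε)`. -/
def dilate (f : RN N → ℂ) (ε : ℝ) (x : RN N) : ℂ :=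
  ((ε ^ N)⁻¹ : ℝ) • f (ε⁻¹ • x)

/-- The `{ρ^ν}`-maximal function `sup_ν sup_{ε > 0} |(ρ^ν_ε * v)(x)|` of a function `v`. -/
def maximalFunction {ι : Type*} (ρ : ι → RN N → ℂ) (v : RN N → ℂ) (x : RN N) : ℝ≥0∞ :=
  ⨆ (ν : ι) (ε : ℝ) (_ : 0 < ε), ‖∫ y, dilate (ρ ν) ε (x - y) * v y‖ₑ

theorem contDiff_dilate {f : RN N → ℂ} (hs : ContDiff ℝ ((⊤ : ℕ∞) : WithTop ℕ∞) f) (ε : ℝ)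
    (x : RN N) : ContDiff ℝ ((⊤ : ℕ∞) : WithTop ℕ∞) (fun y => dilate f ε (x - y)) := by
  unfold dilate
  fun_prop

theorem hasCompactSupport_dilate {f : RN N → ℂ} (hc : HasCompactSupport f) {ε : ℝ} (hε : ε ≠ 0)
    (x : RN N) : HasCompactSupport (fun y => dilate f ε (x - y)) := by
  have h := hc.comp_homeomorph
    ((Homeomorph.subLeft x).trans (Homeomorph.smulOfNeZero ε⁻¹ (inv_ne_zero hε)))
  exact h.mono fun y hy h0 => hy (by
    have h1 : f (ε⁻¹ • (x - y)) = 0 := h0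
    simp [dilate, h1])

/-- For `f` smooth with compact support and `ε > 0`, the test function `y ↦ f_ε(x - y)`. -/
def testFunction (f : RN N → ℂ) (hs : ContDiff ℝ ((⊤ : ℕ∞) : WithTop ℕ∞) f)
    (hc : HasCompactSupport f) (ε : ℝ) (hε : 0 < ε) (x : RN N) : 𝓢(RN N, ℂ) :=
  HasCompactSupport.toSchwartzMap (f := fun y => dilate f ε (x - y))
    (hasCompactSupport_dilate hc hε.ne' x)
    (contDiff_dilate hs ε x)

/-- The `{ρ^ν}`-maximal function `sup_ν sup_{ε > 0} |⟨T, ρ^ν_ε(x - ·)⟩|` of a tempered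
distribution `T`, for smooth compactly supported `ρ^ν`. -/
def maximalFunctionDistrib {ι : Type*} (ρ : ι → RN N → ℂ)
    (hs : ∀ ν, ContDiff ℝ ((⊤ : ℕ∞) : WithTop ℕ∞) (ρ ν)) (hc : ∀ ν, HasCompactSupport (ρ ν))
    (T : 𝓢'(RN N, ℂ)) (x : RN N) : ℝ≥0∞ :=
  ⨆ (ν : ι) (ε : ℝ) (hε : 0 < ε), ‖T (testFunction (ρ ν) (hs ν) (hc ν) ε hε x)‖ₑ

/-- The weak `L^1` quantity `|||f|||_{M^1} = sup_{λ > 0} λ |{f > λ}|` of a `[0, ∞]`-valued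
function on `ℝ^N`. -/
def weakL1 (f : RN N → ℝ≥0∞) : ℝ≥0∞ :=
  ⨆ (r : ℝ) (_ : 0 < r), ENNReal.ofReal r * volume {x | ENNReal.ofReal r < f x}

/-- A bounded function vanishing outside the unit ball belongs to `L²`. -/
theorem memLp_two_of_unitBall {f : RN N → ℂ} (hf : MemLp f ∞ volume)
    (h0 : ∀ᵐ x, x ∉ Metric.ball (0 : RN N) 1 → f x = 0) : MemLp f 2 volume := by
  have h1 : (Metric.ball (0 : RN N) 1).indicator f =ᵐ[volume] f := by
    filter_upwards [h0] with x hx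
    by_cases hb : x ∈ Metric.ball (0 : RN N) 1
    · simp [hb]
    · rw [Set.indicator_of_notMem hb, hx hb]
  refine MemLp.ae_eq h1 ((memLp_indicator_iff_restrict measurableSet_ball).2 ?_)
  have : IsFiniteMeasure (volume.restrict (Metric.ball (0 : RN N) 1)) :=
    ⟨by simpa using measure_ball_lt_top⟩
  exact (hf.restrict _).mono_exponent le_top

theorem hasBoundedSymbol_rescale {K : 𝓢'(RN N, ℂ)} (h : HasBoundedSymbol K) (c : ℝ)
    (hc : c ≠ 0) : HasBoundedSymbol (rescale c hc K) := by
  obtain ⟨m, hm⟩ := h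
  have hq : Measure.QuasiMeasurePreserving (fun ξ : RN N => c⁻¹ • ξ) volume volume := by
    refine ⟨measurable_const_smul _, ?_⟩
    rw [Measure.map_addHaar_smul _ (inv_ne_zero hc)]
    exact Measure.smul_absolutelyContinuous
  have hM : MemLp (fun ξ => m (c⁻¹ • ξ)) ∞ (volume : Measure (RN N)) := by
    refine memLp_top_of_bound ((Lp.aestronglyMeasurable m).comp_quasiMeasurePreserving hq) ‖m‖ ?_
    refine hq.ae (p := fun ξ => ‖m ξ‖ ≤ ‖m‖) ?_
    filter_upwards [ae_le_eLpNormEssSup (f := m) (μ := (volume : Measure (RN N)))] with ξ hξ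
    rw [Lp.norm_def, ← ENNReal.ofReal_le_iff_le_toReal (Lp.eLpNorm_ne_top _), ofReal_norm,
      eLpNorm_exponent_top]
    exact hξ
  refine ⟨hM.toLp _, ?_⟩
  ext φ
  let e : RN N ≃L[ℝ] RN N := ContinuousLinearEquiv.smulLeft (Units.mk0 c hc)
  let ψ : 𝓢(RN N, ℂ) := SchwartzMap.compCLMOfContinuousLinearEquiv ℂ e φ
  have hψ : ∀ ξ, ψ ξ = φ (c • ξ) := fun ξ => rfl
  have h1 : 𝓕 (rescale c hc K) φ = K ((|c| ^ N : ℝ) • 𝓕 ψ) := by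
    change K (SchwartzMap.compCLMOfContinuousLinearEquiv ℂ _ (𝓕 φ)) = _
    congr 1
    ext ξ
    change 𝓕 (φ : RN N → ℂ) (c⁻¹ • ξ) = (|c| ^ N : ℝ) • 𝓕 (ψ : RN N → ℂ) ξ
    rw [Real.fourier_eq, Real.fourier_eq]
    have h2 := Measure.integral_comp_smul (volume : Measure (RN N))
      (fun v => Real.fourierChar (-inner ℝ v (c⁻¹ • ξ)) • φ v) c
    have h3 : ∀ v : RN N, inner ℝ (c • v) (c⁻¹ • ξ) = inner ℝ v ξ := fun v => by
      rw [inner_smul_left, inner_smul_right]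
      simp [hc]
    simp only [h3] at h2
    simp only [hψ]
    rw [h2, smul_smul, finrank_euclideanSpace_fin, abs_inv, abs_pow, mul_inv_cancel₀, one_smul]
    positivity
  have h4 : K ((|c| ^ N : ℝ) • 𝓕 ψ) = ((|c| ^ N : ℝ) : ℂ) • K (𝓕 ψ) := by
    rw [← map_smul]
    congr 1
  rw [h1, h4]
  change _ • (𝓕 K) ψ = _
  rw [hm, Lp.toTemperedDistribution_apply, Lp.toTemperedDistribution_apply]
  have h5 : ∫ x, φ x • (hM.toLp _ : RN N → ℂ) x = ∫ x, φ x • m (c⁻¹ • x) := by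
    refine integral_congr_ae ?_
    filter_upwards [hM.coeFn_toLp] with x hx
    rw [hx]
  have h6 := Measure.integral_comp_smul (volume : Measure (RN N))
    (fun v => φ v • m (c⁻¹ • v)) c
  simp only [inv_smul_smul₀ hc] at h6
  rw [h5]
  simp only [hψ]
  rw [h6, finrank_euclideanSpace_fin, abs_inv, abs_pow, ← Complex.coe_smul, smul_smul,
    ← Complex.ofReal_mul, mul_inv_cancel₀, Complex.ofReal_one, one_smul]
  positivity

end SingularMaximal

end

open SingularMaximal

/-!
The proof compares the mollifications of `K * u` with truncated singular integrals.

Write `K * u` for `convL2 K u`, and `k_ε` for the kernel `k` cut off continuously at distance `ε`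
from the origin. Convolution operators commute, so that `ρ_ε * (K * u) = (K * ρ_ε) * u`
(`integral_dilate_mul_convL2`). The function `K * ρ_ε` is the dilation of `(ε^N K(ε ·)) * ρ`
(`convL2_dilate_ae_eq`), hence bounded by `Q₂ ε^{-N}`; and at distance more than `2 ε` from the
origin it is given by integration against `k`, so that it differs from `(∫ ρ) k` by an error
controlled by the gradient of `k`. Together, `|K * ρ_ε - (∫ ρ) k_ε| ≤ C (Q₂ + Q₁ (C₀ + C₁)) ε / (ε
+ |z|)^{N+1}` (`IsFundamentalKernel.norm_convL2_sub_le`). Convolution with the right-hand side is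
dominated by the Hardy-Littlewood maximal function `Mu` (`lintegral_majorant_mul_le`), and
therefore, pointwise, `M_{ρ^ν}(K * u) ≤ Q₁ T^* u + C (Q₂ + Q₁ (C₀ + C₁)) M u`, where `T^* u =
sup_ε |k_ε * u|`.

The maximal truncated operator `T^*` is handled by the same comparison, read backwards. With a
fixed mollifier `β` in place of `ρ` it gives `T^* u ≤ C M(K * u) + C A M u`, where `A = C₀ + C₁ +
‖K̂‖_∞`, since `|K * β_ε| ≤ ‖K̂‖_∞ ‖β̂_ε‖_1` is bounded by a multiple of `‖K̂‖_∞ ε^{-N}`. So `T^*`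
is bounded on `L²` (`exists_lintegral_maximalTrunc_sq_le`). The kernels `k_ε` satisfy a Hörmander
condition uniform in `ε`, and a Calderón-Zygmund decomposition (`exists_good_add_bad`), with
stopping sets built from a Vitali covering, gives the weak type `(1, 1)` bound for `T^*`
(`exists_weakL1_maximalTrunc_le`) and so the weak estimate for `u ∈ L¹ ∩ L²`.

For a finite measure `u`, mollification provides `u_n ∈ L¹ ∩ L²` with `‖u_n‖_1 ≤ ‖u‖` along which
`ρ_ε * (K * u_n)` converges at every point (`exists_tendsto_integral`). Superlevel sets of the
maximal function of the limit lie in the lower limit of the corresponding sets for `u_n`, and the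
constant is preserved (`weakL1_maximalFunctionDistrib_le`). The `L²` estimate only uses that the
maximal function along bounded `ρ^ν` supported in the unit ball is dominated by `M(K * u)`
(`eLpNorm_maximalFunction_le`).
-/

noncomputable section

namespace SingularMaximal

open Set Filter Topology Metric

variable {N : ℕ}

/-! ### The Hardy-Littlewood maximal function -/

/-- The centred Hardy-Littlewood maximal function of a `[0, ∞]`-valued function, the supremum of
its averages over the open balls with a given centre. -/
def hlMax (f : RN N → ℝ≥0∞) (x : RN N) : ℝ≥0∞ :=
  ⨆ (r : ℝ) (_ : 0 < r), (volume (ball x r))⁻¹ * ∫⁻ y in ball x r, f y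

theorem volume_ball_eq (x : RN N) {r : ℝ} (hr : 0 < r) :
    volume (ball x r) = ENNReal.ofReal (r ^ N) * volume (ball (0 : RN N) 1) := by
  simpa using Measure.addHaar_ball_of_pos volume x hr

theorem volume_ball_mul (x : RN N) {r s : ℝ} (hs : 0 < s) (hr : 0 < r) :
    volume (ball x (s * r)) = ENNReal.ofReal (s ^ N) * volume (ball x r) := by
  rw [volume_ball_eq x hr, volume_ball_eq x (mul_pos hs hr), mul_pow,
    ENNReal.ofReal_mul (by positivity), mul_assoc]

theorem volume_closedBall_eq (x : RN N) {r : ℝ} (hr : 0 < r) :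
    volume (closedBall x r) = ENNReal.ofReal (r ^ N) * volume (ball (0 : RN N) 1) := by
  simpa using Measure.addHaar_closedBall volume x hr.le

theorem volume_ball_ne_zero (x : RN N) {r : ℝ} (hr : 0 < r) : volume (ball x r) ≠ 0 :=
  (measure_ball_pos volume x hr).ne'

theorem lintegral_ball_le_hlMax (f : RN N → ℝ≥0∞) (x : RN N) {r : ℝ} (hr : 0 < r) :
    ∫⁻ y in ball x r, f y ≤ volume (ball x r) * hlMax f x := by
  have h : (volume (ball x r))⁻¹ * ∫⁻ y in ball x r, f y ≤ hlMax f x :=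
    le_iSup₂ (f := fun (r : ℝ) (_ : 0 < r) => (volume (ball x r))⁻¹ * ∫⁻ y in ball x r, f y) r hr
  calc ∫⁻ y in ball x r, f y
      = volume (ball x r) * ((volume (ball x r))⁻¹ * ∫⁻ y in ball x r, f y) := by
        rw [← mul_assoc, ENNReal.mul_inv_cancel (volume_ball_ne_zero x hr) measure_ball_lt_top.ne,
          one_mul]
    _ ≤ _ := by gcongr

theorem hlMax_mono {f g : RN N → ℝ≥0∞} (h : ∀ x, f x ≤ g x) (x : RN N) : hlMax f x ≤ hlMax g x := by
  unfold hlMax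
  gcongr with r hr y
  exact h y

theorem hlMax_const_add_le (c : ℝ≥0∞) {f : RN N → ℝ≥0∞} (x : RN N) :
    hlMax (fun y => c + f y) x ≤ c + hlMax f x := by
  refine iSup₂_le fun r hr => ?_
  rw [lintegral_add_left measurable_const, setLIntegral_const, mul_add, mul_comm c, ← mul_assoc,
    ENNReal.inv_mul_cancel (volume_ball_ne_zero x hr) measure_ball_lt_top.ne, one_mul]
  gcongr
  exact le_iSup₂ (f := fun (r : ℝ) (_ : 0 < r) =>
    (volume (ball x r))⁻¹ * ∫⁻ y in ball x r, f y) r hr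

/-- The maximal function is lower semicontinuous. -/
theorem isOpen_lt_hlMax (f : RN N → ℝ≥0∞) (a : ℝ≥0∞) : IsOpen {x | a < hlMax f x} := by
  rw [isOpen_iff_mem_nhds]
  intro x hx
  simp only [mem_ofPred_eq, hlMax, lt_iSup_iff] at hx
  obtain ⟨r, hr, hx⟩ := hx
  set I := ∫⁻ y in ball x r, f y
  have hI : I ≠ 0 := by
    rintro h
    simp [h] at hx
  have hlim : Tendsto (fun s : ℝ => (ENNReal.ofReal (s ^ N) * volume (ball (0 : RN N) 1))⁻¹ * I)
      (𝓝[>] r) (𝓝 ((ENNReal.ofReal (r ^ N) * volume (ball (0 : RN N) 1))⁻¹ * I)) := by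
    refine Tendsto.mono_left ?_ nhdsWithin_le_nhds
    refine ENNReal.Tendsto.mul_const ?_ (Or.inl ?_)
    · refine tendsto_inv_iff.2 ?_
      refine ENNReal.Tendsto.mul_const ?_ (Or.inr measure_ball_lt_top.ne)
      exact ENNReal.tendsto_ofReal ((continuous_pow N).tendsto r)
    · exact ENNReal.inv_ne_zero.2 (ENNReal.mul_ne_top ENNReal.ofReal_ne_top measure_ball_lt_top.ne)
  rw [volume_ball_eq x hr] at hx
  -- a slightly larger radius still gives an average above `a`, and the ball of that radius about
  -- any nearby centre contains the ball of radius `r` about `x`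
  obtain ⟨s, hs, hrs⟩ := ((hlim.eventually_const_lt hx).and self_mem_nhdsWithin).exists
  have hrs : r < s := hrs
  filter_upwards [ball_mem_nhds x (sub_pos.2 hrs)] with z hz
  have hsub : ball x r ⊆ ball z s := by
    intro y hy
    rw [mem_ball] at *
    have := dist_triangle y x z
    rw [dist_comm x z] at this
    linarith
  refine hs.trans_le ?_
  rw [← volume_ball_eq z (hr.trans hrs)]
  refine le_trans ?_ (le_iSup₂ (f := fun (r : ℝ) (_ : 0 < r) =>
    (volume (ball z r))⁻¹ * ∫⁻ y in ball z r, f y) s (hr.trans hrs))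
  gcongr
  exact lintegral_mono_set hsub

theorem measurable_hlMax (f : RN N → ℝ≥0∞) : Measurable (hlMax f) :=
  measurable_of_Ioi fun a => (isOpen_lt_hlMax f a).measurableSet

/-- A positive radius whose ball has volume at most `V` is bounded in terms of `V`. -/
theorem exists_radius_bound (hN : 0 < N) {V : ℝ≥0∞} (hV : V ≠ ∞) :
    ∃ R : ℝ, ∀ (x : RN N) (r : ℝ), volume (ball x r) ≤ V → r ≤ R := by
  have hω : volume (ball (0 : RN N) 1) ≠ 0 := volume_ball_ne_zero 0 one_pos
  have hω' : volume (ball (0 : RN N) 1) ≠ ∞ := measure_ball_lt_top.ne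
  have hq : V / volume (ball (0 : RN N) 1) ≠ ∞ := ENNReal.div_ne_top hV hω
  refine ⟨max 1 (V / volume (ball (0 : RN N) 1)).toReal, fun x r h => ?_⟩
  by_cases hr : r ≤ 1
  · exact hr.trans (le_max_left _ _)
  push Not at hr
  rw [volume_ball_eq x (one_pos.trans hr)] at h
  have h1 : ENNReal.ofReal (r ^ N) ≤ V / volume (ball (0 : RN N) 1) :=
    (ENNReal.le_div_iff_mul_le (Or.inl hω) (Or.inl hω')).2 h
  have h2 : r ^ N ≤ (V / volume (ball (0 : RN N) 1)).toReal :=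
    (ENNReal.ofReal_le_iff_le_toReal hq).1 h1
  exact ((le_self_pow₀ hr.le hN.ne').trans h2).trans (le_max_right _ _)

/-- The weak type `(1, 1)` inequality for the Hardy-Littlewood maximal function; the factor `5 ^ N`
comes from the Vitali covering lemma. -/
theorem mul_volume_lt_hlMax_le (hN : 0 < N) (f : RN N → ℝ≥0∞) (t : ℝ≥0∞) :
    t * volume {x | t < hlMax f x} ≤ ENNReal.ofReal (5 ^ N) * ∫⁻ y, f y := by
  rcases eq_or_ne t 0 with rfl | ht0
  · simp
  rcases eq_or_ne t ∞ with rfl | htop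
  · simp
  rcases eq_or_ne (∫⁻ y, f y) ∞ with hf | hf
  · rw [hf, ENNReal.mul_top (by simp)]
    exact le_top
  have hex : ∀ x : RN N, ∃ r : ℝ, x ∈ {x | t < hlMax f x} →
      0 < r ∧ t * volume (ball x r) ≤ ∫⁻ y in ball x r, f y := by
    intro x
    by_cases hx : t < hlMax f x
    · have hx' := hx
      simp only [hlMax, lt_iSup_iff] at hx'
      obtain ⟨r, hr, h⟩ := hx'
      refine ⟨r, fun _ => ⟨hr, ?_⟩⟩
      have h' := h.le
      rw [mul_comm, ← div_eq_mul_inv] at h'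
      exact (ENNReal.le_div_iff_mul_le (Or.inl (volume_ball_ne_zero x hr))
        (Or.inl measure_ball_lt_top.ne)).1 h'
    · exact ⟨0, fun h => absurd h hx⟩
  choose r hr using hex
  obtain ⟨R, hR⟩ := exists_radius_bound hN (ENNReal.div_ne_top hf ht0)
  have hrR : ∀ x ∈ {x | t < hlMax f x}, r x ≤ R := by
    intro x hx
    refine hR x _ ?_
    refine (ENNReal.le_div_iff_mul_le (Or.inl ht0) (Or.inl htop)).2 ?_
    rw [mul_comm]
    exact (hr x hx).2.trans (setLIntegral_le_lintegral _ _)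
  obtain ⟨v, hv, hdis, hcov⟩ := Vitali.exists_disjoint_subfamily_covering_enlargement_closedBall
    {x | t < hlMax f x} id r R hrR 5 (by norm_num)
  have hvc : v.Countable := by
    refine hdis.countable_of_nonempty_interior fun a ha => ?_
    exact ⟨a, ball_subset_interior_closedBall (mem_ball_self (hr a (hv ha)).1)⟩
  have hdis' : v.PairwiseDisjoint fun a => ball a (r a) :=
    hdis.mono fun a => ball_subset_closedBall
  have hsub : {x | t < hlMax f x} ⊆ ⋃ a ∈ v, closedBall a (5 * r a) := by
    intro x hx
    obtain ⟨b, hb, hxb⟩ := hcov x hx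
    exact mem_biUnion hb (hxb (mem_closedBall_self (hr x hx).1.le))
  calc t * volume {x | t < hlMax f x}
      ≤ t * ∑' a : v, volume (closedBall (a : RN N) (5 * r a)) := by
        gcongr
        exact (measure_mono hsub).trans (measure_biUnion_le _ hvc _)
    _ = ∑' a : v, ENNReal.ofReal (5 ^ N) * (t * volume (ball (a : RN N) (r a))) := by
        rw [← ENNReal.tsum_mul_left]
        congr 1
        ext a
        have ha := (hr a (hv a.2)).1
        rw [volume_closedBall_eq _ (by positivity), volume_ball_eq _ ha, mul_pow,
          ENNReal.ofReal_mul (by positivity)]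
        ring
    _ ≤ ∑' a : v, ENNReal.ofReal (5 ^ N) * ∫⁻ y in ball (a : RN N) (r a), f y := by
        gcongr with a
        exact (hr a (hv a.2)).2
    _ = ENNReal.ofReal (5 ^ N) * ∫⁻ y in ⋃ a ∈ v, ball (a : RN N) (r a), f y := by
        rw [ENNReal.tsum_mul_left, lintegral_biUnion hvc (fun a _ => measurableSet_ball) hdis']
    _ ≤ _ := by
        gcongr
        exact Measure.restrict_le_self

/-- The weak type `(1, 1)` inequality at height `2 t` only sees the part of `f` above `t`. -/
theorem mul_volume_two_mul_lt_hlMax_le (hN : 0 < N) {f : RN N → ℝ≥0∞} (hf : Measurable f)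
    {t : ℝ≥0∞} (ht : t ≠ ∞) :
    t * volume {x | 2 * t < hlMax f x} ≤
      ENNReal.ofReal (5 ^ N) * ∫⁻ y in {y | t < f y}, f y := by
  have hm : MeasurableSet {y | t < f y} := measurableSet_lt measurable_const hf
  rw [← lintegral_indicator hm]
  refine le_trans ?_ (mul_volume_lt_hlMax_le hN _ t)
  gcongr t * volume ?_
  intro x hx
  have h1 : hlMax f x ≤ t + hlMax ({y | t < f y}.indicator f) x := by
    refine (hlMax_mono (fun y => ?_) x).trans (hlMax_const_add_le t x)
    by_cases hy : t < f y
    · rw [indicator_of_mem (show y ∈ {y | t < f y} from hy)]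
      exact le_add_self
    · exact (not_lt.1 hy).trans le_self_add
  have hx : 2 * t < hlMax f x := hx
  rw [two_mul] at hx
  exact (ENNReal.add_lt_add_iff_left ht).1 (hx.trans_le h1)

/-- The layer cake formula for `a ^ 2`, as an inequality valid also for `a = ∞`. -/
theorem lintegral_indicator_Ioi_le_sq (a : ℝ≥0∞) :
    a ^ 2 ≤ ∫⁻ t in Ioi (0 : ℝ), {t : ℝ | ENNReal.ofReal t < a}.indicator
      (fun t => ENNReal.ofReal (2 * t)) t := by
  have hm : MeasurableSet {t : ℝ | ENNReal.ofReal t < a} :=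
    measurableSet_lt ENNReal.measurable_ofReal measurable_const
  rw [lintegral_indicator hm, Measure.restrict_restrict hm]
  rcases eq_or_ne a ∞ with rfl | ha
  · refine le_trans ?_ (lintegral_mono_set (s := Ioi (1 : ℝ)) fun t ht =>
      ⟨ENNReal.ofReal_lt_top, (one_pos.trans (mem_Ioi.1 ht) : (0 : ℝ) < t)⟩)
    have : ∫⁻ _ in Ioi (1 : ℝ), (1 : ℝ≥0∞) ≤ ∫⁻ t in Ioi (1 : ℝ), ENNReal.ofReal (2 * t) := by
      refine setLIntegral_mono' measurableSet_Ioi fun t ht => ?_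
      rw [← ENNReal.ofReal_one]
      refine ENNReal.ofReal_le_ofReal ?_
      have := mem_Ioi.1 ht
      linarith
    refine le_trans ?_ this
    simp
  · lift a to ℝ≥0 using ha
    have hset : {t : ℝ | ENNReal.ofReal t < a} ∩ Ioi 0 = Ioo 0 (a : ℝ) := by
      ext t
      simp only [mem_inter_iff, mem_ofPred_eq, mem_Ioi, mem_Ioo]
      constructor
      · rintro ⟨h1, h2⟩
        exact ⟨h2, by
          rw [← ENNReal.ofReal_coe_nnreal] at h1
          exact (ENNReal.ofReal_lt_ofReal_iff_of_nonneg h2.le).1 h1⟩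
      · rintro ⟨h1, h2⟩
        refine ⟨?_, h1⟩
        rw [← ENNReal.ofReal_coe_nnreal]
        exact (ENNReal.ofReal_lt_ofReal_iff_of_nonneg h1.le).2 h2
    rw [hset, ← ofReal_integral_eq_lintegral_ofReal]
    · rw [← integral_Ioc_eq_integral_Ioo, ← intervalIntegral.integral_of_le (NNReal.coe_nonneg a),
        intervalIntegral.integral_const_mul, integral_id, ← ENNReal.ofReal_coe_nnreal,
        ← ENNReal.ofReal_pow (NNReal.coe_nonneg a)]
      apply ENNReal.ofReal_le_ofReal
      apply le_of_eq
      ring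
    · exact ((by fun_prop : Continuous fun t : ℝ => 2 * t).integrableOn_Icc).mono_set
        Ioo_subset_Icc_self
    · filter_upwards [ae_restrict_mem measurableSet_Ioo] with t ht
      have := ht.1
      positivity

/-- The layer cake formula for `a`, as an inequality. -/
theorem lintegral_indicator_Ioi_one_le (a : ℝ≥0∞) :
    ∫⁻ t in Ioi (0 : ℝ), {t : ℝ | ENNReal.ofReal t < a}.indicator 1 t ≤ a := by
  have hm : MeasurableSet {t : ℝ | ENNReal.ofReal t < a} :=
    measurableSet_lt ENNReal.measurable_ofReal measurable_const
  rcases eq_or_ne a ∞ with rfl | ha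
  · exact le_top
  rw [lintegral_indicator_one hm, Measure.restrict_apply hm]
  lift a to ℝ≥0 using ha
  calc _ ≤ volume (Ioo 0 (a : ℝ)) := by
        refine measure_mono fun t ht => ⟨ht.2, ?_⟩
        have h1 : ENNReal.ofReal t < a := ht.1
        rw [← ENNReal.ofReal_coe_nnreal] at h1
        exact (ENNReal.ofReal_lt_ofReal_iff_of_nonneg (le_of_lt ht.2)).1 h1
    _ = a := by simp

/-- The Hardy-Littlewood maximal inequality in `L²`, obtained from the weak type inequality by
integration over the levels. -/
theorem lintegral_hlMax_sq_le (hN : 0 < N) {f : RN N → ℝ≥0∞} (hf : Measurable f) :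
    ∫⁻ x, hlMax f x ^ 2 ≤ ENNReal.ofReal (8 * 5 ^ N) * ∫⁻ x, f x ^ 2 := by
  have hM := measurable_hlMax f
  calc ∫⁻ x, hlMax f x ^ 2 = ∫⁻ x, 4 * (hlMax f x / 2) ^ 2 := by
        congr 1
        ext x
        rw [show (4 : ℝ≥0∞) = 2 ^ 2 by norm_num, ← mul_pow,
          ENNReal.mul_div_cancel (by norm_num) (by norm_num)]
    _ ≤ ∫⁻ x, 4 * ∫⁻ t in Ioi (0 : ℝ), {t : ℝ | ENNReal.ofReal t < hlMax f x / 2}.indicator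
          (fun t => ENNReal.ofReal (2 * t)) t := by
        gcongr with x
        exact lintegral_indicator_Ioi_le_sq _
    _ = 4 * ∫⁻ t in Ioi (0 : ℝ), ∫⁻ x,
          {p : RN N × ℝ | ENNReal.ofReal p.2 < hlMax f p.1 / 2}.indicator
            (fun p => ENNReal.ofReal (2 * p.2)) (x, t) := by
        have hm : Measurable ({p : RN N × ℝ | ENNReal.ofReal p.2 < hlMax f p.1 / 2}.indicator
            (fun p => ENNReal.ofReal (2 * p.2))) := by
          refine Measurable.indicator (by fun_prop) (measurableSet_lt (by fun_prop) ?_)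
          exact (hM.comp measurable_fst).div_const 2
        rw [lintegral_const_mul' _ _ (by norm_num)]
        exact congrArg (4 * ·) (lintegral_lintegral_swap (f := fun x t =>
          {p : RN N × ℝ | ENNReal.ofReal p.2 < hlMax f p.1 / 2}.indicator
            (fun p => ENNReal.ofReal (2 * p.2)) (x, t)) hm.aemeasurable)
    _ ≤ 4 * ∫⁻ t in Ioi (0 : ℝ), ENNReal.ofReal (2 * 5 ^ N) * ∫⁻ x,
          {p : RN N × ℝ | ENNReal.ofReal p.2 < f p.1}.indicator (fun p => f p.1) (x, t) := by
        gcongr 4 * ?_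
        refine setLIntegral_mono' measurableSet_Ioi fun t ht => ?_
        have ht : 0 < t := ht
        have h1 := mul_volume_two_mul_lt_hlMax_le hN hf (t := ENNReal.ofReal t)
          ENNReal.ofReal_ne_top
        have hm1 : MeasurableSet {x | 2 * ENNReal.ofReal t < hlMax f x} :=
          measurableSet_lt measurable_const hM
        have hm2 : MeasurableSet {x | ENNReal.ofReal t < f x} :=
          measurableSet_lt measurable_const hf
        have h2 : ∫⁻ x, {p : RN N × ℝ | ENNReal.ofReal p.2 < hlMax f p.1 / 2}.indicator
            (fun p => ENNReal.ofReal (2 * p.2)) (x, t) =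
            2 * (ENNReal.ofReal t * volume {x | 2 * ENNReal.ofReal t < hlMax f x}) := by
          have h4 : (2 : ℝ≥0∞) * ENNReal.ofReal t = ENNReal.ofReal (2 * t) := by
            rw [ENNReal.ofReal_mul (by norm_num), ENNReal.ofReal_ofNat]
          rw [← mul_assoc, ← lintegral_indicator_const hm1, h4]
          congr 1
          ext x
          simp only [indicator, mem_ofPred_eq]
          rw [← h4]
          congr 1
          rw [ENNReal.lt_div_iff_mul_lt (Or.inl (by norm_num)) (Or.inl (by norm_num)), mul_comm]
        have h3 : ∫⁻ x, {p : RN N × ℝ | ENNReal.ofReal p.2 < f p.1}.indicator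
            (fun p => f p.1) (x, t) = ∫⁻ x in {x | ENNReal.ofReal t < f x}, f x := by
          rw [← lintegral_indicator hm2]
          rfl
        rw [h2, h3, ENNReal.ofReal_mul (by norm_num), ENNReal.ofReal_ofNat, mul_assoc]
        gcongr
    _ = ENNReal.ofReal (8 * 5 ^ N) * ∫⁻ x, ∫⁻ t in Ioi (0 : ℝ),
          {p : RN N × ℝ | ENNReal.ofReal p.2 < f p.1}.indicator (fun p => f p.1) (x, t) := by
        have hm : Measurable ({p : RN N × ℝ | ENNReal.ofReal p.2 < f p.1}.indicator
            (fun p => f p.1)) :=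
          Measurable.indicator (by fun_prop) (measurableSet_lt (by fun_prop) (by fun_prop))
        rw [lintegral_const_mul' _ _ ENNReal.ofReal_ne_top, ← mul_assoc,
          lintegral_lintegral_swap (f := fun x t => {p : RN N × ℝ | ENNReal.ofReal p.2 <
            f p.1}.indicator (fun p => f p.1) (x, t)) hm.aemeasurable]
        congr 1
        rw [← ENNReal.ofReal_ofNat 4, ← ENNReal.ofReal_mul (by norm_num)]
        congr 1
        ring
    _ ≤ _ := by
        gcongr with x
        calc _ = ∫⁻ t in Ioi (0 : ℝ), f x * {t : ℝ | ENNReal.ofReal t < f x}.indicator 1 t := by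
              congr 1
              ext t
              simp [indicator]
          _ = f x * ∫⁻ t in Ioi (0 : ℝ), {t : ℝ | ENNReal.ofReal t < f x}.indicator 1 t := by
              refine lintegral_const_mul _ ?_
              exact measurable_const.indicator
                (measurableSet_lt ENNReal.measurable_ofReal measurable_const)
          _ ≤ f x * f x := by
              gcongr
              exact lintegral_indicator_Ioi_one_le _
          _ = f x ^ 2 := (sq _).symm

/-! ### Majorization of convolutions by the maximal function -/

/-- The model majorant `ε / (ε + |z|)^(N + 1)`, an approximate identity at scale `ε` with the
decay of the difference of two translates of a singular kernel. -/
def majorant (ε : ℝ) (z : RN N) : ℝ := ε / (ε + ‖z‖) ^ (N + 1)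

theorem majorant_nonneg {ε : ℝ} (hε : 0 < ε) (z : RN N) : 0 ≤ majorant ε z := by
  unfold majorant
  positivity

theorem continuous_majorant {ε : ℝ} (hε : 0 < ε) : Continuous (majorant ε : RN N → ℝ) := by
  unfold majorant
  refine Continuous.div continuous_const (by fun_prop) fun z => ?_
  positivity

theorem majorant_le {ε : ℝ} (hε : 0 < ε) (z : RN N) : majorant ε z ≤ (ε ^ N)⁻¹ := by
  unfold majorant
  rw [div_le_iff₀ (by positivity), inv_mul_eq_div, le_div_iff₀ (by positivity), ← pow_succ']
  gcongr
  linarith [norm_nonneg z]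

/-- Decomposition of the majorant over the dyadic balls of radius `2 ^ (k + 1) * ε`. -/
theorem ofReal_majorant_le_tsum {ε : ℝ} (hε : 0 < ε) (x y : RN N) :
    ENNReal.ofReal (majorant ε (x - y)) ≤ ∑' k : ℕ,
      ENNReal.ofReal ((2 ^ (k * (N + 1)) * ε ^ N)⁻¹) *
        (ball x (2 ^ (k + 1) * ε)).indicator 1 y := by
  have hkey : ∃ k : ℕ, majorant ε (x - y) ≤ (2 ^ (k * (N + 1)) * ε ^ N)⁻¹ ∧
      y ∈ ball x (2 ^ (k + 1) * ε) := by
    by_cases h : ‖x - y‖ < ε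
    · refine ⟨0, by simpa using majorant_le hε (x - y), ?_⟩
      rw [mem_ball, dist_comm, dist_eq_norm, zero_add, pow_one]
      linarith
    · push Not at h
      obtain ⟨k, h1, h2⟩ := exists_nat_pow_near (one_le_div hε |>.2 h) (one_lt_two)
      rw [le_div_iff₀ hε] at h1
      rw [div_lt_iff₀ hε] at h2
      refine ⟨k, ?_, ?_⟩
      · unfold majorant
        rw [div_le_iff₀ (by positivity), inv_mul_eq_div, le_div_iff₀ (by positivity)]
        calc ε * (2 ^ (k * (N + 1)) * ε ^ N) = (2 ^ k * ε) ^ (N + 1) := by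
              rw [mul_pow, ← pow_mul]
              ring
          _ ≤ _ := by
              gcongr
              linarith
      · rw [mem_ball, dist_comm, dist_eq_norm]
        exact h2
  obtain ⟨k, h1, h2⟩ := hkey
  refine le_trans ?_ (ENNReal.le_tsum k)
  rw [indicator_of_mem h2, Pi.one_apply, mul_one]
  exact ENNReal.ofReal_le_ofReal h1

/-- Convolution with the majorant is controlled by the maximal function, at every scale. -/
theorem lintegral_majorant_mul_le {ε : ℝ} (hε : 0 < ε) {f : RN N → ℝ≥0∞} (hf : Measurable f)
    (x : RN N) :
    ∫⁻ y, ENNReal.ofReal (majorant ε (x - y)) * f y ≤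
      ENNReal.ofReal (2 ^ (N + 1)) * volume (ball (0 : RN N) 1) * hlMax f x := by
  calc ∫⁻ y, ENNReal.ofReal (majorant ε (x - y)) * f y
      ≤ ∫⁻ y, ∑' k : ℕ, ENNReal.ofReal ((2 ^ (k * (N + 1)) * ε ^ N)⁻¹) *
        (ball x (2 ^ (k + 1) * ε)).indicator f y := by
        refine lintegral_mono fun y => ?_
        refine (mul_le_mul_left (ofReal_majorant_le_tsum hε x y) (f y)).trans ?_
        rw [← ENNReal.tsum_mul_right]
        refine ENNReal.tsum_le_tsum fun k => ?_
        rw [mul_assoc]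
        refine mul_le_mul_right ?_ _
        by_cases h : y ∈ ball x (2 ^ (k + 1) * ε) <;> simp [h]
    _ = ∑' k : ℕ, ENNReal.ofReal ((2 ^ (k * (N + 1)) * ε ^ N)⁻¹) *
        ∫⁻ y in ball x (2 ^ (k + 1) * ε), f y := by
        rw [lintegral_tsum fun k => by
          exact ((hf.indicator measurableSet_ball).const_mul _).aemeasurable]
        congr 1
        ext k
        rw [lintegral_const_mul _ (hf.indicator measurableSet_ball),
          lintegral_indicator measurableSet_ball]
    _ ≤ ∑' k : ℕ, 2⁻¹ ^ k * (ENNReal.ofReal (2 ^ N) *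
          (volume (ball (0 : RN N) 1) * hlMax f x)) := by
        refine ENNReal.tsum_le_tsum fun k => ?_
        refine (mul_le_mul_right (lintegral_ball_le_hlMax f x (by positivity)) _).trans ?_
        rw [volume_ball_eq x (by positivity), ← mul_assoc, ← mul_assoc, ← mul_assoc, ← mul_assoc,
          ← ENNReal.ofReal_mul (by positivity)]
        gcongr
        rw [← ENNReal.ofReal_ofNat 2, ← ENNReal.ofReal_inv_of_pos (by norm_num),
          ← ENNReal.ofReal_pow (by norm_num), ← ENNReal.ofReal_mul (by positivity)]
        apply ENNReal.ofReal_le_ofReal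
        apply le_of_eq
        have h2 : (2 : ℝ)⁻¹ ^ k * 2 ^ k = 1 := by rw [← mul_pow]; norm_num
        rw [inv_mul_eq_div, div_eq_iff (by positivity)]
        linear_combination (-(2 ^ (k * N) * 2 ^ N * ε ^ N : ℝ)) * h2
    _ = _ := by
        rw [ENNReal.tsum_mul_right, ENNReal.tsum_geometric, ENNReal.one_sub_inv_two, inv_inv,
          pow_succ, ENNReal.ofReal_mul (by positivity), ENNReal.ofReal_ofNat]
        ring

theorem hlMax_one_le (x : RN N) : hlMax (fun _ => 1) x ≤ 1 := by
  refine iSup₂_le fun r hr => ?_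
  rw [setLIntegral_const, one_mul,
    ENNReal.inv_mul_cancel (volume_ball_ne_zero x hr) measure_ball_lt_top.ne]

theorem lintegral_majorant_le {ε : ℝ} (hε : 0 < ε) (x : RN N) :
    ∫⁻ y, ENNReal.ofReal (majorant ε (x - y)) ≤
      ENNReal.ofReal (2 ^ (N + 1)) * volume (ball (0 : RN N) 1) := by
  have h := lintegral_majorant_mul_le hε (f := fun _ => 1) measurable_const x
  simp only [mul_one] at h
  exact h.trans (mul_le_of_le_one_right' (hlMax_one_le x))

/-! ### The Calderón-Zygmund decomposition -/

/-- A function is dominated almost everywhere by its maximal function, by Lebesgue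
differentiation. -/
theorem ae_le_hlMax {f : RN N → ℝ≥0∞} (hf : Measurable f) (hfi : ∫⁻ x, f x ≠ ∞) :
    ∀ᵐ x, f x ≤ hlMax f x := by
  filter_upwards [(Besicovitch.vitaliFamily (volume : Measure (RN N))).ae_tendsto_lintegral_div
    hf.aemeasurable hfi] with x hx
  refine le_of_tendsto (hx.comp (Besicovitch.tendsto_filterAt volume x)) ?_
  filter_upwards [self_mem_nhdsWithin] with r hr
  have hr : 0 < r := hr
  have h1 : ∫⁻ y in closedBall x r, f y = ∫⁻ y in ball x r, f y := by
    refine setLIntegral_congr ?_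
    rw [← ball_union_sphere]
    refine union_ae_eq_left_of_ae_eq_empty ?_
    rw [ae_eq_empty]
    exact Measure.addHaar_sphere_of_ne_zero volume x hr.ne'
  simp only [Function.comp_apply]
  rw [h1, volume_closedBall_eq x hr, ← volume_ball_eq x hr, div_eq_mul_inv, mul_comm]
  exact le_iSup₂ (f := fun (r : ℝ) (_ : 0 < r) =>
    (volume (ball x r))⁻¹ * ∫⁻ y in ball x r, f y) r hr

/-- A countable family of closed balls `closedBall c (5 * r c)`, whose cores `closedBall c (r c)`
are disjoint, can be shrunk to a disjoint family of measurable sets with the same union, each of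
them still containing its core. -/
theorem exists_disjoint_between {v : Set (RN N)} (hv : v.Countable) {r : RN N → ℝ}
    (hr : ∀ c ∈ v, 0 < r c) (hdis : v.PairwiseDisjoint fun c => closedBall c (r c)) :
    ∃ F : RN N → Set (RN N), (∀ c ∈ v, MeasurableSet (F c) ∧ closedBall c (r c) ⊆ F c ∧
      F c ⊆ closedBall c (5 * r c)) ∧ v.PairwiseDisjoint F ∧
      ⋃ c ∈ v, closedBall c (5 * r c) ⊆ ⋃ c ∈ v, F c := by
  obtain ⟨e, he⟩ := countable_iff_exists_injOn.1 hv
  set U := ⋃ b ∈ v, closedBall b (r b) with hU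
  have hUm : MeasurableSet U := MeasurableSet.biUnion hv fun b _ => measurableSet_closedBall
  -- a point outside all cores is given to the first ball, in an enumeration of `v`, containing it
  refine ⟨fun c => closedBall c (r c) ∪ (closedBall c (5 * r c) \
    (U ∪ ⋃ b ∈ {b ∈ v | e b < e c}, closedBall b (5 * r b))), fun c hc => ⟨?_, ?_, ?_⟩, ?_, ?_⟩
  · refine measurableSet_closedBall.union (measurableSet_closedBall.diff (hUm.union ?_))
    exact MeasurableSet.biUnion (hv.mono (sep_subset _ _)) fun b _ => measurableSet_closedBall
  · exact subset_union_left
  · refine union_subset (closedBall_subset_closedBall ?_) sdiff_subset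
    linarith [hr c hc]
  · intro a ha b hb hab
    refine Set.disjoint_left.2 fun x hxa hxb => ?_
    rcases hxa with hxa | ⟨hxa, hxa'⟩ <;> rcases hxb with hxb | ⟨hxb, hxb'⟩
    · exact Set.disjoint_left.1 (hdis ha hb hab) hxa hxb
    · exact hxb' (Or.inl (mem_biUnion ha hxa))
    · exact hxa' (Or.inl (mem_biUnion hb hxb))
    · rcases lt_trichotomy (e a) (e b) with h | h | h
      · exact hxb' (Or.inr (mem_biUnion (x := a) ⟨ha, h⟩ hxa))
      · exact hab (he ha hb h)
      · exact hxa' (Or.inr (mem_biUnion (x := b) ⟨hb, h⟩ hxb))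
  · intro x hx
    by_cases hxU : x ∈ U
    · obtain ⟨b, hb, hxb⟩ := mem_iUnion₂.1 hxU
      exact mem_biUnion hb (Or.inl hxb)
    · obtain ⟨c, hc, hxc⟩ := mem_iUnion₂.1 hx
      have hne : (e '' {c ∈ v | x ∈ closedBall c (5 * r c)}).Nonempty :=
        ⟨e c, c, ⟨hc, hxc⟩, rfl⟩
      obtain ⟨b, ⟨hb, hxb⟩, hbe⟩ := Nat.sInf_mem hne
      refine mem_biUnion hb (Or.inr ⟨hxb, ?_⟩)
      rintro (h | h)
      · exact hxU h
      · obtain ⟨a, ⟨ha, hab⟩, hxa⟩ := mem_iUnion₂.1 h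
        rw [hbe] at hab
        exact absurd hab (not_lt.2 (Nat.sInf_le ⟨a, ⟨ha, hxa⟩, rfl⟩))

/-- The stopping sets of the Calderón-Zygmund decomposition of `f` at height `t`: disjoint sets
`F c`, contained in balls `closedBall c (s c)` of small total volume, such that the averages of `f`
over the `F c` are at most a multiple of `t` and `f ≤ t` outside their union. The sets partition
`{t < hlMax f}`, and are built from a Vitali covering by balls of radius comparable with the
distance to the complement. -/
theorem exists_stopping_sets (hN : 0 < N) {f : RN N → ℝ≥0∞} (hf : Measurable f)
    (hfi : ∫⁻ x, f x ≠ ∞) {t : ℝ≥0∞} (ht0 : t ≠ 0) :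
    ∃ (v : Set (RN N)) (s : RN N → ℝ) (F : RN N → Set (RN N)), v.Countable ∧
      (∀ c ∈ v, 0 < s c ∧ MeasurableSet (F c) ∧ F c ⊆ closedBall c (s c) ∧ volume (F c) ≠ 0 ∧
        ∫⁻ x in F c, f x ≤ ENNReal.ofReal (16 ^ N) * t * volume (F c)) ∧
      v.PairwiseDisjoint F ∧
      t * ∑' c : v, volume (closedBall (c : RN N) (2 * s c)) ≤
        ENNReal.ofReal (50 ^ N) * ∫⁻ x, f x ∧
      ∀ᵐ x, x ∉ ⋃ c ∈ v, F c → f x ≤ t := by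
  have : Nonempty (Fin N) := ⟨⟨0, hN⟩⟩
  set Ω := {x | t < hlMax f x} with hΩ
  have hΩo : IsOpen Ω := isOpen_lt_hlMax f t
  have hweak : t * volume Ω ≤ ENNReal.ofReal (5 ^ N) * ∫⁻ x, f x := mul_volume_lt_hlMax_le hN f t
  have hΩfin : volume Ω ≠ ∞ := by
    intro h
    rw [h, ENNReal.mul_top ht0] at hweak
    exact ENNReal.mul_ne_top ENNReal.ofReal_ne_top hfi (top_le_iff.1 hweak)
  have hne : Ωᶜ.Nonempty := by
    rw [nonempty_compl]
    intro h
    rw [h] at hΩfin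
    exact hΩfin (by simp)
  set r : RN N → ℝ := fun c => infDist c Ωᶜ / 10 with hrdef
  have hr : ∀ c ∈ Ω, 0 < r c := by
    intro c hc
    have : 0 < infDist c Ωᶜ :=
      (hΩo.isClosed_compl.notMem_iff_infDist_pos hne).1 (fun h => h hc)
    simp only [hrdef]
    positivity
  have hball : ∀ c ∈ Ω, ball c (10 * r c) ⊆ Ω := by
    intro c hc x hx
    by_contra hxΩ
    have h1 : infDist c Ωᶜ ≤ dist c x := infDist_le_dist_of_mem hxΩ
    rw [mem_ball, dist_comm] at hx
    simp only [hrdef] at hx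
    linarith
  obtain ⟨R, hR⟩ := exists_radius_bound hN hΩfin
  obtain ⟨v, hv, hdis, hcov⟩ := Vitali.exists_disjoint_subfamily_covering_enlargement_closedBall
    Ω id r R (fun c hc => hR c _ (measure_mono ((ball_subset_ball
      (by linarith [hr c hc])).trans (hball c hc)))) 5 (by norm_num)
  simp only [id] at hdis hcov
  have hvc : v.Countable := by
    refine hdis.countable_of_nonempty_interior fun a ha => ?_
    exact ⟨a, ball_subset_interior_closedBall (mem_ball_self (hr a (hv ha)))⟩
  obtain ⟨F, hF, hFdis, hFcov⟩ := exists_disjoint_between hvc (fun c hc => hr c (hv hc)) hdis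
  refine ⟨v, fun c => 5 * r c, F, hvc, fun c hc => ?_, hFdis, ?_, ?_⟩
  · have hrc := hr c (hv hc)
    obtain ⟨hFm, hF1, hF2⟩ := hF c hc
    have hvol : volume (ball c (r c)) ≤ volume (F c) :=
      measure_mono (ball_subset_closedBall.trans hF1)
    refine ⟨by positivity, hFm, hF2, fun h => ?_, ?_⟩
    · rw [h] at hvol
      exact volume_ball_ne_zero c hrc (le_zero_iff.1 hvol)
    · -- a ball of comparable radius about a nearest point `z` of the complement contains `F c`,
      -- and the maximal function is at most `t` at `z`
      obtain ⟨z, hz, hzc⟩ := hΩo.isClosed_compl.exists_infDist_eq_dist hne c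
      have hsub : F c ⊆ ball z (16 * r c) := by
        refine hF2.trans fun x hx => ?_
        rw [mem_closedBall] at hx
        rw [mem_ball]
        have h1 := dist_triangle x c z
        have h2 : infDist c Ωᶜ = 10 * r c := by simp only [hrdef]; ring
        rw [← hzc, h2] at h1
        linarith
      calc ∫⁻ x in F c, f x ≤ ∫⁻ x in ball z (16 * r c), f x := lintegral_mono_set hsub
        _ ≤ volume (ball z (16 * r c)) * hlMax f z := lintegral_ball_le_hlMax f z (by positivity)
        _ ≤ (ENNReal.ofReal (16 ^ N) * volume (ball c (r c))) * t := by
            rw [volume_ball_mul z (by norm_num) hrc, volume_ball_eq z hrc, volume_ball_eq c hrc]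
            gcongr
            exact not_lt.1 hz
        _ ≤ (ENNReal.ofReal (16 ^ N) * volume (F c)) * t := by gcongr
        _ = _ := by ring
  · calc t * ∑' c : v, volume (closedBall (c : RN N) (2 * (5 * r c)))
        = t * (ENNReal.ofReal (10 ^ N) * ∑' c : v, volume (closedBall (c : RN N) (r c))) := by
          rw [← ENNReal.tsum_mul_left (a := ENNReal.ofReal (10 ^ N))]
          congr 1
          refine tsum_congr fun c => ?_
          have hrc := hr c (hv c.2)
          rw [volume_closedBall_eq _ (by positivity), volume_closedBall_eq _ hrc,
            show 2 * (5 * r (c : RN N)) = 10 * r c by ring, mul_pow,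
            ENNReal.ofReal_mul (by positivity), mul_assoc]
      _ ≤ t * (ENNReal.ofReal (10 ^ N) * volume Ω) := by
          rw [← measure_biUnion hvc hdis fun c _ => measurableSet_closedBall]
          gcongr
          refine iUnion₂_subset fun c hc => (closedBall_subset_ball ?_).trans (hball c (hv hc))
          linarith [hr c (hv hc)]
      _ = ENNReal.ofReal (10 ^ N) * (t * volume Ω) := by ring
      _ ≤ ENNReal.ofReal (10 ^ N) * (ENNReal.ofReal (5 ^ N) * ∫⁻ x, f x) := by gcongr
      _ = _ := by
          rw [← mul_assoc, ← ENNReal.ofReal_mul (by positivity), ← mul_pow]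
          norm_num
  · filter_upwards [ae_le_hlMax hf hfi] with x hx hxF
    refine hx.trans (not_lt.1 fun hxΩ => hxF (hFcov ?_))
    obtain ⟨b, hb, hxb⟩ := hcov x hxΩ
    exact mem_biUnion hb (hxb (mem_closedBall_self (hr x hxΩ).le))

/-! ### A weak type inequality for maximal convolution operators -/

/-- The maximal function `sup_i |k_i * u|` of a family of kernels. -/
def maximalConv {τ : Type*} (k : τ → RN N → ℂ) (u : RN N → ℂ) (x : RN N) : ℝ≥0∞ :=
  ⨆ i, ‖∫ y, k i (x - y) * u y‖ₑ

theorem integrable_mul_of_bounded {k u : RN N → ℂ} (hk : Continuous k) {M : ℝ}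
    (hM : ∀ z, ‖k z‖ ≤ M) (hu : Integrable u) (x : RN N) :
    Integrable (fun y => k (x - y) * u y) :=
  hu.bdd_mul (c := M) (by fun_prop) (Eventually.of_forall fun y => hM _)

theorem continuous_conv_of_bounded {k u : RN N → ℂ} (hk : Continuous k) {M : ℝ}
    (hM : ∀ z, ‖k z‖ ≤ M) (hu : Integrable u) :
    Continuous (fun x => ∫ y, k (x - y) * u y) := by
  refine continuous_of_dominated (bound := fun y => M * ‖u y‖)
    (fun x => (integrable_mul_of_bounded hk hM hu x).aestronglyMeasurable)
    (fun x => Eventually.of_forall fun y => ?_) (hu.norm.const_mul _)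
    (Eventually.of_forall fun y => by fun_prop)
  rw [norm_mul]
  gcongr
  exact hM _

theorem measurable_iSup_enorm {τ : Type*} {f : τ → RN N → ℂ} (hf : ∀ i, Continuous (f i)) :
    Measurable fun x => ⨆ i, ‖f i x‖ₑ :=
  (lowerSemicontinuous_iSup fun i => (hf i).enorm.lowerSemicontinuous).measurable

theorem measurable_maximalConv {τ : Type*} {k : τ → RN N → ℂ} (hk : ∀ i, Continuous (k i))
    (hM : ∀ i, ∃ M : ℝ, ∀ z, ‖k i z‖ ≤ M) {u : RN N → ℂ} (hu : Integrable u) :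
    Measurable (maximalConv k u) :=
  measurable_iSup_enorm fun i => by
    obtain ⟨M, h⟩ := hM i
    exact continuous_conv_of_bounded (hk i) h hu

theorem maximalConv_add_le {τ : Type*} {k : τ → RN N → ℂ} (hk : ∀ i, Continuous (k i))
    (hM : ∀ i, ∃ M : ℝ, ∀ z, ‖k i z‖ ≤ M) {u v : RN N → ℂ} (hu : Integrable u)
    (hv : Integrable v) (x : RN N) :
    maximalConv k (u + v) x ≤ maximalConv k u x + maximalConv k v x := by
  refine iSup_le fun i => ?_
  obtain ⟨M, h⟩ := hM i
  simp only [Pi.add_apply, mul_add]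
  rw [integral_add (integrable_mul_of_bounded (hk i) h hu x)
    (integrable_mul_of_bounded (hk i) h hv x)]
  refine (enorm_add_le _ _).trans ?_
  gcongr
  · exact le_iSup (fun i => ‖∫ y, k i (x - y) * u y‖ₑ) i
  · exact le_iSup (fun i => ‖∫ y, k i (x - y) * v y‖ₑ) i

/-- The Calderón-Zygmund decomposition `u = g + b` at height `t`: the good part `g` is the average
of `u` on each stopping set and `u` elsewhere, and the bad part `b` has integral zero on each
stopping set. -/
theorem exists_good_add_bad (hN : 0 < N) {u : RN N → ℂ} (hum : Measurable u) (hu : Integrable u)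
    {t : ℝ≥0∞} (ht0 : t ≠ 0) :
    ∃ (g b : RN N → ℂ) (v : Set (RN N)) (s : RN N → ℝ) (F : RN N → Set (RN N)),
      u = g + b ∧ Integrable g ∧ Integrable b ∧ v.Countable ∧
      (∀ᵐ x, ‖g x‖ₑ ≤ ENNReal.ofReal (16 ^ N) * t) ∧
      ∫⁻ x, ‖g x‖ₑ ≤ ∫⁻ x, ‖u x‖ₑ ∧ ∫⁻ x, ‖b x‖ₑ ≤ 2 * ∫⁻ x, ‖u x‖ₑ ∧
      (∀ c ∈ v, 0 < s c ∧ MeasurableSet (F c) ∧ F c ⊆ closedBall c (s c) ∧ ∫ x in F c, b x = 0) ∧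
      v.PairwiseDisjoint F ∧ (∀ x, x ∉ ⋃ c ∈ v, F c → b x = 0) ∧
      t * ∑' c : v, volume (closedBall (c : RN N) (2 * s c)) ≤
        ENNReal.ofReal (50 ^ N) * ∫⁻ x, ‖u x‖ₑ := by
  obtain ⟨v, s, F, hv, hF, hdis, hvol, hae⟩ := exists_stopping_sets hN (f := fun x => ‖u x‖ₑ)
    hum.enorm hu.hasFiniteIntegral.ne ht0
  set G := ⋃ c ∈ v, F c with hG
  have hGm : MeasurableSet G := MeasurableSet.biUnion hv fun c hc => (hF c hc).2.1
  have hex : ∀ x, ∃ c, x ∈ G → c ∈ v ∧ x ∈ F c := by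
    intro x
    by_cases hx : x ∈ G
    · obtain ⟨c, hc, hxc⟩ := mem_iUnion₂.1 hx
      exact ⟨c, fun _ => ⟨hc, hxc⟩⟩
    · exact ⟨0, fun h => absurd h hx⟩
  -- `κ x` is the centre of the stopping set that contains `x`
  choose κ hκ using hex
  have hκF : ∀ c ∈ v, ∀ x ∈ F c, κ x = c := by
    intro c hc x hx
    have hxG : x ∈ G := mem_biUnion hc hx
    by_contra hne
    exact Set.disjoint_left.1 (hdis (hκ x hxG).1 hc hne) (hκ x hxG).2 hx
  have hfin : ∀ c ∈ v, volume (F c) ≠ ∞ := fun c hc =>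
    ((measure_mono (hF c hc).2.2.1).trans_lt measure_closedBall_lt_top).ne
  set a : RN N → ℂ := fun c => ⨍ x in F c, u x with ha
  have ha1 : ∀ c ∈ v, ‖a c‖ₑ * volume (F c) ≤ ∫⁻ x in F c, ‖u x‖ₑ := by
    intro c hc
    simp only [ha]
    rw [setAverage_eq, enorm_smul, mul_right_comm]
    have h1 : ‖(volume.real (F c))⁻¹‖ₑ * volume (F c) = 1 := by
      have h0 : volume.real (F c) ≠ 0 := ENNReal.toReal_ne_zero.2 ⟨(hF c hc).2.2.2.1, hfin c hc⟩
      rw [enorm_inv h0,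
        Real.enorm_of_nonneg measureReal_nonneg, ofReal_measureReal (hfin c hc),
        ENNReal.inv_mul_cancel (hF c hc).2.2.2.1 (hfin c hc)]
    rw [h1, one_mul]
    exact enorm_integral_le_lintegral_enorm _
  classical
  set g : RN N → ℂ := fun x => if x ∈ G then a (κ x) else u x with hg
  have hgF : ∀ c ∈ v, ∀ x ∈ F c, g x = a c := by
    intro c hc x hx
    have hxG : x ∈ G := mem_biUnion hc hx
    simp only [hg, if_pos hxG, hκF c hc x hx]
  have hgG : ∀ x ∉ G, g x = u x := fun x hx => by simp only [hg, if_neg hx]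
  have hgm : AEStronglyMeasurable g volume := by
    rw [← Measure.restrict_univ (μ := volume), ← union_compl_self G, aestronglyMeasurable_union_iff]
    constructor
    · have := hv.to_subtype
      rw [hG, biUnion_eq_iUnion, aestronglyMeasurable_iUnion_iff]
      rintro ⟨c, hc⟩
      refine (aestronglyMeasurable_const (b := a c)).congr ?_
      filter_upwards [ae_restrict_mem (hF c hc).2.1] with x hx
      exact (hgF c hc x hx).symm
    · refine hum.aestronglyMeasurable.congr ?_
      filter_upwards [ae_restrict_mem hGm.compl] with x hx
      exact (hgG x hx).symm
  have hsplit : ∀ h : RN N → ℝ≥0∞,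
      ∫⁻ x, h x = (∑' c : v, ∫⁻ x in F c, h x) + ∫⁻ x in Gᶜ, h x := by
    intro h
    rw [← lintegral_add_compl h hGm, hG, lintegral_biUnion hv (fun c hc => (hF c hc).2.1) hdis]
  have hg1 : ∫⁻ x, ‖g x‖ₑ ≤ ∫⁻ x, ‖u x‖ₑ := by
    rw [hsplit, hsplit fun x => ‖u x‖ₑ]
    refine add_le_add (ENNReal.tsum_le_tsum fun c => ?_) (le_of_eq ?_)
    · rw [setLIntegral_congr_fun (hF c c.2).2.1 (g := fun _ => ‖a c‖ₑ)
        (fun x hx => by simp only [hgF c c.2 x hx]), setLIntegral_const]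
      exact ha1 c c.2
    · exact setLIntegral_congr_fun hGm.compl fun x hx => by simp only [hgG x hx]
  have hgi : Integrable g := ⟨hgm, hg1.trans_lt hu.hasFiniteIntegral⟩
  refine ⟨g, u - g, v, s, F, by simp, hgi, hu.sub hgi, hv, ?_, hg1, ?_, ?_, hdis, ?_, hvol⟩
  · filter_upwards [hae] with x hx
    by_cases hxG : x ∈ G
    · obtain ⟨hc, hxc⟩ := hκ x hxG
      rw [hgF _ hc x hxc]
      have h1 := (ha1 _ hc).trans (hF _ hc).2.2.2.2
      exact (ENNReal.mul_le_mul_iff_left (hF _ hc).2.2.2.1 (hfin _ hc)).1 h1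
    · rw [hgG x hxG]
      refine (hx hxG).trans (le_mul_of_one_le_left' ?_)
      rw [← ENNReal.ofReal_one]
      exact ENNReal.ofReal_le_ofReal (one_le_pow₀ (by norm_num))
  · calc ∫⁻ x, ‖(u - g) x‖ₑ ≤ ∫⁻ x, (‖u x‖ₑ + ‖g x‖ₑ) := by
          exact lintegral_mono fun x => enorm_sub_le
      _ = (∫⁻ x, ‖u x‖ₑ) + ∫⁻ x, ‖g x‖ₑ := lintegral_add_left hum.enorm _
      _ ≤ _ := by
          rw [two_mul]
          gcongr
  · intro c hc
    refine ⟨(hF c hc).1, (hF c hc).2.1, (hF c hc).2.2.1, ?_⟩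
    simp only [Pi.sub_apply]
    rw [integral_sub hu.integrableOn hgi.integrableOn,
      setIntegral_congr_fun (g := fun _ => a c) (hF c hc).2.1 (fun x hx => hgF c hc x hx),
      setIntegral_const, ha]
    simp only
    rw [measure_smul_setAverage _ (hfin c hc), sub_self]
  · intro x hx
    rw [Pi.sub_apply, hgG x hx, sub_self]

theorem majorant_sub_comm (ε : ℝ) (x y : RN N) : majorant ε (x - y) = majorant ε (y - x) := by
  rw [majorant, majorant, norm_sub_rev]

/-- Away from the doubled balls, the maximal function of the bad part is controlled by the
regularity of the kernels, since the bad part has integral zero on each piece. -/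
theorem maximalConv_bad_le {τ : Type*} {k : τ → RN N → ℂ} (hk : ∀ i, Continuous (k i))
    (hM : ∀ i, ∃ M : ℝ, ∀ z, ‖k i z‖ ≤ M) {A : ℝ}
    (hreg : ∀ i (s : ℝ) (z y : RN N), 0 < s → ‖y‖ ≤ s → 2 * s ≤ ‖z‖ →
      ‖k i (z - y) - k i z‖ ≤ A * majorant s z)
    {b : RN N → ℂ} (hb : Integrable b) {v : Set (RN N)} (hv : v.Countable) {s : RN N → ℝ}
    {F : RN N → Set (RN N)}
    (hF : ∀ c ∈ v, 0 < s c ∧ MeasurableSet (F c) ∧ F c ⊆ closedBall c (s c) ∧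
      ∫ x in F c, b x = 0)
    (hdis : v.PairwiseDisjoint F) (hb0 : ∀ x, x ∉ ⋃ c ∈ v, F c → b x = 0) {x : RN N}
    (hx : x ∉ ⋃ c ∈ v, closedBall c (2 * s c)) :
    maximalConv k b x ≤ ∑' c : v, ENNReal.ofReal (A * majorant (s c) (x - (c : RN N))) *
      ∫⁻ y in F c, ‖b y‖ₑ := by
  refine iSup_le fun i => ?_
  obtain ⟨M, hMi⟩ := hM i
  have hint := integrable_mul_of_bounded (hk i) hMi hb x
  have := hv.to_subtype
  have h1 : ∫ y, k i (x - y) * b y = ∑' c : v, ∫ y in F c, k i (x - y) * b y := by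
    rw [← integral_iUnion (fun c : v => (hF c c.2).2.1) ?_ hint.integrableOn,
      ← biUnion_eq_iUnion v fun c _ => F c,
      setIntegral_eq_integral_of_forall_compl_eq_zero]
    · intro y hy
      rw [hb0 y hy, mul_zero]
    · intro c d hcd
      exact hdis c.2 d.2 (fun h => hcd (Subtype.ext h))
  rw [h1]
  refine enorm_tsum_le_tsum_enorm.trans (ENNReal.tsum_le_tsum fun c => ?_)
  obtain ⟨hs, hFm, hFs, hb1⟩ := hF c c.2
  -- the kernel at the centre may be subtracted, since `b` has integral zero on `F c`
  have h2 : ∫ y in F c, k i (x - y) * b y =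
      ∫ y in F c, (k i (x - y) - k i (x - (c : RN N))) * b y := by
    simp only [sub_mul]
    rw [integral_sub hint.integrableOn (hb.integrableOn.const_mul _), integral_const_mul, hb1,
      mul_zero, sub_zero]
  rw [h2, ← lintegral_const_mul'' _ hb.aestronglyMeasurable.enorm.restrict]
  refine (enorm_integral_le_lintegral_enorm _).trans (setLIntegral_mono' hFm fun y hy => ?_)
  rw [enorm_mul]
  gcongr
  rw [← ofReal_norm]
  refine ENNReal.ofReal_le_ofReal ?_
  have hxc : x ∉ closedBall (c : RN N) (2 * s c) := fun h => hx (mem_biUnion c.2 h)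
  rw [mem_closedBall, dist_eq_norm, not_le] at hxc
  have hyc := hFs hy
  rw [mem_closedBall, dist_eq_norm] at hyc
  have := hreg i (s c) (x - (c : RN N)) (y - c) hs hyc hxc.le
  rwa [sub_sub_sub_cancel_right] at this

/-- The constant of the weak type inequality for maximal convolution operators. -/
def weakConst (N : ℕ) : ℝ≥0∞ :=
  4 * ENNReal.ofReal (16 ^ N) + ENNReal.ofReal (50 ^ N) +
    4 * (ENNReal.ofReal (2 ^ (N + 1)) * volume (ball (0 : RN N) 1))

theorem weakConst_ne_top (N : ℕ) : weakConst N ≠ ∞ := by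
  unfold weakConst
  have := (measure_ball_lt_top (μ := volume) (x := (0 : RN N)) (r := 1)).ne
  finiteness

/-- Chebyshev's inequality at a real height. -/
theorem ofReal_mul_volume_lt_le {f : RN N → ℝ≥0∞} (hf : Measurable f) {t : ℝ} (S : Set (RN N)) :
    ENNReal.ofReal t * volume {x ∈ S | ENNReal.ofReal t < f x} ≤ ∫⁻ x in S, f x := by
  have hm : MeasurableSet {x | ENNReal.ofReal t < f x} := measurableSet_lt measurable_const hf
  calc ENNReal.ofReal t * volume {x ∈ S | ENNReal.ofReal t < f x}
      = ENNReal.ofReal t * (volume.restrict S) {x | ENNReal.ofReal t < f x} := by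
        rw [Measure.restrict_apply hm, inter_comm]
        rfl
    _ ≤ ENNReal.ofReal t * (volume.restrict S) {x | ENNReal.ofReal t ≤ f x} := by
        gcongr with x
        exact le_of_lt
    _ ≤ _ := mul_meas_ge_le_lintegral hf _

/-- A family of kernels satisfying a uniform smoothness condition, and whose maximal function is
bounded on `L²`, has a maximal function of weak type `(1, 1)`. -/
theorem weakL1_maximalConv_le (hN : 0 < N) {τ : Type*} {k : τ → RN N → ℂ}
    (hk : ∀ i, Continuous (k i)) (hM : ∀ i, ∃ M : ℝ, ∀ z, ‖k i z‖ ≤ M) {A : ℝ} (hA : 0 < A)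
    (hreg : ∀ i (s : ℝ) (z y : RN N), 0 < s → ‖y‖ ≤ s → 2 * s ≤ ‖z‖ →
      ‖k i (z - y) - k i z‖ ≤ A * majorant s z)
    (hL2 : ∀ g : RN N → ℂ, Integrable g → MemLp g 2 volume →
      ∫⁻ x, maximalConv k g x ^ 2 ≤ ENNReal.ofReal A ^ 2 * ∫⁻ x, ‖g x‖ₑ ^ 2)
    {u : RN N → ℂ} (hum : Measurable u) (hu : Integrable u) :
    weakL1 (maximalConv k u) ≤ weakConst N * ENNReal.ofReal A * ∫⁻ x, ‖u x‖ₑ := by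
  refine iSup₂_le fun t ht => ?_
  set I := ∫⁻ x, ‖u x‖ₑ with hI
  -- the height `t / A` makes the contributions of the good and the bad part comparable
  obtain ⟨g, b, v, s, F, rfl, hg, hb, hv, hgt, hg1, hb1, hF, hdis, hb0, hvol⟩ :=
    exists_good_add_bad hN hum hu (t := ENNReal.ofReal (t / A)) (by simp; positivity)
  have hA0 : ENNReal.ofReal A ≠ 0 := by simpa using hA
  have ht0 : ENNReal.ofReal t ≠ 0 := by simpa using ht
  set E := ⋃ c ∈ v, closedBall c (2 * s c) with hE
  have hEm : MeasurableSet E := MeasurableSet.biUnion hv fun c _ => measurableSet_closedBall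
  have hTg := measurable_maximalConv hk hM hg
  have hTb := measurable_maximalConv hk hM hb
  have hhalf : ENNReal.ofReal t = ENNReal.ofReal (t / 2) + ENNReal.ofReal (t / 2) := by
    rw [← ENNReal.ofReal_add (by positivity) (by positivity), add_halves]
  have hsub : {x | ENNReal.ofReal t < maximalConv k (g + b) x} ⊆
      {x | ENNReal.ofReal (t / 2) < maximalConv k g x} ∪ E ∪
        {x ∈ Eᶜ | ENNReal.ofReal (t / 2) < maximalConv k b x} := by
    intro x hx
    by_contra hcon
    simp only [mem_union, mem_ofPred_eq, not_or, not_and, mem_compl_iff, not_lt] at hcon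
    obtain ⟨⟨h1, h2⟩, h3⟩ := hcon
    have hx : ENNReal.ofReal t < maximalConv k (g + b) x := hx
    refine absurd ((maximalConv_add_le hk hM hg hb x).trans (add_le_add h1 (h3 h2))) ?_
    rw [← hhalf]
    exact not_le.2 hx
  -- the good part, by the `L²` bound
  have hgood : ENNReal.ofReal t * volume {x | ENNReal.ofReal (t / 2) < maximalConv k g x} ≤
      4 * ENNReal.ofReal (16 ^ N) * ENNReal.ofReal A * I := by
    have hsq : ∫⁻ x, ‖g x‖ₑ ^ 2 ≤ ENNReal.ofReal (16 ^ N) * ENNReal.ofReal (t / A) * I := by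
      calc ∫⁻ x, ‖g x‖ₑ ^ 2 ≤ ∫⁻ x, ENNReal.ofReal (16 ^ N) * ENNReal.ofReal (t / A) * ‖g x‖ₑ := by
            refine lintegral_mono_ae ?_
            filter_upwards [hgt] with x hx
            rw [sq]
            gcongr
        _ = ENNReal.ofReal (16 ^ N) * ENNReal.ofReal (t / A) * ∫⁻ x, ‖g x‖ₑ :=
            lintegral_const_mul' _ _ (by finiteness)
        _ ≤ _ := by gcongr
    have hg2 : MemLp g 2 volume := by
      refine ⟨hg.aestronglyMeasurable, ?_⟩
      rw [eLpNorm_lt_top_iff_lintegral_rpow_enorm_lt_top (by norm_num) (by norm_num)]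
      simp only [ENNReal.toReal_ofNat, ENNReal.rpow_ofNat]
      exact hsq.trans_lt (by have := hu.hasFiniteIntegral; finiteness)
    have hcheb : ENNReal.ofReal (t / 2) ^ 2 *
        volume {x | ENNReal.ofReal (t / 2) < maximalConv k g x} ≤
        ∫⁻ x, maximalConv k g x ^ 2 := by
      refine le_trans ?_ (mul_meas_ge_le_lintegral (hTg.pow_const 2) (ENNReal.ofReal (t / 2) ^ 2))
      refine mul_le_mul_right (measure_mono fun x hx => ?_) _
      have hx : ENNReal.ofReal (t / 2) < maximalConv k g x := hx
      simp only [mem_ofPred_eq]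
      gcongr
    have hfin := (hcheb.trans (hL2 g hg hg2)).trans (mul_le_mul_right hsq _)
    have e1 : ENNReal.ofReal (t / 2) ^ 2 = ENNReal.ofReal (t / 4) * ENNReal.ofReal t := by
      rw [← ENNReal.ofReal_pow (by positivity), ← ENNReal.ofReal_mul (by positivity)]
      congr 1
      ring
    have e2 : ENNReal.ofReal A ^ 2 * (ENNReal.ofReal (16 ^ N) * ENNReal.ofReal (t / A) * I) =
        ENNReal.ofReal (t / 4) * (4 * ENNReal.ofReal (16 ^ N) * ENNReal.ofReal A * I) := by
      have : ENNReal.ofReal A ^ 2 * ENNReal.ofReal (t / A) =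
          ENNReal.ofReal (t / 4) * (4 * ENNReal.ofReal A) := by
        rw [← ENNReal.ofReal_ofNat 4, ← ENNReal.ofReal_pow hA.le,
          ← ENNReal.ofReal_mul (by positivity), ← ENNReal.ofReal_mul (by positivity),
          ← ENNReal.ofReal_mul (by positivity)]
        congr 1
        field_simp
      calc _ = ENNReal.ofReal A ^ 2 * ENNReal.ofReal (t / A) * (ENNReal.ofReal (16 ^ N) * I) := by
            ring
        _ = _ := by
            rw [this]
            ring
    rw [e1, e2, mul_assoc] at hfin
    exact (ENNReal.mul_le_mul_iff_right (by simp; positivity) ENNReal.ofReal_ne_top).1 hfin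
  -- the exceptional set
  have hexc : ENNReal.ofReal t * volume E ≤ ENNReal.ofReal (50 ^ N) * ENNReal.ofReal A * I := by
    have e1 : ENNReal.ofReal t = ENNReal.ofReal A * ENNReal.ofReal (t / A) := by
      rw [← ENNReal.ofReal_mul hA.le, mul_div_cancel₀ _ hA.ne']
    calc ENNReal.ofReal t * volume E
        ≤ ENNReal.ofReal A * (ENNReal.ofReal (t / A) *
          ∑' c : v, volume (closedBall (c : RN N) (2 * s c))) := by
          rw [← mul_assoc, ← e1]
          gcongr
          exact measure_biUnion_le _ hv _
      _ ≤ ENNReal.ofReal A * (ENNReal.ofReal (50 ^ N) * I) := by gcongr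
      _ = _ := by ring
  -- the bad part, by the regularity of the kernels
  have hbad : ENNReal.ofReal t * volume {x ∈ Eᶜ | ENNReal.ofReal (t / 2) < maximalConv k b x} ≤
      4 * (ENNReal.ofReal (2 ^ (N + 1)) * volume (ball (0 : RN N) 1)) * ENNReal.ofReal A * I := by
    have h1 : ∫⁻ x in Eᶜ, maximalConv k b x ≤ ENNReal.ofReal A *
        (ENNReal.ofReal (2 ^ (N + 1)) * volume (ball (0 : RN N) 1)) * (2 * I) := by
      have := hv.to_subtype
      calc ∫⁻ x in Eᶜ, maximalConv k b x
          ≤ ∫⁻ x in Eᶜ, ∑' c : v, ENNReal.ofReal (A * majorant (s c) (x - (c : RN N))) *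
            ∫⁻ y in F c, ‖b y‖ₑ := by
            refine setLIntegral_mono' hEm.compl fun x hx => ?_
            exact maximalConv_bad_le hk hM hreg hb hv hF hdis hb0 hx
        _ ≤ ∫⁻ x, ∑' c : v, ENNReal.ofReal (A * majorant (s c) (x - (c : RN N))) *
            ∫⁻ y in F c, ‖b y‖ₑ := setLIntegral_le_lintegral _ _
        _ = ∑' c : v, ∫⁻ x, ENNReal.ofReal (A * majorant (s c) (x - (c : RN N))) *
            ∫⁻ y in F c, ‖b y‖ₑ := by
            refine lintegral_tsum fun c => ?_
            have := continuous_majorant (N := N) (hF c c.2).1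
            exact Measurable.aemeasurable (by fun_prop)
        _ ≤ ∑' c : v, ENNReal.ofReal A *
            (ENNReal.ofReal (2 ^ (N + 1)) * volume (ball (0 : RN N) 1)) *
            ∫⁻ y in F c, ‖b y‖ₑ := by
            refine ENNReal.tsum_le_tsum fun c => ?_
            have hc := continuous_majorant (N := N) (hF c c.2).1
            rw [lintegral_mul_const _ (by fun_prop)]
            gcongr
            simp only [ENNReal.ofReal_mul hA.le]
            rw [lintegral_const_mul _ (by fun_prop)]
            gcongr
            simp only [majorant_sub_comm (s c) _ (c : RN N)]
            exact lintegral_majorant_le (hF c c.2).1 _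
        _ = ENNReal.ofReal A * (ENNReal.ofReal (2 ^ (N + 1)) * volume (ball (0 : RN N) 1)) *
            ∫⁻ y in ⋃ c ∈ v, F c, ‖b y‖ₑ := by
            rw [ENNReal.tsum_mul_left, lintegral_biUnion hv (fun c hc => (hF c hc).2.1) hdis]
        _ ≤ _ := by
            gcongr
            exact (setLIntegral_le_lintegral _ _).trans hb1
    have h2 := (ofReal_mul_volume_lt_le hTb (t := t / 2) Eᶜ).trans h1
    rw [hhalf, ← two_mul, mul_assoc]
    refine (mul_le_mul_right h2 2).trans (le_of_eq ?_)
    ring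
  calc ENNReal.ofReal t * volume {x | ENNReal.ofReal t < maximalConv k (g + b) x}
      ≤ ENNReal.ofReal t * (volume {x | ENNReal.ofReal (t / 2) < maximalConv k g x} + volume E +
          volume {x ∈ Eᶜ | ENNReal.ofReal (t / 2) < maximalConv k b x}) := by
        gcongr
        refine (measure_mono hsub).trans ((measure_union_le _ _).trans ?_)
        gcongr
        exact measure_union_le _ _
    _ ≤ 4 * ENNReal.ofReal (16 ^ N) * ENNReal.ofReal A * I +
          ENNReal.ofReal (50 ^ N) * ENNReal.ofReal A * I +
          4 * (ENNReal.ofReal (2 ^ (N + 1)) * volume (ball (0 : RN N) 1)) *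
            ENNReal.ofReal A * I := by
        rw [mul_add, mul_add]
        gcongr
    _ = weakConst N * ENNReal.ofReal A * I := by
        unfold weakConst
        ring

/-! ### Truncated kernels -/

/-- The Lipschitz cutoff function equal to `0` on `(-∞, 1/2]`, to `1` on `[1, ∞)`, and affine in
between. -/
def cutoff (t : ℝ) : ℝ := max 0 (min 1 (2 * t - 1))

theorem continuous_cutoff : Continuous cutoff := by
  unfold cutoff
  fun_prop

theorem cutoff_nonneg (t : ℝ) : 0 ≤ cutoff t := le_max_left _ _

theorem cutoff_le_one (t : ℝ) : cutoff t ≤ 1 := max_le zero_le_one (min_le_left _ _)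

theorem cutoff_eq_zero {t : ℝ} (ht : t ≤ 1 / 2) : cutoff t = 0 :=
  max_eq_left ((min_le_right _ _).trans (by linarith))

theorem cutoff_eq_one {t : ℝ} (ht : 1 ≤ t) : cutoff t = 1 := by
  unfold cutoff
  rw [min_eq_left (by linarith), max_eq_right zero_le_one]

theorem abs_cutoff_sub_le (a b : ℝ) : |cutoff a - cutoff b| ≤ 2 * |a - b| := by
  unfold cutoff
  rw [max_comm 0, max_comm 0]
  refine (abs_max_sub_max_le_abs _ _ _).trans ?_
  refine (abs_min_sub_min_le_max _ _ _ _).trans (max_le (by simp) ?_)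
  rw [show 2 * a - 1 - (2 * b - 1) = 2 * (a - b) by ring, abs_mul, abs_two]

/-- The kernel `k`, cut off continuously at distance `ε` from the origin. -/
def truncKernel (k : RN N → ℂ) (ε : ℝ) (z : RN N) : ℂ := cutoff (‖z‖ / ε) • k z

theorem truncKernel_of_le {k : RN N → ℂ} {ε : ℝ} (hε : 0 < ε) {z : RN N} (hz : ε ≤ ‖z‖) :
    truncKernel k ε z = k z := by
  rw [truncKernel, cutoff_eq_one ((one_le_div hε).2 hz), one_smul]

theorem truncKernel_of_le_half {k : RN N → ℂ} {ε : ℝ} (hε : 0 < ε) {z : RN N}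
    (hz : ‖z‖ ≤ ε / 2) : truncKernel k ε z = 0 := by
  rw [truncKernel, cutoff_eq_zero, zero_smul]
  rw [div_le_iff₀ hε]
  linarith

section

variable {K : 𝓢'(RN N, ℂ)} {k : RN N → ℂ} {C₀ C₁ : ℝ}

theorem IsFundamentalKernel.continuous_truncKernel (h : IsFundamentalKernel K k C₀ C₁) {ε : ℝ}
    (hε : 0 < ε) : Continuous (truncKernel k ε) := by
  rw [continuous_iff_continuousAt]
  intro z
  by_cases hz : z = 0
  · have : truncKernel k ε =ᶠ[𝓝 z] fun _ => 0 := by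
      filter_upwards [ball_mem_nhds z (half_pos hε)] with y hy
      rw [hz, mem_ball_zero_iff] at hy
      exact truncKernel_of_le_half hε hy.le
    exact continuousAt_const.congr this.symm
  · refine ContinuousAt.smul (f := fun z : RN N => cutoff (‖z‖ / ε)) ?_ ?_
    · exact (continuous_cutoff.comp (continuous_norm.div_const ε)).continuousAt
    · exact h.contDiffOn.continuousOn.continuousAt (isOpen_compl_singleton.mem_nhds hz)

theorem IsFundamentalKernel.norm_truncKernel_le (h : IsFundamentalKernel K k C₀ C₁) {ε : ℝ}
    (hε : 0 < ε) (z : RN N) : ‖truncKernel k ε z‖ ≤ C₀ * 2 ^ N * (ε ^ N)⁻¹ := by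
  by_cases hz : ‖z‖ ≤ ε / 2
  · rw [truncKernel_of_le_half hε hz, norm_zero]
    have := h.nonneg_zero
    positivity
  · push Not at hz
    have hz0 : z ≠ 0 := norm_pos_iff.1 ((half_pos hε).trans hz)
    rw [truncKernel, norm_smul, Real.norm_of_nonneg (cutoff_nonneg _)]
    calc cutoff (‖z‖ / ε) * ‖k z‖ ≤ 1 * (C₀ / ‖z‖ ^ N) := by
          gcongr
          · exact cutoff_le_one _
          · exact h.size z hz0
      _ ≤ C₀ / (ε / 2) ^ N := by
          rw [one_mul]
          have := h.nonneg_zero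
          gcongr
      _ = _ := by
          rw [div_pow]
          field_simp

theorem div_pow_le_majorant {s : ℝ} (hs : 0 < s) {z : RN N} (hz : 2 * s ≤ ‖z‖) :
    2 ^ (N + 1) * (s / ‖z‖ ^ (N + 1)) ≤ 3 ^ (N + 1) * majorant s z := by
  have hz0 : 0 < ‖z‖ := by linarith
  unfold majorant
  rw [mul_div_assoc', mul_div_assoc', div_le_div_iff₀ (by positivity) (by positivity)]
  have h1 : (2 * (s + ‖z‖)) ^ (N + 1) ≤ (3 * ‖z‖) ^ (N + 1) :=
    pow_le_pow_left₀ (by positivity) (by linarith) _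
  rw [mul_pow, mul_pow] at h1
  nlinarith

theorem inv_pow_le_majorant {s : ℝ} (hs : 0 < s) {z : RN N} (hz : ‖z‖ ≤ 2 * s) :
    (s ^ N)⁻¹ ≤ 3 ^ (N + 1) * majorant s z := by
  unfold majorant
  rw [mul_div_assoc', inv_eq_one_div, div_le_div_iff₀ (by positivity) (by positivity), one_mul]
  calc (s + ‖z‖) ^ (N + 1) ≤ (3 * s) ^ (N + 1) := by
        gcongr
        linarith
    _ = _ := by ring

/-- Regularity of the kernel away from the origin, from the gradient bound and the mean value
inequality. -/
theorem IsFundamentalKernel.norm_kernel_sub_le (h : IsFundamentalKernel K k C₀ C₁) {s : ℝ}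
    (hs : 0 < s) {z y : RN N} (hy : ‖y‖ ≤ s) (hz : 2 * s ≤ ‖z‖) :
    ‖k (z - y) - k z‖ ≤ C₁ * (3 ^ (N + 1) * majorant s z) := by
  have hz0 : 0 < ‖z‖ := by linarith
  have hw : ∀ w ∈ closedBall z (‖z‖ / 2), ‖z‖ / 2 ≤ ‖w‖ := by
    intro w hw
    rw [mem_closedBall, dist_eq_norm, norm_sub_rev] at hw
    have := norm_sub_norm_le z w
    linarith
  have hw0 : ∀ w ∈ closedBall z (‖z‖ / 2), w ≠ 0 := fun w hwz =>
    norm_pos_iff.1 ((half_pos hz0).trans_le (hw w hwz))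
  have hC := h.nonneg_one
  have key := (convex_closedBall z (‖z‖ / 2)).norm_image_sub_le_of_norm_fderiv_le (𝕜 := ℝ) (f := k)
    (C := C₁ / (‖z‖ / 2) ^ (N + 1)) (x := z) (y := z - y)
    (fun w hwz => (h.contDiffOn.differentiableOn one_ne_zero).differentiableAt
      (isOpen_compl_singleton.mem_nhds (hw0 w hwz)))
    (fun w hwz => (h.gradient w (hw0 w hwz)).trans (by
      have := hw w hwz
      gcongr))
    (mem_closedBall_self (by positivity))
    (by
      rw [mem_closedBall, dist_eq_norm, sub_sub_cancel_left, norm_neg]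
      linarith)
  refine key.trans ?_
  rw [sub_sub_cancel_left, norm_neg]
  calc C₁ / (‖z‖ / 2) ^ (N + 1) * ‖y‖ ≤ C₁ / (‖z‖ / 2) ^ (N + 1) * s := by gcongr
    _ = C₁ * (2 ^ (N + 1) * (s / ‖z‖ ^ (N + 1))) := by
        rw [div_pow]
        field_simp
    _ ≤ _ := by
        exact mul_le_mul_of_nonneg_left (div_pow_le_majorant hs hz) hC

/-- Regularity of the cutoff, with a bound free of the truncation parameter `ε`: the cutoff varies
only where `|z|` is at most a multiple of `ε`. -/
theorem abs_cutoff_sub_le_div {ε s : ℝ} (hε : 0 < ε) (hs : 0 < s) {z y : RN N} (hy : ‖y‖ ≤ s)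
    (hz : 2 * s ≤ ‖z‖) : |cutoff (‖z - y‖ / ε) - cutoff (‖z‖ / ε)| ≤ 4 * s / ‖z‖ := by
  have hz0 : 0 < ‖z‖ := by linarith
  have h1 : ‖z‖ ≤ 2 * ‖z - y‖ := by
    have := norm_sub_norm_le z y
    linarith
  by_cases h2 : ε ≤ ‖z - y‖ ∧ ε ≤ ‖z‖
  · rw [cutoff_eq_one ((one_le_div hε).2 h2.1), cutoff_eq_one ((one_le_div hε).2 h2.2), sub_self,
      abs_zero]
    positivity
  · have h3 : ‖z‖ ≤ 2 * ε := by
      rw [not_and_or] at h2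
      rcases h2 with h2 | h2 <;> linarith
    refine (abs_cutoff_sub_le _ _).trans ?_
    rw [← sub_div, abs_div, abs_of_pos hε]
    have h4 : |‖z - y‖ - ‖z‖| ≤ s := by
      have := abs_norm_sub_norm_le (z - y) z
      rw [sub_sub_cancel_left, norm_neg] at this
      linarith
    rw [mul_div_assoc', div_le_div_iff₀ hε hz0]
    nlinarith [abs_nonneg (‖z - y‖ - ‖z‖)]

/-- The truncated kernels are regular uniformly in the truncation parameter. -/
theorem IsFundamentalKernel.norm_truncKernel_sub_le (h : IsFundamentalKernel K k C₀ C₁) {ε : ℝ}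
    (hε : 0 < ε) {s : ℝ} (hs : 0 < s) {z y : RN N} (hy : ‖y‖ ≤ s) (hz : 2 * s ≤ ‖z‖) :
    ‖truncKernel k ε (z - y) - truncKernel k ε z‖ ≤
      2 * 3 ^ (N + 1) * (C₀ + C₁) * majorant s z := by
  have hz0 : 0 < ‖z‖ := by linarith
  have hC0 := h.nonneg_zero
  have hC1 := h.nonneg_one
  have h1 : ‖z‖ / 2 ≤ ‖z - y‖ := by
    have := norm_sub_norm_le z y
    linarith
  have h2 : ‖k (z - y)‖ ≤ C₀ * 2 ^ N / ‖z‖ ^ N := by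
    refine (h.size _ (norm_pos_iff.1 ((half_pos hz0).trans_le h1))).trans ?_
    calc C₀ / ‖z - y‖ ^ N ≤ C₀ / (‖z‖ / 2) ^ N := by gcongr
      _ = _ := by
        rw [div_pow]
        field_simp
  have e : truncKernel k ε (z - y) - truncKernel k ε z =
      (cutoff (‖z - y‖ / ε) - cutoff (‖z‖ / ε)) • k (z - y) +
        cutoff (‖z‖ / ε) • (k (z - y) - k z) := by
    unfold truncKernel
    module
  rw [e]
  calc _ ≤ |cutoff (‖z - y‖ / ε) - cutoff (‖z‖ / ε)| * ‖k (z - y)‖ +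
        cutoff (‖z‖ / ε) * ‖k (z - y) - k z‖ := by
        refine (norm_add_le _ _).trans ?_
        rw [norm_smul, norm_smul, Real.norm_eq_abs, Real.norm_of_nonneg (cutoff_nonneg _)]
    _ ≤ 4 * s / ‖z‖ * (C₀ * 2 ^ N / ‖z‖ ^ N) + 1 * (C₁ * (3 ^ (N + 1) * majorant s z)) := by
        gcongr
        · exact abs_cutoff_sub_le_div hε hs hy hz
        · exact cutoff_le_one _
        · exact h.norm_kernel_sub_le hs hy hz
    _ = 2 * C₀ * (2 ^ (N + 1) * (s / ‖z‖ ^ (N + 1))) + C₁ * (3 ^ (N + 1) * majorant s z) := by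
        field_simp
        ring
    _ ≤ 2 * C₀ * (3 ^ (N + 1) * majorant s z) + 2 * C₁ * (3 ^ (N + 1) * majorant s z) := by
        have := majorant_nonneg hs z
        refine add_le_add (mul_le_mul_of_nonneg_left (div_pow_le_majorant hs hz) (by positivity)) ?_
        exact mul_le_mul_of_nonneg_right (by linarith) (by positivity)
    _ = _ := by ring

end

/-! ### The convolution operator on square integrable functions -/

theorem integral_fourierInv_mul_eq_flip {f g : RN N → ℂ} (hf : Integrable f) (hg : Integrable g) :
    ∫ x, 𝓕⁻ f x * g x = ∫ ξ, f ξ * 𝓕⁻ g ξ := by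
  have h := VectorFourier.integral_fourierIntegral_smul_eq_flip (L := -innerₗ (RN N))
    (μ := volume) (ν := volume) Real.continuous_fourierChar
    (by exact (continuous_inner (𝕜 := ℝ) (E := RN N)).neg) hf hg
  simp only [smul_eq_mul] at h
  have e : (-innerₗ (RN N)).flip = -innerₗ (RN N) := by
    ext x y
    simp [real_inner_comm]
  rw [e] at h
  exact h

theorem fourierInv_comp_sub_left (f : RN N → ℂ) (x ξ : RN N) :
    𝓕⁻ (fun y => f (x - y)) ξ = Real.fourierChar (inner ℝ ξ x) • 𝓕 f ξ := by
  rw [Real.fourierInv_eq, Real.fourier_eq,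
    ← integral_sub_left_eq_self (fun y => Real.fourierChar (inner ℝ y ξ) • f (x - y)) volume x,
    Circle.smul_def, ← integral_smul]
  congr 1
  ext y
  rw [← Circle.smul_def]
  rw [sub_sub_cancel, smul_smul, inner_sub_left, real_inner_comm, sub_eq_add_neg,
    AddChar.map_add_eq_mul]

theorem convL2_add (K : 𝓢'(RN N, ℂ)) (u v : Lp ℂ 2 (volume : Measure (RN N))) :
    convL2 K (u + v) = convL2 K u + convL2 K v := by
  rw [convL2, FourierTransform.fourier_add, Lp.add_smul, FourierTransform.fourierInv_add]
  rfl

theorem norm_convL2_le (K : 𝓢'(RN N, ℂ)) (u : Lp ℂ 2 (volume : Measure (RN N))) :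
    ‖convL2 K u‖ ≤ ‖symbol K‖ * ‖u‖ := by
  rw [convL2, ← Lp.norm_fourier_eq, fourier_fourierInv_eq, ← Lp.norm_fourier_eq u]
  exact Lp.norm_smul_le _ _

theorem continuous_convL2 (K : 𝓢'(RN N, ℂ)) : Continuous (convL2 K) := by
  let T : Lp ℂ 2 (volume : Measure (RN N)) →+ Lp ℂ 2 (volume : Measure (RN N)) :=
    AddMonoidHom.mk' (convL2 K) (convL2_add K)
  exact AddMonoidHomClass.continuous_of_bound T ‖symbol K‖ (norm_convL2_le K)

/-- On Schwartz functions, the operator on `L²` agrees with the pointwise defined convolution. -/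
theorem convL2_toLp_schwartz (K : 𝓢'(RN N, ℂ)) (φ : 𝓢(RN N, ℂ)) :
    (convL2 K (φ.toLp 2) : RN N → ℂ) =ᵐ[volume] convSchwartz K φ := by
  set h : Lp ℂ 2 (volume : Measure (RN N)) := symbol K • 𝓕 (φ.toLp 2 : Lp ℂ 2 volume) with hh
  have h1 : (h : RN N → ℂ) =ᵐ[volume] fun ξ => symbol K ξ * 𝓕 φ ξ := by
    rw [hh, SchwartzMap.toLp_fourier_eq]
    filter_upwards [Lp.coeFn_lpSMul (r := 2) (symbol K) ((𝓕 φ).toLp 2 : Lp ℂ 2 volume),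
      (𝓕 φ).coeFn_toLp 2 (volume : Measure (RN N))] with ξ h2 h3
    rw [h2, Pi.smul_apply', h3, smul_eq_mul]
  refine ae_eq_of_integral_contDiff_smul_eq ((Lp.memLp _).locallyIntegrable (by norm_num))
    (continuous_convSchwartz K φ).locallyIntegrable fun g hg hgc => ?_
  let ψ : 𝓢(RN N, ℂ) := HasCompactSupport.toSchwartzMap (f := fun x => (g x : ℂ))
    (hgc.comp_left Complex.ofReal_zero) (Complex.ofRealCLM.contDiff.comp hg)
  have hψ : ∀ x, ψ x = g x := fun x => rfl
  have h2 : Lp.toTemperedDistribution (convL2 K (φ.toLp 2)) ψ =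
      Lp.toTemperedDistribution h (𝓕⁻ ψ) := by
    have : Lp.toTemperedDistribution (convL2 K (φ.toLp 2)) =
      𝓕⁻ (Lp.toTemperedDistribution h) := (Lp.fourierInv_toTemperedDistribution_eq h).symm
    rw [this]
    rfl
  rw [Lp.toTemperedDistribution_apply, Lp.toTemperedDistribution_apply] at h2
  simp only [hψ, Complex.coe_smul] at h2
  rw [h2]
  calc ∫ ξ, 𝓕⁻ ψ ξ * h ξ = ∫ ξ, (symbol K ξ * 𝓕 φ ξ) * 𝓕⁻ (ψ : RN N → ℂ) ξ := by
        refine integral_congr_ae ?_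
        filter_upwards [h1] with ξ h3
        rw [h3, mul_comm, SchwartzMap.fourierInv_coe]
    _ = ∫ x, convSchwartz K φ x * ψ x :=
        (integral_fourierInv_mul_eq_flip (integrable_symbol_mul K (𝓕 φ)) ψ.integrable).symm
    _ = ∫ x, g x • convSchwartz K φ x := by
        congr 1
        ext x
        rw [hψ, mul_comm, Complex.real_smul]

theorem measurePreserving_sub_left' (x : RN N) :
    MeasurePreserving (fun y : RN N => x - y) volume volume :=
  Measure.measurePreserving_sub_left volume x

/-- The bilinear form `(f, u) ↦ (f * u)(x)` on square integrable functions. -/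
def convPairing (x : RN N) :
    Lp ℂ 2 (volume : Measure (RN N)) →L[ℂ] Lp ℂ 2 (volume : Measure (RN N)) →L[ℂ] ℂ :=
  (ContinuousLinearMap.mul ℂ ℂ).lpPairing volume 2 2 ∘L
    (Lp.compMeasurePreservingₗᵢ ℂ (fun y : RN N => x - y)
      (measurePreserving_sub_left' x)).toContinuousLinearMap

theorem convPairing_apply (x : RN N) (f u : Lp ℂ 2 (volume : Measure (RN N))) :
    convPairing x f u = ∫ y, f (x - y) * u y := by
  rw [convPairing, ContinuousLinearMap.comp_apply, ContinuousLinearMap.lpPairing_eq_integral]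
  refine integral_congr_ae ?_
  filter_upwards [Lp.coeFn_compMeasurePreserving f (measurePreserving_sub_left' x)] with y hy
  have : (Lp.compMeasurePreservingₗᵢ ℂ (fun y : RN N => x - y)
      (measurePreserving_sub_left' x)).toContinuousLinearMap f =
    Lp.compMeasurePreserving (fun y : RN N => x - y) (measurePreserving_sub_left' x) f := rfl
  rw [this, hy]
  rfl

theorem ae_comp_sub_left {f g : RN N → ℂ} (h : f =ᵐ[volume] g) (x : RN N) :
    (fun y => f (x - y)) =ᵐ[volume] fun y => g (x - y) :=
  (measurePreserving_sub_left' x).quasiMeasurePreserving.ae_eq_comp h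

/-- The convolution `φ * (K * ψ)` as an integral in the Fourier variable, in which `φ` and `ψ` play
the same role. -/
theorem integral_mul_convSchwartz (K : 𝓢'(RN N, ℂ)) (x : RN N) (φ ψ : 𝓢(RN N, ℂ)) :
    ∫ y, φ (x - y) * convSchwartz K ψ y =
      ∫ ξ, (symbol K ξ * 𝓕 ψ ξ) * (Real.fourierChar (inner ℝ ξ x) • 𝓕 φ ξ) := by
  have h := integral_fourierInv_mul_eq_flip (integrable_symbol_mul K (𝓕 ψ))
    (φ.integrable.comp_sub_left x)
  simp only [fourierInv_comp_sub_left] at h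
  simp only [mul_comm (φ _)]
  exact h

theorem convPairing_eq_of_ae (x : RN N) {f u : Lp ℂ 2 (volume : Measure (RN N))}
    {f' u' : RN N → ℂ} (hf : f =ᵐ[volume] f') (hu : u =ᵐ[volume] u') :
    convPairing x f u = ∫ y, f' (x - y) * u' y := by
  rw [convPairing_apply]
  refine integral_congr_ae ?_
  filter_upwards [ae_comp_sub_left hf x, hu] with y h1 h2
  rw [h1, h2]

theorem convPairing_convL2_schwartz (K : 𝓢'(RN N, ℂ)) (x : RN N) (φ ψ : 𝓢(RN N, ℂ)) :
    convPairing x (φ.toLp 2 volume) (convL2 K (ψ.toLp 2 volume)) =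
      convPairing x (convL2 K (φ.toLp 2 volume)) (ψ.toLp 2 volume) := by
  have h1 := convPairing_eq_of_ae x (φ.coeFn_toLp 2 volume) (convL2_toLp_schwartz K ψ)
  have h2 := convPairing_eq_of_ae x (convL2_toLp_schwartz K φ) (ψ.coeFn_toLp 2 volume)
  have e : ∫ y, convSchwartz K φ (x - y) * ψ y = ∫ y, ψ (x - y) * convSchwartz K φ y := by
    rw [← integral_sub_left_eq_self (fun y => ψ (x - y) * convSchwartz K φ y) volume x]
    simp only [sub_sub_cancel, mul_comm]
  refine h1.trans (Eq.trans ?_ h2.symm)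
  rw [e, integral_mul_convSchwartz, integral_mul_convSchwartz]
  congr 1
  ext ξ
  simp only [Circle.smul_def, smul_eq_mul]
  ring

/-- The convolution operator commutes with convolution: `f * (K * u) = (K * f) * u`. -/
theorem convPairing_convL2 (K : 𝓢'(RN N, ℂ)) (x : RN N)
    (f u : Lp ℂ 2 (volume : Measure (RN N))) :
    convPairing x f (convL2 K u) = convPairing x (convL2 K f) u := by
  have hdense : DenseRange (SchwartzMap.toLpCLM ℂ ℂ 2 (volume : Measure (RN N))) :=
    SchwartzMap.denseRange_toLpCLM ENNReal.ofNat_ne_top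
  have hc := continuous_convL2 K
  -- for Schwartz functions, both sides are the integral of `symbol K * 𝓕 f * 𝓕 u` against a
  -- character
  have h1 : ∀ φ : 𝓢(RN N, ℂ), convPairing x (SchwartzMap.toLpCLM ℂ ℂ 2 volume φ) (convL2 K u) =
      convPairing x (convL2 K (SchwartzMap.toLpCLM ℂ ℂ 2 volume φ)) u := by
    intro φ
    refine congrFun (hdense.equalizer ((ContinuousLinearMap.continuous _).comp hc)
      (ContinuousLinearMap.continuous _) (funext fun ψ => ?_)) u
    exact convPairing_convL2_schwartz K x φ ψ
  exact congrFun (hdense.equalizer ((convPairing x).continuous.clm_apply continuous_const)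
    (((convPairing x).continuous.comp hc).clm_apply continuous_const) (funext h1)) f

/-- For a Schwartz function `ψ`, the identity `ψ * (K * u) = (K * ψ) * u` holds at every point. -/
theorem integral_mul_convL2 (K : 𝓢'(RN N, ℂ)) (x : RN N) (ψ : 𝓢(RN N, ℂ))
    (u : Lp ℂ 2 (volume : Measure (RN N))) :
    ∫ y, ψ (x - y) * convL2 K u y = ∫ y, convSchwartz K ψ (x - y) * u y := by
  have h1 := convPairing_eq_of_ae x (ψ.coeFn_toLp 2 volume) (ae_eq_refl (convL2 K u))
  have h2 := convPairing_eq_of_ae x (convL2_toLp_schwartz K ψ) (ae_eq_refl u)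
  exact h1.symm.trans ((convPairing_convL2 K x (ψ.toLp 2 volume) u).trans h2)

/-- The convolution of `K` with a Schwartz function, evaluated by applying the distribution `K`. -/
theorem convSchwartz_eq_apply {K : 𝓢'(RN N, ℂ)} (hK : HasBoundedSymbol K) {ψ τ : 𝓢(RN N, ℂ)}
    {x : RN N} (h : ∀ y, τ y = ψ (x - y)) : convSchwartz K ψ x = K τ := by
  have h1 : K τ = (𝓕 K) (𝓕⁻ τ) := by
    rw [TemperedDistribution.fourier_apply, fourier_fourierInv_eq]
  rw [h1, fourier_eq_symbol hK, Lp.toTemperedDistribution_apply, convSchwartz, Real.fourierInv_eq]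
  have h2 : (τ : RN N → ℂ) = fun y => ψ (x - y) := funext h
  congr 1
  ext ξ
  rw [SchwartzMap.fourierInv_coe, h2, fourierInv_comp_sub_left, ← SchwartzMap.fourier_coe]
  simp only [Circle.smul_def, smul_eq_mul]
  ring

/-! ### Convolution of the kernel with dilated functions -/

/-- A smooth compactly supported real function as a complex Schwartz function. -/
def schwartzOfReal (g : RN N → ℝ) (hg : ContDiff ℝ ((⊤ : ℕ∞) : WithTop ℕ∞) g)
    (hgc : HasCompactSupport g) : 𝓢(RN N, ℂ) :=
  HasCompactSupport.toSchwartzMap (f := fun x => (g x : ℂ))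
    (hgc.comp_left Complex.ofReal_zero) (Complex.ofRealCLM.contDiff.comp hg)

theorem schwartzOfReal_apply (g : RN N → ℝ) (hg : ContDiff ℝ ((⊤ : ℕ∞) : WithTop ℕ∞) g)
    (hgc : HasCompactSupport g) (x : RN N) : schwartzOfReal g hg hgc x = g x := rfl

theorem contDiff_comp_affine {g : RN N → ℝ} (hg : ContDiff ℝ ((⊤ : ℕ∞) : WithTop ℕ∞) g) (a : RN N)
    (c : ℝ) : ContDiff ℝ ((⊤ : ℕ∞) : WithTop ℕ∞) fun y => g (a + c • y) := by
  fun_prop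

theorem hasCompactSupport_comp_affine {g : RN N → ℝ} (hg : HasCompactSupport g) (a : RN N)
    {c : ℝ} (hc : c ≠ 0) : HasCompactSupport fun y => g (a + c • y) :=
  hg.comp_homeomorph ((Homeomorph.smulOfNeZero c hc).trans (Homeomorph.addLeft a))

/-- The Schwartz function `y ↦ g (a + c y)`. -/
def schwartzAffine (g : RN N → ℝ) (hg : ContDiff ℝ ((⊤ : ℕ∞) : WithTop ℕ∞) g)
    (hgc : HasCompactSupport g) (a : RN N) (c : ℝ) (hc : c ≠ 0) : 𝓢(RN N, ℂ) :=
  schwartzOfReal _ (contDiff_comp_affine hg a c) (hasCompactSupport_comp_affine hgc a hc)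

theorem schwartzAffine_apply (g : RN N → ℝ) (hg : ContDiff ℝ ((⊤ : ℕ∞) : WithTop ℕ∞) g)
    (hgc : HasCompactSupport g) (a : RN N) (c : ℝ) (hc : c ≠ 0) (y : RN N) :
    schwartzAffine g hg hgc a c hc y = g (a + c • y) := rfl

/-- Testing `K * u` against a smooth compactly supported function. -/
theorem integral_smul_convL2 (K : 𝓢'(RN N, ℂ)) {g : RN N → ℝ}
    (hg : ContDiff ℝ ((⊤ : ℕ∞) : WithTop ℕ∞) g) (hgc : HasCompactSupport g)
    (u : Lp ℂ 2 (volume : Measure (RN N))) :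
    ∫ z, g z • convL2 K u z =
      ∫ y, convSchwartz K (schwartzAffine g hg hgc 0 (-1) (by norm_num)) (-y) * u y := by
  have h := integral_mul_convL2 K 0 (schwartzAffine g hg hgc 0 (-1) (by norm_num)) u
  simp only [zero_sub, schwartzAffine_apply, zero_add, neg_smul, one_smul, neg_neg] at h
  simpa only [Complex.real_smul] using h

/-- Away from the origin, `K * f` is given by integration against the kernel. -/
theorem IsFundamentalKernel.convL2_ae_eq {K : 𝓢'(RN N, ℂ)} {k : RN N → ℂ} {C₀ C₁ : ℝ}
    (h : IsFundamentalKernel K k C₀ C₁) {ε : ℝ} (hε : 0 < ε)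
    (f : Lp ℂ 2 (volume : Measure (RN N))) (hf : Integrable f)
    (hf0 : ∀ᵐ x, x ∉ ball (0 : RN N) ε → f x = 0) :
    ∀ᵐ z : RN N, 2 * ε < ‖z‖ → convL2 K f z = ∫ y, truncKernel k ε (z - y) * f y := by
  have hkc := h.continuous_truncKernel hε
  have hkb := h.norm_truncKernel_le hε
  have hconv := continuous_conv_of_bounded hkc hkb hf
  have hSf : LocallyIntegrable (convL2 K f) := (Lp.memLp _).locallyIntegrable (by norm_num)
  have hU : IsOpen {z : RN N | 2 * ε < ‖z‖} := isOpen_lt continuous_const continuous_norm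
  have key := hU.ae_eq_zero_of_integral_contDiff_smul_eq_zero (μ := volume)
    (f := fun z => convL2 K f z - ∫ y, truncKernel k ε (z - y) * f y)
    ((hSf.sub hconv.locallyIntegrable).locallyIntegrableOn _) ?_
  · filter_upwards [key] with z hz hz'
    exact sub_eq_zero.1 (hz hz')
  intro g hg hgc hgU
  have hgi : Integrable g := hg.continuous.integrable_of_hasCompactSupport hgc
  have hi1 : Integrable (fun z => g z • convL2 K f z) :=
    hSf.integrable_smul_left_of_hasCompactSupport hg.continuous hgc
  have hi2 : Integrable (fun z => g z • ∫ y, truncKernel k ε (z - y) * f y) :=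
    hconv.locallyIntegrable.integrable_smul_left_of_hasCompactSupport hg.continuous hgc
  simp only [smul_sub]
  rw [integral_sub hi1 hi2, sub_eq_zero, integral_smul_convL2 K hg hgc]
  -- for `y` in the support of `f`, the translate of `g` by `y` is supported away from the origin,
  -- where the distribution `K` is the function `k`
  have hpt : ∀ y ∈ ball (0 : RN N) ε,
      convSchwartz K (schwartzAffine g hg hgc 0 (-1) (by norm_num)) (-y) =
        ∫ z, truncKernel k ε (z - y) * g z := by
    intro y hy
    rw [mem_ball_zero_iff] at hy
    have hfar : ∀ z, g z ≠ 0 → 2 * ε < ‖z‖ := fun z hz => hgU (subset_tsupport g hz)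
    rw [convSchwartz_eq_apply h.boundedSymbol
      (τ := schwartzAffine g hg hgc y 1 one_ne_zero) (fun w => ?_)]
    · rw [h.restriction, ← integral_sub_right_eq_self _ y]
      · refine integral_congr_ae (Eventually.of_forall fun z => ?_)
        simp only [schwartzAffine_apply, one_smul, add_sub_cancel]
        by_cases hz : g z = 0
        · simp [hz]
        · rw [truncKernel_of_le hε]
          have h1 := hfar z hz
          have h2 := norm_sub_norm_le z y
          linarith
      · exact (hasCompactSupport_comp_affine hgc y one_ne_zero).comp_left Complex.ofReal_zero
      · intro h0
        refine notMem_tsupport_iff_eventuallyEq.2 ?_ h0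
        filter_upwards [ball_mem_nhds (0 : RN N) hε] with w hw
        rw [mem_ball_zero_iff] at hw
        rw [schwartzAffine_apply, one_smul]
        by_contra hne
        have h1 := hfar (y + w) (fun h0 => hne (by rw [h0]; simp))
        have h2 := norm_add_le y w
        linarith
    · simp only [schwartzAffine_apply]
      congr 2
      module
  calc ∫ y, convSchwartz K (schwartzAffine g hg hgc 0 (-1) (by norm_num)) (-y) * f y
      = ∫ y, ∫ z, truncKernel k ε (z - y) * g z * f y := by
        refine integral_congr_ae ?_
        filter_upwards [hf0] with y hy
        by_cases hyb : y ∈ ball (0 : RN N) ε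
        · rw [hpt y hyb, integral_mul_const]
        · simp [hy hyb]
    _ = ∫ z, ∫ y, truncKernel k ε (z - y) * g z * f y := by
        refine integral_integral_swap ?_
        have h1 : Integrable (fun p : RN N × RN N => f p.1 * (g p.2 : ℂ))
            (volume.prod volume) := hf.mul_prod hgi.ofReal
        refine (h1.bdd_mul (c := C₀ * 2 ^ N * (ε ^ N)⁻¹)
          (f := fun p : RN N × RN N => truncKernel k ε (p.2 - p.1)) ?_
          (Eventually.of_forall fun p => hkb _)).congr (Eventually.of_forall fun p => ?_)
        · exact (hkc.comp (continuous_snd.sub continuous_fst)).aestronglyMeasurable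
        · simp only [Function.uncurry]
          ring
    _ = ∫ z, g z • ∫ y, truncKernel k ε (z - y) * f y := by
        congr 1
        ext z
        rw [← integral_smul]
        congr 1
        ext y
        rw [Complex.real_smul]
        ring

theorem quasiMeasurePreserving_const_smul {c : ℝ} (hc : c ≠ 0) :
    Measure.QuasiMeasurePreserving (fun x : RN N => c • x) volume volume := by
  refine ⟨measurable_const_smul _, ?_⟩
  rw [Measure.map_addHaar_smul _ hc]
  exact Measure.smul_absolutelyContinuous

theorem aestronglyMeasurable_dilate {f : RN N → ℂ} (hf : AEStronglyMeasurable f volume) {ε : ℝ}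
    (hε : 0 < ε) : AEStronglyMeasurable (dilate f ε) volume :=
  (hf.comp_quasiMeasurePreserving
    (quasiMeasurePreserving_const_smul (inv_ne_zero hε.ne'))).const_smul ((ε ^ N)⁻¹ : ℝ)

theorem integrable_dilate {f : RN N → ℂ} (hf : Integrable f) {ε : ℝ} (hε : 0 < ε) :
    Integrable (dilate f ε) :=
  (hf.comp_smul (inv_ne_zero hε.ne')).smul ((ε ^ N)⁻¹ : ℝ)

theorem memLp_two_dilate {f : RN N → ℂ} (hf : MemLp f 2 volume) {ε : ℝ} (hε : 0 < ε) :
    MemLp (dilate f ε) 2 volume := by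
  refine (memLp_two_iff_integrable_sq_norm (aestronglyMeasurable_dilate hf.1 hε)).2 ?_
  have h := ((memLp_two_iff_integrable_sq_norm hf.1).1 hf).comp_smul (inv_ne_zero hε.ne')
  refine (h.const_mul (((ε ^ N)⁻¹ : ℝ) ^ 2)).congr (Eventually.of_forall fun x => ?_)
  simp only [dilate, norm_smul, mul_pow, Real.norm_eq_abs, sq_abs]

theorem dilate_smul (f : RN N → ℂ) {ε : ℝ} (hε : 0 < ε) (x : RN N) :
    dilate f ε (ε • x) = ((ε ^ N)⁻¹ : ℝ) • f x := by
  rw [dilate, inv_smul_smul₀ hε.ne']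

/-- Change of variables in an integral against a dilated function. -/
theorem integral_mul_dilate (F f : RN N → ℂ) {ε : ℝ} (hε : 0 < ε) :
    ∫ y, F y * dilate f ε y = ∫ w, F (ε • w) * f w := by
  have h := Measure.integral_comp_smul (volume : Measure (RN N)) (fun y => F y * dilate f ε y) ε
  rw [finrank_euclideanSpace_fin, abs_of_pos (by positivity)] at h
  have h0 : (ε ^ N : ℝ) ≠ 0 := by positivity
  have h2 : ∀ x, F (ε • x) * dilate f ε (ε • x) = ((ε ^ N)⁻¹ : ℝ) • (F (ε • x) * f x) := by
    intro x
    rw [dilate_smul f hε, mul_smul_comm]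
  simp only [h2] at h
  rw [integral_smul] at h
  exact (smul_right_injective ℂ (inv_ne_zero h0) h).symm

theorem lintegral_comp_smul (F : RN N → ℝ≥0∞) {c : ℝ} (hc : c ≠ 0) :
    ∫⁻ y, F (c • y) = ENNReal.ofReal |(c ^ N)⁻¹| * ∫⁻ y, F y := by
  have h := (Homeomorph.smulOfNeZero c hc).measurableEmbedding.lintegral_map (μ := volume) F
  have h2 : Measure.map (Homeomorph.smulOfNeZero c hc) (volume : Measure (RN N)) =
      ENNReal.ofReal |(c ^ N)⁻¹| • volume := by
    have := Measure.map_addHaar_smul (volume : Measure (RN N)) hc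
    rwa [finrank_euclideanSpace_fin] at this
  rw [h2, lintegral_smul_measure] at h
  exact h.symm

theorem lintegral_enorm_dilate (f : RN N → ℂ) {ε : ℝ} (hε : 0 < ε) :
    ∫⁻ y, ‖dilate f ε y‖ₑ = ∫⁻ y, ‖f y‖ₑ := by
  have h := lintegral_comp_smul (fun y => ‖f y‖ₑ) (inv_ne_zero hε.ne')
  simp only [dilate, enorm_smul]
  rw [lintegral_const_mul' _ _ enorm_ne_top, h, ← mul_assoc, Real.enorm_of_nonneg (by positivity),
    ← ENNReal.ofReal_mul (by positivity), inv_pow, inv_inv, abs_of_pos (by positivity),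
    inv_mul_cancel₀ (by positivity), ENNReal.ofReal_one, one_mul]

theorem integral_dilate (f : RN N → ℂ) {ε : ℝ} (hε : 0 < ε) :
    ∫ y, dilate f ε y = ∫ y, f y := by
  simpa using integral_mul_dilate (fun _ => 1) f hε

theorem dilate_eq_zero_ae {f : RN N → ℂ} (h0 : ∀ᵐ x, x ∉ ball (0 : RN N) 1 → f x = 0) {ε : ℝ}
    (hε : 0 < ε) : ∀ᵐ x, x ∉ ball (0 : RN N) ε → dilate f ε x = 0 := by
  filter_upwards [(quasiMeasurePreserving_const_smul (inv_ne_zero hε.ne')).ae h0] with x hx hxb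
  rw [dilate, hx, smul_zero]
  rw [mem_ball_zero_iff, norm_smul, norm_inv, Real.norm_of_nonneg hε.le] at *
  rw [inv_mul_lt_iff₀ hε, mul_one]
  exact hxb

theorem rescale_apply_eq {K : 𝓢'(RN N, ℂ)} {c : ℝ} (hc : c ≠ 0) {τ τ' : 𝓢(RN N, ℂ)}
    (h : ∀ y, τ y = τ' (c⁻¹ • y)) : rescale c hc K τ' = K τ := by
  change K (SchwartzMap.compCLMOfContinuousLinearEquiv ℂ _ τ') = _
  congr 1
  ext y
  exact (h y).symm

/-- Scaling of the convolution operator: `K * ρ_ε` is the dilation of `(ε^N K(ε ·)) * ρ`. -/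
theorem convL2_dilate_ae_eq {K : 𝓢'(RN N, ℂ)} (hK : HasBoundedSymbol K) {ε : ℝ} (hε : 0 < ε)
    {f : RN N → ℂ} (hf : MemLp f 2 volume) :
    convL2 K ((memLp_two_dilate hf hε).toLp _) =ᵐ[volume]
      dilate (convL2 (rescale ε hε.ne' K) (hf.toLp f)) ε := by
  refine ae_eq_of_integral_contDiff_smul_eq ((Lp.memLp _).locallyIntegrable (by norm_num))
    ((memLp_two_dilate (Lp.memLp _) hε).locallyIntegrable (by norm_num)) fun g hg hgc => ?_
  rw [integral_smul_convL2 K hg hgc]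
  have hg' := contDiff_comp_affine hg 0 ε
  have hgc' := hasCompactSupport_comp_affine hgc 0 hε.ne'
  have e1 : ∫ y, convSchwartz K (schwartzAffine g hg hgc 0 (-1) (by norm_num)) (-y) *
      (memLp_two_dilate hf hε).toLp _ y =
      ∫ w, convSchwartz K (schwartzAffine g hg hgc 0 (-1) (by norm_num)) (-(ε • w)) * f w := by
    rw [← integral_mul_dilate (fun y => convSchwartz K
      (schwartzAffine g hg hgc 0 (-1) (by norm_num)) (-y)) f hε]
    refine integral_congr_ae ?_
    filter_upwards [(memLp_two_dilate hf hε).coeFn_toLp] with y hy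
    rw [hy]
  have e2 : ∫ z, g z • dilate (convL2 (rescale ε hε.ne' K) (hf.toLp f)) ε z =
      ∫ w, g (0 + ε • w) • convL2 (rescale ε hε.ne' K) (hf.toLp f) w := by
    simp only [Complex.real_smul, zero_add]
    exact integral_mul_dilate (fun z => (g z : ℂ)) _ hε
  rw [e1, e2, integral_smul_convL2 _ hg' hgc']
  refine integral_congr_ae ?_
  filter_upwards [hf.coeFn_toLp] with w hw
  rw [hw]
  congr 1
  rw [convSchwartz_eq_apply hK (τ := schwartzAffine g hg hgc (ε • w) 1 one_ne_zero),
    convSchwartz_eq_apply (hasBoundedSymbol_rescale hK ε hε.ne')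
      (τ := schwartzAffine g hg hgc (ε • w) ε hε.ne'), rescale_apply_eq]
  · intro y
    simp only [schwartzAffine_apply, one_smul, smul_inv_smul₀ hε.ne']
  · intro y
    simp only [schwartzAffine_apply]
    congr 2
    module
  · intro y
    simp only [schwartzAffine_apply]
    congr 2
    module

/-- The convolution of the kernel with a function `R` supported in the ball of radius `ε` differs
from a multiple of the truncated kernel by a multiple of the majorant at scale `ε`. -/
theorem IsFundamentalKernel.norm_convL2_sub_le {K : 𝓢'(RN N, ℂ)} {k : RN N → ℂ} {C₀ C₁ : ℝ}
    (h : IsFundamentalKernel K k C₀ C₁) {ε : ℝ} (hε : 0 < ε)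
    (R : Lp ℂ 2 (volume : Measure (RN N))) (hR : Integrable R)
    (hR0 : ∀ᵐ x, x ∉ ball (0 : RN N) ε → R x = 0) {Q q : ℝ} (hq : ∫ x, ‖R x‖ ≤ q)
    (hQ : ∀ᵐ z, ‖convL2 K R z‖ ≤ Q * (ε ^ N)⁻¹) :
    ∀ᵐ z, ‖convL2 K R z - (∫ x, R x) * truncKernel k ε z‖ ≤
      6 ^ (N + 1) * (Q + q * (C₀ + C₁)) * majorant ε z := by
  have hkc := h.continuous_truncKernel hε
  have hkb := h.norm_truncKernel_le hε
  have hC0 := h.nonneg_zero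
  have hC1 := h.nonneg_one
  have hq0 : 0 ≤ q := (integral_nonneg fun x => norm_nonneg _).trans hq
  have hR1 : ‖∫ x, R x‖ ≤ q := (norm_integral_le_integral_norm _).trans hq
  filter_upwards [hQ, h.convL2_ae_eq hε R hR hR0] with z hz1 hz2
  have hmaj := majorant_nonneg hε z
  have hQ0 : 0 ≤ Q := by
    have h1 := (norm_nonneg _).trans hz1
    exact nonneg_of_mul_nonneg_left h1 (by positivity)
  rcases le_or_gt ‖z‖ (2 * ε) with hz | hz
  · -- near the origin, both terms are separately bounded by a multiple of `ε ^ (-N)`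
    calc ‖convL2 K R z - (∫ x, R x) * truncKernel k ε z‖
        ≤ ‖convL2 K R z‖ + ‖(∫ x, R x) * truncKernel k ε z‖ := _root_.norm_sub_le _ _
      _ ≤ Q * (ε ^ N)⁻¹ + q * (C₀ * 2 ^ N * (ε ^ N)⁻¹) := by
          rw [norm_mul]
          exact add_le_add hz1 (mul_le_mul hR1 (hkb z) (norm_nonneg _) hq0)
      _ = (Q + 2 ^ N * (q * C₀)) * (ε ^ N)⁻¹ := by ring
      _ ≤ (Q + 2 ^ N * (q * C₀)) * (3 ^ (N + 1) * majorant ε z) :=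
          mul_le_mul_of_nonneg_left (inv_pow_le_majorant hε hz) (by positivity)
      _ ≤ (2 ^ (N + 1) * Q + 2 ^ (N + 1) * (q * (C₀ + C₁))) * (3 ^ (N + 1) * majorant ε z) := by
          gcongr
          · exact le_mul_of_one_le_left hQ0 (one_le_pow₀ (by norm_num))
          · norm_num
          · omega
          · linarith
      _ = _ := by
          rw [show (6 : ℝ) = 2 * 3 by norm_num, mul_pow]
          ring
  · -- far from the origin, the difference is controlled by the regularity of the kernel
    have e : convL2 K R z - (∫ x, R x) * truncKernel k ε z =
        ∫ y, (truncKernel k ε (z - y) - truncKernel k ε z) * R y := by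
      simp only [sub_mul]
      rw [hz2 hz, integral_sub (integrable_mul_of_bounded hkc hkb hR z) (hR.const_mul _),
        integral_const_mul, mul_comm (∫ x, R x)]
    rw [e]
    calc ‖∫ y, (truncKernel k ε (z - y) - truncKernel k ε z) * R y‖
        ≤ ∫ y, 2 * 3 ^ (N + 1) * (C₀ + C₁) * majorant ε z * ‖R y‖ := by
          refine norm_integral_le_of_norm_le (hR.norm.const_mul _) ?_
          filter_upwards [hR0] with y hy
          rw [norm_mul]
          by_cases hyb : y ∈ ball (0 : RN N) ε
          · gcongr
            rw [mem_ball_zero_iff] at hyb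
            exact h.norm_truncKernel_sub_le hε hε hyb.le hz.le
          · simp [hy hyb]
      _ ≤ 2 * 3 ^ (N + 1) * (C₀ + C₁) * majorant ε z * q := by
          rw [integral_const_mul]
          gcongr
      _ = 2 * (3 ^ (N + 1) * (q * (C₀ + C₁)) * majorant ε z) := by ring
      _ ≤ 2 ^ (N + 1) * (3 ^ (N + 1) * (Q + q * (C₀ + C₁)) * majorant ε z) := by
          gcongr
          · exact le_self_pow₀ (by norm_num) (by omega)
          · linarith
      _ = _ := by
          rw [show (6 : ℝ) = 2 * 3 by norm_num, mul_pow]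
          ring

/-! ### Pointwise bounds for the mollifications of `K * u` -/

/-- The constant in the majorization of convolutions by the Hardy-Littlewood maximal function. -/
def majorantConst (N : ℕ) : ℝ≥0∞ := ENNReal.ofReal (2 ^ (N + 1)) * volume (ball (0 : RN N) 1)

theorem majorantConst_ne_top (N : ℕ) : majorantConst N ≠ ∞ := by
  unfold majorantConst
  have := (measure_ball_lt_top (μ := volume) (x := (0 : RN N)) (r := 1)).ne
  finiteness

theorem measurable_enorm_coeFn (u : Lp ℂ 2 (volume : Measure (RN N))) :
    Measurable fun y => ‖u y‖ₑ :=
  (Lp.stronglyMeasurable u).measurable.enorm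

theorem integral_dilate_mul_convL2 (K : 𝓢'(RN N, ℂ)) {ε : ℝ} (hε : 0 < ε) {f : RN N → ℂ}
    (hf : MemLp f 2 volume) (u : Lp ℂ 2 (volume : Measure (RN N))) (x : RN N) :
    ∫ y, dilate f ε (x - y) * convL2 K u y =
      ∫ y, convL2 K ((memLp_two_dilate hf hε).toLp _) (x - y) * u y := by
  rw [← convPairing_eq_of_ae x (memLp_two_dilate hf hε).coeFn_toLp (ae_eq_refl (convL2 K u)),
    convPairing_convL2, convPairing_apply]

/-- The mollification of `K * u` by `f_ε` is, up to a multiple of the maximal function of `u`, a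
multiple of the convolution of `u` with the kernel truncated at scale `ε`. -/
theorem IsFundamentalKernel.enorm_integral_dilate_sub_le {K : 𝓢'(RN N, ℂ)} {k : RN N → ℂ}
    {C₀ C₁ : ℝ} (h : IsFundamentalKernel K k C₀ C₁) {ε : ℝ} (hε : 0 < ε) {f : RN N → ℂ}
    (hf : MemLp f 2 volume) (hfi : Integrable f)
    (hf0 : ∀ᵐ x, x ∉ ball (0 : RN N) 1 → f x = 0) {Q q : ℝ} (hq : ∫ x, ‖f x‖ ≤ q)
    (hQ : ∀ᵐ z, ‖convL2 K ((memLp_two_dilate hf hε).toLp _) z‖ ≤ Q * (ε ^ N)⁻¹)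
    {u : Lp ℂ 2 (volume : Measure (RN N))} (hu : Integrable u) (x : RN N) :
    ‖(∫ y, dilate f ε (x - y) * convL2 K u y) -
        (∫ y, f y) * ∫ y, truncKernel k ε (x - y) * u y‖ₑ ≤
      ENNReal.ofReal (6 ^ (N + 1) * (Q + q * (C₀ + C₁))) * majorantConst N *
        hlMax (fun y => ‖u y‖ₑ) x := by
  set R := (memLp_two_dilate hf hε).toLp (dilate f ε) with hR
  have hRae : R =ᵐ[volume] dilate f ε := (memLp_two_dilate hf hε).coeFn_toLp
  have hRi : Integrable R := (integrable_dilate hfi hε).congr hRae.symm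
  have hR0 : ∀ᵐ x, x ∉ ball (0 : RN N) ε → R x = 0 := by
    filter_upwards [hRae, dilate_eq_zero_ae hf0 hε] with y h1 h2
    rwa [h1]
  have hRint : ∫ y, R y = ∫ y, f y := by
    rw [integral_congr_ae hRae, integral_dilate f hε]
  have hRn : ∫ y, ‖R y‖ ≤ q := by
    refine le_trans (le_of_eq ?_) hq
    rw [integral_norm_eq_lintegral_enorm hRi.aestronglyMeasurable,
      integral_norm_eq_lintegral_enorm hfi.aestronglyMeasurable, ← lintegral_enorm_dilate f hε]
    congr 1
    refine lintegral_congr_ae ?_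
    filter_upwards [hRae] with y hy
    rw [hy]
  have key := h.norm_convL2_sub_le hε R hRi hR0 hRn hQ
  rw [hRint] at key
  have hkc := h.continuous_truncKernel hε
  have hkb := h.norm_truncKernel_le hε
  have hi1 : Integrable (fun y => convL2 K R (x - y) * u y) :=
    MemLp.integrable_mul
      ((Lp.memLp (convL2 K R)).comp_measurePreserving (measurePreserving_sub_left' x))
      (Lp.memLp u)
  have e : (∫ y, dilate f ε (x - y) * convL2 K u y) -
      (∫ y, f y) * ∫ y, truncKernel k ε (x - y) * u y =
      ∫ y, (convL2 K R (x - y) - (∫ y, f y) * truncKernel k ε (x - y)) * u y := by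
    rw [integral_dilate_mul_convL2 K hε hf u x, ← integral_const_mul, ← integral_sub hi1
      ((integrable_mul_of_bounded hkc hkb hu x).const_mul _)]
    congr 1
    ext y
    ring
  rw [e]
  refine (enorm_integral_le_lintegral_enorm _).trans ?_
  calc ∫⁻ y, ‖(convL2 K R (x - y) - (∫ y, f y) * truncKernel k ε (x - y)) * u y‖ₑ
      ≤ ∫⁻ y, ENNReal.ofReal (6 ^ (N + 1) * (Q + q * (C₀ + C₁))) *
          (ENNReal.ofReal (majorant ε (x - y)) * ‖u y‖ₑ) := by
        refine lintegral_mono_ae ?_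
        filter_upwards [(measurePreserving_sub_left' x).quasiMeasurePreserving.ae key]
          with y hy
        rw [enorm_mul, ← mul_assoc, ← ENNReal.ofReal_mul' (majorant_nonneg hε _)]
        gcongr
        rw [← ofReal_norm]
        exact ENNReal.ofReal_le_ofReal hy
    _ = ENNReal.ofReal (6 ^ (N + 1) * (Q + q * (C₀ + C₁))) *
          ∫⁻ y, ENNReal.ofReal (majorant ε (x - y)) * ‖u y‖ₑ :=
        lintegral_const_mul' _ _ ENNReal.ofReal_ne_top
    _ ≤ _ := by
        rw [mul_assoc]
        gcongr
        exact lintegral_majorant_mul_le hε (measurable_enorm_coeFn u) x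

/-- Mollification by a bounded function supported in the unit ball is controlled by the maximal
function. -/
theorem enorm_integral_dilate_mul_le {f : RN N → ℂ} {Q : ℝ≥0∞} (hQt : Q ≠ ∞)
    (hQ : eLpNorm f ∞ volume ≤ Q)
    (hf0 : ∀ᵐ x, x ∉ ball (0 : RN N) 1 → f x = 0) (v : RN N → ℂ) {ε : ℝ} (hε : 0 < ε)
    (x : RN N) :
    ‖∫ y, dilate f ε (x - y) * v y‖ₑ ≤
      Q * volume (ball (0 : RN N) 1) * hlMax (fun y => ‖v y‖ₑ) x := by
  have hb : ∀ᵐ y, ‖f y‖ₑ ≤ Q := by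
    filter_upwards [ae_le_eLpNormEssSup (f := f) (μ := (volume : Measure (RN N)))] with y hy
    rw [eLpNorm_exponent_top] at hQ
    exact hy.trans hQ
  have hq := (measurePreserving_sub_left' x).quasiMeasurePreserving
  refine (enorm_integral_le_lintegral_enorm _).trans ?_
  calc ∫⁻ y, ‖dilate f ε (x - y) * v y‖ₑ
      ≤ ∫⁻ y, ENNReal.ofReal ((ε ^ N)⁻¹) * Q * (ball x ε).indicator (fun y => ‖v y‖ₑ) y := by
        refine lintegral_mono_ae ?_
        filter_upwards [hq.ae (dilate_eq_zero_ae hf0 hε),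
          hq.ae ((quasiMeasurePreserving_const_smul (inv_ne_zero hε.ne')).ae hb)] with y h1 h2
        by_cases hy : y ∈ ball x ε
        · rw [indicator_of_mem hy, enorm_mul, dilate, enorm_smul,
            Real.enorm_of_nonneg (by positivity)]
          gcongr
        · rw [h1, zero_mul, enorm_zero]
          · exact zero_le
          · rwa [mem_ball_zero_iff, ← dist_eq_norm, dist_comm]
    _ = ENNReal.ofReal ((ε ^ N)⁻¹) * Q * ∫⁻ y in ball x ε, ‖v y‖ₑ := by
        rw [← lintegral_indicator measurableSet_ball]
        rw [lintegral_const_mul' _ _ (ENNReal.mul_ne_top ENNReal.ofReal_ne_top hQt)]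
    _ ≤ ENNReal.ofReal ((ε ^ N)⁻¹) * Q *
          (ENNReal.ofReal (ε ^ N) * volume (ball (0 : RN N) 1) * hlMax (fun y => ‖v y‖ₑ) x) := by
        rw [← volume_ball_eq x hε]
        gcongr
        exact lintegral_ball_le_hlMax _ x hε
    _ = ENNReal.ofReal ((ε ^ N)⁻¹) * ENNReal.ofReal (ε ^ N) *
          (Q * volume (ball (0 : RN N) 1) * hlMax (fun y => ‖v y‖ₑ) x) := by ring
    _ = _ := by
        rw [← ENNReal.ofReal_mul (by positivity), inv_mul_cancel₀ (by positivity),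
          ENNReal.ofReal_one, one_mul]

/-- The convolution of two square integrable functions is continuous. -/
theorem continuous_convPairing (f u : Lp ℂ 2 (volume : Measure (RN N))) :
    Continuous fun x => convPairing x f u := by
  let T : C(RN N, C(RN N, RN N)) :=
    ContinuousMap.curry ⟨fun p : RN N × RN N => p.1 - p.2, by fun_prop⟩
  have h1 : Continuous fun x => Lp.compMeasurePreserving (T x)
      (measurePreserving_sub_left' x) f :=
    Continuous.compMeasurePreservingLp continuous_const T.continuous
      (fun x => measurePreserving_sub_left' x) (by norm_num)
  exact (((ContinuousLinearMap.mul ℂ ℂ).lpPairing volume 2 2).continuous.comp h1).clm_apply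
    continuous_const

theorem measurable_maximalFunction {ι : Type*} {ρ : ι → RN N → ℂ}
    (hρ : ∀ ν, MemLp (ρ ν) 2 volume) (v : Lp ℂ 2 (volume : Measure (RN N))) :
    Measurable (maximalFunction ρ v) := by
  refine LowerSemicontinuous.measurable ?_
  refine lowerSemicontinuous_iSup fun ν => lowerSemicontinuous_iSup fun ε =>
    lowerSemicontinuous_iSup fun hε => ?_
  have h := continuous_convPairing ((memLp_two_dilate (hρ ν) hε).toLp _) v
  simp only [fun x => convPairing_eq_of_ae x (memLp_two_dilate (hρ ν) hε).coeFn_toLp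
    (ae_eq_refl v)] at h
  exact h.enorm.lowerSemicontinuous

/-! ### The maximal truncated operator -/

/-- The maximal function of the truncations of the singular integral with kernel `k`. -/
def maximalTrunc (k u : RN N → ℂ) (x : RN N) : ℝ≥0∞ :=
  maximalConv (fun ε : {ε : ℝ // 0 < ε} => truncKernel k ε) u x

theorem le_maximalTrunc (k u : RN N → ℂ) {ε : ℝ} (hε : 0 < ε) (x : RN N) :
    ‖∫ y, truncKernel k ε (x - y) * u y‖ₑ ≤ maximalTrunc k u x :=
  le_iSup (fun ε : {ε : ℝ // 0 < ε} => ‖∫ y, truncKernel k ε (x - y) * u y‖ₑ) ⟨ε, hε⟩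

/-- There is a smooth mollifier supported in the unit ball. -/
theorem exists_mollifier (N : ℕ) : ∃ β : 𝓢(RN N, ℂ),
    (∀ x, x ∉ ball (0 : RN N) 1 → β x = 0) ∧ ∫ x, β x = 1 := by
  let b : ContDiffBump (0 : RN N) := ⟨1 / 2, 1, by norm_num, by norm_num⟩
  refine ⟨schwartzOfReal (b.normed volume) b.contDiff_normed b.hasCompactSupport_normed,
    fun x hx => ?_, ?_⟩
  · have : x ∉ Function.support (b.normed volume) := by
      rw [b.support_normed_eq]
      exact hx
    rw [schwartzOfReal_apply, Function.notMem_support.1 this, Complex.ofReal_zero]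
  · simp only [schwartzOfReal_apply]
    rw [integral_complex_ofReal, b.integral_normed, Complex.ofReal_one]

/-- The dilation of a Schwartz function, as a Schwartz function. -/
def schwartzDilate (β : 𝓢(RN N, ℂ)) (ε : ℝ) (hε : 0 < ε) : 𝓢(RN N, ℂ) :=
  ((ε ^ N)⁻¹ : ℝ) • SchwartzMap.compCLMOfContinuousLinearEquiv ℂ
    (ContinuousLinearEquiv.smulLeft (Units.mk0 ε hε.ne')⁻¹ : RN N ≃L[ℝ] RN N) β

theorem schwartzDilate_coe (β : 𝓢(RN N, ℂ)) (ε : ℝ) (hε : 0 < ε) :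
    (schwartzDilate β ε hε : RN N → ℂ) = dilate β ε := rfl

theorem fourier_schwartzDilate (β : 𝓢(RN N, ℂ)) (ε : ℝ) (hε : 0 < ε) (ξ : RN N) :
    𝓕 (schwartzDilate β ε hε) ξ = 𝓕 β (ε • ξ) := by
  rw [SchwartzMap.fourier_coe, SchwartzMap.fourier_coe, schwartzDilate_coe, Real.fourier_eq,
    Real.fourier_eq]
  have h := integral_mul_dilate (fun v => (Real.fourierChar (-inner ℝ v ξ) : ℂ)) β hε
  simp only [Circle.smul_def, smul_eq_mul]
  rw [h]
  congr 1
  ext w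
  rw [inner_smul_left, inner_smul_right]
  rfl

/-- The convolution of `K` with a dilated Schwartz function is bounded, through the Fourier
transform. -/
theorem norm_convL2_dilate_schwartz_le (K : 𝓢'(RN N, ℂ)) (β : 𝓢(RN N, ℂ)) {ε : ℝ} (hε : 0 < ε) :
    ∀ᵐ z, ‖convL2 K ((memLp_two_dilate (β.memLp 2 volume) hε).toLp _) z‖ ≤
      ‖symbol K‖ * (∫ ξ, ‖𝓕 β ξ‖) * (ε ^ N)⁻¹ := by
  have e : (memLp_two_dilate (β.memLp 2 volume) hε).toLp _ =
      (schwartzDilate β ε hε).toLp 2 volume := rfl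
  rw [e]
  filter_upwards [convL2_toLp_schwartz K (schwartzDilate β ε hε)] with z hz
  rw [hz]
  refine (norm_convSchwartz_le K _ z).trans (le_of_eq ?_)
  rw [SchwartzMap.norm_toLp_one]
  simp only [fourier_schwartzDilate]
  rw [Measure.integral_comp_smul volume (fun ξ => ‖𝓕 β ξ‖) ε, finrank_euclideanSpace_fin,
    abs_of_pos (by positivity), smul_eq_mul]
  ring

theorem lintegral_enorm_sq_eq (f : RN N → ℂ) :
    ∫⁻ x, ‖f x‖ₑ ^ 2 = eLpNorm f 2 volume ^ 2 := by
  have h := eLpNorm_nnreal_pow_eq_lintegral (f := f) (μ := (volume : Measure (RN N))) (p := 2)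
    (by norm_num)
  simpa using h.symm

theorem lintegral_enorm_convL2_sq_le (K : 𝓢'(RN N, ℂ)) (u : Lp ℂ 2 (volume : Measure (RN N))) :
    ∫⁻ x, ‖convL2 K u x‖ₑ ^ 2 ≤ ENNReal.ofReal ‖symbol K‖ ^ 2 * ∫⁻ x, ‖u x‖ₑ ^ 2 := by
  rw [lintegral_enorm_sq_eq, lintegral_enorm_sq_eq, ← Lp.enorm_def, ← Lp.enorm_def, ← mul_pow]
  gcongr
  rw [← ofReal_norm, ← ofReal_norm, ← ENNReal.ofReal_mul (norm_nonneg _)]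
  exact ENNReal.ofReal_le_ofReal (norm_convL2_le K u)

theorem ennreal_add_sq_le (a b : ℝ≥0∞) : (a + b) ^ 2 ≤ 4 * a ^ 2 + 4 * b ^ 2 := by
  rcases le_total a b with h | h
  · calc (a + b) ^ 2 ≤ (b + b) ^ 2 := by gcongr
      _ = 4 * b ^ 2 := by ring
      _ ≤ _ := le_add_self
  · calc (a + b) ^ 2 ≤ (a + a) ^ 2 := by gcongr
      _ = 4 * a ^ 2 := by ring
      _ ≤ _ := le_self_add

/-- The maximal truncated operator is bounded on `L²`: its truncations are compared with the
mollifications of `K * u` by a fixed mollifier. -/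
theorem exists_lintegral_maximalTrunc_sq_le (hN : 0 < N) : ∃ B : ℝ, 0 < B ∧
    ∀ (K : 𝓢'(RN N, ℂ)) (k : RN N → ℂ) (C₀ C₁ : ℝ), IsFundamentalKernel K k C₀ C₁ →
    ∀ g : RN N → ℂ, Integrable g → MemLp g 2 volume →
      ∫⁻ x, maximalTrunc k g x ^ 2 ≤
        ENNReal.ofReal (B * (C₀ + C₁ + ‖symbol K‖)) ^ 2 * ∫⁻ x, ‖g x‖ₑ ^ 2 := by
  obtain ⟨β, hβ0, hβ1⟩ := exists_mollifier N
  have hω : volume (ball (0 : RN N) 1) ≠ ∞ := measure_ball_lt_top.ne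
  set a := (eLpNorm β ∞ volume * volume (ball (0 : RN N) 1)).toReal with ha
  set b := 6 ^ (N + 1) * ((∫ ξ, ‖𝓕 β ξ‖) + ∫ x, ‖β x‖) * (majorantConst N).toReal with hb
  have ha0 : 0 ≤ a := ENNReal.toReal_nonneg
  have hF0 : 0 ≤ ∫ ξ, ‖𝓕 β ξ‖ := integral_nonneg fun ξ => norm_nonneg _
  have hn0 : 0 ≤ ∫ x, ‖β x‖ := integral_nonneg fun ξ => norm_nonneg _
  have hb0 : 0 ≤ b := by positivity
  refine ⟨32 * 5 ^ N * (1 + a + b), by positivity, fun K k C₀ C₁ h g hgi hg2 => ?_⟩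
  have hC0 := h.nonneg_zero
  have hC1 := h.nonneg_one
  have hm0 := norm_nonneg (symbol K)
  set A := C₀ + C₁ + ‖symbol K‖ with hA
  have hA0 : 0 ≤ A := by positivity
  set u := hg2.toLp g with hu
  have hug : u =ᵐ[volume] g := hg2.coeFn_toLp
  have hui : Integrable u := hgi.congr hug.symm
  have hpt : ∀ x, maximalTrunc k g x ≤
      ENNReal.ofReal a * hlMax (fun y => ‖convL2 K u y‖ₑ) x +
        ENNReal.ofReal (b * A) * hlMax (fun y => ‖u y‖ₑ) x := by
    intro x
    refine iSup_le fun ε => ?_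
    have e1 : ∫ y, truncKernel k ε (x - y) * g y = ∫ y, truncKernel k ε (x - y) * u y := by
      refine integral_congr_ae ?_
      filter_upwards [hug] with y hy
      rw [hy]
    rw [e1]
    have h1 := h.enorm_integral_dilate_sub_le ε.2 (β.memLp 2 volume) β.integrable
      (Eventually.of_forall hβ0) le_rfl (norm_convL2_dilate_schwartz_le K β ε.2) hui x
    rw [hβ1, one_mul] at h1
    have h2 := enorm_integral_dilate_mul_le (f := β) (β.memLp ∞ volume).2.ne le_rfl
      (Eventually.of_forall hβ0) (convL2 K u) ε.2 x
    rw [← ENNReal.ofReal_toReal (ENNReal.mul_ne_top (β.memLp ∞ volume).2.ne hω), ← ha] at h2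
    have h3 : ENNReal.ofReal (6 ^ (N + 1) * (‖symbol K‖ * (∫ ξ, ‖𝓕 β ξ‖) +
        (∫ x, ‖β x‖) * (C₀ + C₁))) * majorantConst N ≤ ENNReal.ofReal (b * A) := by
      rw [← ENNReal.ofReal_toReal (majorantConst_ne_top N), ← ENNReal.ofReal_mul (by positivity)]
      refine ENNReal.ofReal_le_ofReal ?_
      have h4 : ‖symbol K‖ * (∫ ξ, ‖𝓕 β ξ‖) + (∫ x, ‖β x‖) * (C₀ + C₁) ≤
          ((∫ ξ, ‖𝓕 β ξ‖) + ∫ x, ‖β x‖) * A := by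
        have h5 : 0 ≤ (∫ ξ, ‖𝓕 β ξ‖) * (C₀ + C₁) := by positivity
        have h6 : 0 ≤ (∫ x, ‖β x‖) * ‖symbol K‖ := by positivity
        rw [hA]
        linarith
      calc _ ≤ 6 ^ (N + 1) * (((∫ ξ, ‖𝓕 β ξ‖) + ∫ x, ‖β x‖) * A) *
            (majorantConst N).toReal := by gcongr
        _ = b * A := by
            rw [hb]
            ring
    have e2 : ∀ p q : ℂ, ‖q‖ₑ ≤ ‖p‖ₑ + ‖p - q‖ₑ := by
      intro p q
      calc ‖q‖ₑ = ‖p - (p - q)‖ₑ := by rw [sub_sub_cancel]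
        _ ≤ _ := enorm_sub_le
    refine (e2 _ _).trans (add_le_add h2 (h1.trans ?_))
    gcongr
  have hmeas1 := measurable_hlMax (fun y => ‖convL2 K u y‖ₑ)
  have hmeas2 := measurable_hlMax (fun y => ‖u y‖ₑ)
  have hI : ∫⁻ x, ‖g x‖ₑ ^ 2 = ∫⁻ x, ‖u x‖ₑ ^ 2 := by
    refine lintegral_congr_ae ?_
    filter_upwards [hug] with y hy
    rw [hy]
  rw [hI]
  set I := ∫⁻ x, ‖u x‖ₑ ^ 2 with hIdef
  calc ∫⁻ x, maximalTrunc k g x ^ 2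
      ≤ ∫⁻ x, (4 * ENNReal.ofReal a ^ 2 * hlMax (fun y => ‖convL2 K u y‖ₑ) x ^ 2 +
        4 * ENNReal.ofReal (b * A) ^ 2 * hlMax (fun y => ‖u y‖ₑ) x ^ 2) := by
        refine lintegral_mono fun x => ?_
        refine (pow_le_pow_left' (hpt x) 2).trans ((ennreal_add_sq_le _ _).trans (le_of_eq ?_))
        ring
    _ = (4 * ENNReal.ofReal a ^ 2 * ∫⁻ x, hlMax (fun y => ‖convL2 K u y‖ₑ) x ^ 2) +
        4 * ENNReal.ofReal (b * A) ^ 2 * ∫⁻ x, hlMax (fun y => ‖u y‖ₑ) x ^ 2 := by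
        rw [lintegral_add_left (by fun_prop), lintegral_const_mul _ (by fun_prop),
          lintegral_const_mul _ (by fun_prop)]
    _ ≤ 4 * ENNReal.ofReal a ^ 2 * (ENNReal.ofReal (8 * 5 ^ N) *
          (ENNReal.ofReal ‖symbol K‖ ^ 2 * I)) +
        4 * ENNReal.ofReal (b * A) ^ 2 * (ENNReal.ofReal (8 * 5 ^ N) * I) := by
        gcongr
        · refine (lintegral_hlMax_sq_le hN (measurable_enorm_coeFn _)).trans ?_
          gcongr
          exact lintegral_enorm_convL2_sq_le K u
        · exact lintegral_hlMax_sq_le hN (measurable_enorm_coeFn _)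
    _ = ENNReal.ofReal (4 * a ^ 2 * (8 * 5 ^ N) * ‖symbol K‖ ^ 2 +
          4 * (b * A) ^ 2 * (8 * 5 ^ N)) * I := by
        rw [ENNReal.ofReal_add (by positivity) (by positivity)]
        simp only [ENNReal.ofReal_mul' (show (0 : ℝ) ≤ 8 * 5 ^ N by positivity),
          ENNReal.ofReal_mul (show (0 : ℝ) ≤ 4 by norm_num),
          ENNReal.ofReal_mul' (sq_nonneg ‖symbol K‖), ENNReal.ofReal_ofNat,
          ENNReal.ofReal_pow ha0, ENNReal.ofReal_pow hm0,
          ENNReal.ofReal_pow (mul_nonneg hb0 hA0)]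
        ring
    _ ≤ _ := by
        rw [← ENNReal.ofReal_pow (by positivity)]
        gcongr
        have h5 : (1 : ℝ) ≤ 5 ^ N := one_le_pow₀ (by norm_num)
        have h6 : ‖symbol K‖ ^ 2 ≤ A ^ 2 := by
          gcongr
          linarith
        have h7 : a ^ 2 + b ^ 2 ≤ (1 + a + b) ^ 2 := by nlinarith [mul_nonneg ha0 hb0]
        calc 4 * a ^ 2 * (8 * 5 ^ N) * ‖symbol K‖ ^ 2 + 4 * (b * A) ^ 2 * (8 * 5 ^ N)
            ≤ 4 * a ^ 2 * (8 * 5 ^ N) * A ^ 2 + 4 * (b * A) ^ 2 * (8 * 5 ^ N) := by gcongr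
          _ = (32 * 5 ^ N) * 1 * (a ^ 2 + b ^ 2) * A ^ 2 := by ring
          _ ≤ (32 * 5 ^ N) * (32 * 5 ^ N) * (1 + a + b) ^ 2 * A ^ 2 := by
              gcongr
              linarith
          _ = _ := by ring

/-- The maximal truncated operator is of weak type `(1, 1)`. -/
theorem exists_weakL1_maximalTrunc_le (hN : 0 < N) : ∃ W : ℝ, 0 ≤ W ∧
    ∀ (K : 𝓢'(RN N, ℂ)) (k : RN N → ℂ) (C₀ C₁ : ℝ), IsFundamentalKernel K k C₀ C₁ →
    ∀ u : RN N → ℂ, Measurable u → Integrable u →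
      weakL1 (maximalTrunc k u) ≤
        ENNReal.ofReal (W * (C₀ + C₁ + ‖symbol K‖)) * ∫⁻ x, ‖u x‖ₑ := by
  obtain ⟨B, hB, hL2⟩ := exists_lintegral_maximalTrunc_sq_le hN
  refine ⟨(weakConst N).toReal * (B + 2 * 3 ^ (N + 1)), by positivity,
    fun K k C₀ C₁ h u hum hu => ?_⟩
  have hC0 := h.nonneg_zero
  have hC1 := h.nonneg_one
  have hm0 := norm_nonneg (symbol K)
  set A := C₀ + C₁ + ‖symbol K‖ with hA
  have hA0 : 0 ≤ A := by positivity
  rcases hA0.eq_or_lt with hA0 | hA0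
  · -- the kernel vanishes away from the origin
    have hC : C₀ = 0 := by linarith
    have hk : ∀ z, z ≠ 0 → k z = 0 := by
      intro z hz
      have := h.size z hz
      rw [hC, zero_div] at this
      exact norm_le_zero_iff.1 this
    have hT : ∀ x, maximalTrunc k u x = 0 := by
      intro x
      refine le_zero_iff.1 (iSup_le fun ε => ?_)
      have : ∀ z, truncKernel k ε z = 0 := by
        intro z
        by_cases hz : z = 0
        · exact truncKernel_of_le_half ε.2 (by rw [hz, norm_zero]; exact (half_pos ε.2).le)
        · rw [truncKernel, hk z hz, smul_zero]
      simp [this]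
    refine iSup₂_le fun t ht => ?_
    simp [hT]
  · have key := weakL1_maximalConv_le hN (k := fun ε : {ε : ℝ // 0 < ε} => truncKernel k ε)
      (fun ε => h.continuous_truncKernel ε.2) (fun ε => ⟨_, h.norm_truncKernel_le ε.2⟩)
      (A := (B + 2 * 3 ^ (N + 1)) * A) (by positivity) (fun ε s z y hs hy hz => ?_)
      (fun g hg hg2 => ?_) hum hu
    · rw [mul_assoc, ENNReal.ofReal_mul (by positivity),
        ENNReal.ofReal_toReal (weakConst_ne_top N)]
      exact key
    · refine (h.norm_truncKernel_sub_le ε.2 hs hy hz).trans ?_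
      have := majorant_nonneg hs z
      have hB' := hB.le
      gcongr
      · linarith
      · linarith
    · refine (hL2 K k C₀ C₁ h g hg hg2).trans ?_
      gcongr
      linarith [show (0 : ℝ) < 2 * 3 ^ (N + 1) by positivity]

/-! ### Weak and strong bounds for the maximal function of `K * u` -/

theorem le_weakL1 (f : RN N → ℝ≥0∞) {r : ℝ} (hr : 0 < r) :
    ENNReal.ofReal r * volume {x | ENNReal.ofReal r < f x} ≤ weakL1 f :=
  le_iSup₂ (f := fun (r : ℝ) (_ : 0 < r) =>
    ENNReal.ofReal r * volume {x | ENNReal.ofReal r < f x}) r hr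

theorem weakL1_mono {f g : RN N → ℝ≥0∞} (h : ∀ x, f x ≤ g x) : weakL1 f ≤ weakL1 g := by
  refine iSup₂_mono fun r _ => ?_
  exact mul_le_mul_right (measure_mono fun x hx => lt_of_lt_of_le hx (h x)) _

theorem weakL1_const_mul_le {c : ℝ≥0∞} (hc : c ≠ ∞) (f : RN N → ℝ≥0∞) :
    weakL1 (fun x => c * f x) ≤ c * weakL1 f := by
  refine iSup₂_le fun r hr => ?_
  rcases eq_or_ne c 0 with rfl | h0
  · simp
  lift c to ℝ≥0 using hc
  have h0' : (0 : ℝ) < c := by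
    rw [NNReal.coe_pos]
    exact pos_iff_ne_zero.2 (by simpa using h0)
  have e1 : ENNReal.ofReal r = c * ENNReal.ofReal (r / c) := by
    rw [← ENNReal.ofReal_coe_nnreal, ← ENNReal.ofReal_mul h0'.le, mul_div_cancel₀ _ h0'.ne']
  have e2 : {x | ENNReal.ofReal r < c * f x} = {x | ENNReal.ofReal (r / c) < f x} := by
    ext x
    rw [mem_ofPred_eq, mem_ofPred_eq, e1, ENNReal.mul_lt_mul_iff_right h0 ENNReal.coe_ne_top]
  rw [e2, e1, mul_assoc]
  exact mul_le_mul_right (le_weakL1 f (div_pos hr h0')) _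

theorem weakL1_add_le (f g : RN N → ℝ≥0∞) :
    weakL1 (fun x => f x + g x) ≤ 2 * (weakL1 f + weakL1 g) := by
  refine iSup₂_le fun r hr => ?_
  have e1 : ENNReal.ofReal r = ENNReal.ofReal (r / 2) + ENNReal.ofReal (r / 2) := by
    rw [← ENNReal.ofReal_add (by positivity) (by positivity), add_halves]
  have hsub : {x | ENNReal.ofReal r < f x + g x} ⊆
      {x | ENNReal.ofReal (r / 2) < f x} ∪ {x | ENNReal.ofReal (r / 2) < g x} := by
    intro x hx
    by_contra hn
    simp only [mem_union, mem_ofPred_eq, not_or, not_lt] at hn hx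
    rw [e1] at hx
    exact absurd hx (not_lt.2 (add_le_add hn.1 hn.2))
  have e2 : ENNReal.ofReal r = 2 * ENNReal.ofReal (r / 2) := by rw [e1, two_mul]
  calc ENNReal.ofReal r * volume {x | ENNReal.ofReal r < f x + g x}
      ≤ 2 * ENNReal.ofReal (r / 2) * (volume {x | ENNReal.ofReal (r / 2) < f x} +
          volume {x | ENNReal.ofReal (r / 2) < g x}) := by
        rw [← e2]
        gcongr
        exact (measure_mono hsub).trans (measure_union_le _ _)
    _ = 2 * (ENNReal.ofReal (r / 2) * volume {x | ENNReal.ofReal (r / 2) < f x} +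
          ENNReal.ofReal (r / 2) * volume {x | ENNReal.ofReal (r / 2) < g x}) := by ring
    _ ≤ _ := mul_le_mul_right
        (add_le_add (le_weakL1 f (half_pos hr)) (le_weakL1 g (half_pos hr))) _

theorem weakL1_hlMax_le (hN : 0 < N) (f : RN N → ℝ≥0∞) :
    weakL1 (hlMax f) ≤ ENNReal.ofReal (5 ^ N) * ∫⁻ x, f x :=
  iSup₂_le fun r _ => mul_volume_lt_hlMax_le hN f (ENNReal.ofReal r)

/-- A bound on `K(ε ·) ε^N * f` at every scale is a bound on `K * f_ε` with the factor `ε^{-N}`. -/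
theorem norm_convL2_dilate_le {K : 𝓢'(RN N, ℂ)} (hK : HasBoundedSymbol K) {ε : ℝ} (hε : 0 < ε)
    {f : RN N → ℂ} (hf : MemLp f 2 volume) {Q : ℝ}
    (hQ : ∀ᵐ x, ‖convL2 (rescale ε hε.ne' K) (hf.toLp f) x‖ ≤ Q) :
    ∀ᵐ z, ‖convL2 K ((memLp_two_dilate hf hε).toLp _) z‖ ≤ Q * (ε ^ N)⁻¹ := by
  filter_upwards [convL2_dilate_ae_eq hK hε hf,
    (quasiMeasurePreserving_const_smul (inv_ne_zero hε.ne')).ae hQ] with z h1 h2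
  rw [h1, dilate, norm_smul, Real.norm_of_nonneg (by positivity), mul_comm]
  gcongr

/-- The maximal function of `K * u` along `{ρ^ν}` is of weak type `(1, 1)`: pointwise, it is bounded
by `Q₁` times the maximal truncated operator and a multiple of the Hardy-Littlewood maximal function
of `u`. -/
theorem exists_weakL1_maximalFunction_le (hN : 0 < N) : ∃ C : ℝ,
    ∀ (K : 𝓢'(RN N, ℂ)) (k : RN N → ℂ) (C₀ C₁ : ℝ), IsFundamentalKernel K k C₀ C₁ →
    ∀ (ι : Type*) (ρ : ι → RN N → ℂ) (Q₁ Q₂ : ℝ)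
      (hρ : ∀ ν, MemLp (ρ ν) ∞ volume)
      (hsupp : ∀ ν, ∀ᵐ x, x ∉ ball (0 : RN N) 1 → ρ ν x = 0),
    (∀ ν, eLpNorm (ρ ν) 1 volume ≤ ENNReal.ofReal Q₁) →
    (∀ (ε : ℝ) (hε : 0 < ε) (ν : ι), ∃ g : BoundedContinuousFunction (RN N) ℂ,
      convL2 (rescale ε hε.ne' K) ((memLp_two_of_unitBall (hρ ν) (hsupp ν)).toLp (ρ ν))
        =ᵐ[volume] g ∧ ‖g‖ ≤ Q₂) →
    ∀ u : Lp ℂ 2 (volume : Measure (RN N)), Integrable u →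
      weakL1 (maximalFunction ρ (convL2 K u)) ≤
        ENNReal.ofReal (C * (Q₂ + Q₁ * (C₀ + C₁ + ‖symbol K‖))) * eLpNorm u 1 volume := by
  obtain ⟨W, hW, hT⟩ := exists_weakL1_maximalTrunc_le hN
  set m := (majorantConst N).toReal with hm
  have hm0 : 0 ≤ m := ENNReal.toReal_nonneg
  refine ⟨2 * (W + 6 ^ (N + 1) * m * 5 ^ N),
    fun K k C₀ C₁ h ι ρ Q₁ Q₂ hρ hsupp hQ₁ hQ₂ u hu => ?_⟩
  have hC0 := h.nonneg_zero
  have hC1 := h.nonneg_one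
  have hs0 := norm_nonneg (symbol K)
  by_cases hdeg : IsEmpty ι ∨ Q₁ < 0
  · -- no `ρ^ν` at all, or only `ρ^ν` that vanish almost everywhere
    have hz : ∀ x, maximalFunction ρ (convL2 K u) x ≤ 0 := by
      intro x
      refine iSup_le fun ν => iSup₂_le fun ε hε => ?_
      rcases hdeg with hι | hQ
      · exact hι.elim ν
      · have h0 := hQ₁ ν
        rw [ENNReal.ofReal_of_nonpos hQ.le, le_zero_iff,
          eLpNorm_eq_zero_iff (hρ ν).1 one_ne_zero] at h0
        have h1 : eLpNorm (ρ ν) ∞ volume ≤ 0 := by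
          rw [eLpNorm_congr_ae h0, eLpNorm_zero]
        refine (enorm_integral_dilate_mul_le ENNReal.zero_ne_top h1 (hsupp ν) _ hε x).trans ?_
        rw [zero_mul, zero_mul]
    refine iSup₂_le fun r _ => ?_
    simp [fun x => le_zero_iff.1 (hz x)]
  push Not at hdeg
  obtain ⟨⟨ν₀⟩, hQ₁0⟩ := hdeg
  have hQ₂0 : 0 ≤ Q₂ := by
    obtain ⟨g, -, hg⟩ := hQ₂ 1 one_pos ν₀
    exact (norm_nonneg g).trans hg
  have hpt : ∀ x, maximalFunction ρ (convL2 K u) x ≤ ENNReal.ofReal Q₁ * maximalTrunc k u x +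
      ENNReal.ofReal (6 ^ (N + 1) * (Q₂ + Q₁ * (C₀ + C₁))) * majorantConst N *
        hlMax (fun y => ‖u y‖ₑ) x := by
    intro x
    refine iSup_le fun ν => iSup₂_le fun ε hε => ?_
    have hf2 := memLp_two_of_unitBall (hρ ν) (hsupp ν)
    have hfi : Integrable (ρ ν) :=
      memLp_one_iff_integrable.1 ⟨hf2.1, (hQ₁ ν).trans_lt ENNReal.ofReal_lt_top⟩
    have hq : ∫ y, ‖ρ ν y‖ ≤ Q₁ := by
      rw [integral_norm_eq_lintegral_enorm hfi.aestronglyMeasurable,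
        ← eLpNorm_one_eq_lintegral_enorm]
      exact ENNReal.toReal_le_of_le_ofReal hQ₁0 (hQ₁ ν)
    have hQ : ∀ᵐ y, ‖convL2 (rescale ε hε.ne' K) (hf2.toLp (ρ ν)) y‖ ≤ Q₂ := by
      obtain ⟨g, hg, hgQ⟩ := hQ₂ ε hε ν
      filter_upwards [hg] with y hy
      rw [hy]
      exact (g.norm_coe_le_norm y).trans hgQ
    have key := h.enorm_integral_dilate_sub_le hε hf2 hfi (hsupp ν) hq
      (norm_convL2_dilate_le h.boundedSymbol hε hf2 hQ) hu x
    set P := ∫ y, dilate (ρ ν) ε (x - y) * convL2 K u y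
    have h1 : ‖(∫ y, ρ ν y) * ∫ y, truncKernel k ε (x - y) * u y‖ₑ ≤
        ENNReal.ofReal Q₁ * maximalTrunc k u x := by
      rw [enorm_mul]
      refine mul_le_mul' ?_ (le_maximalTrunc k u hε x)
      rw [← ofReal_norm]
      exact ENNReal.ofReal_le_ofReal ((norm_integral_le_integral_norm _).trans hq)
    calc ‖P‖ₑ = ‖((∫ y, ρ ν y) * ∫ y, truncKernel k ε (x - y) * u y) +
          (P - (∫ y, ρ ν y) * ∫ y, truncKernel k ε (x - y) * u y)‖ₑ := by
          rw [add_sub_cancel]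
      _ ≤ _ := (enorm_add_le _ _).trans (add_le_add h1 key)
  have hum : Measurable u := (Lp.stronglyMeasurable u).measurable
  have hB : ENNReal.ofReal (6 ^ (N + 1) * (Q₂ + Q₁ * (C₀ + C₁))) * majorantConst N =
      ENNReal.ofReal (6 ^ (N + 1) * (Q₂ + Q₁ * (C₀ + C₁)) * m) := by
    rw [ENNReal.ofReal_mul' hm0, hm, ENNReal.ofReal_toReal (majorantConst_ne_top N)]
  rw [hB] at hpt
  set b := 6 ^ (N + 1) * (Q₂ + Q₁ * (C₀ + C₁)) * m with hb
  have hb0 : 0 ≤ b := by positivity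
  rw [eLpNorm_one_eq_lintegral_enorm]
  calc weakL1 (maximalFunction ρ (convL2 K u))
      ≤ 2 * (ENNReal.ofReal Q₁ * weakL1 (maximalTrunc k u) +
          ENNReal.ofReal b * weakL1 (hlMax fun y => ‖u y‖ₑ)) := by
        refine (weakL1_mono hpt).trans ((weakL1_add_le _ _).trans ?_)
        exact mul_le_mul_right (add_le_add (weakL1_const_mul_le ENNReal.ofReal_ne_top _)
          (weakL1_const_mul_le ENNReal.ofReal_ne_top _)) _
    _ ≤ 2 * (ENNReal.ofReal Q₁ * (ENNReal.ofReal (W * (C₀ + C₁ + ‖symbol K‖)) * ∫⁻ x, ‖u x‖ₑ) +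
          ENNReal.ofReal b * (ENNReal.ofReal (5 ^ N) * ∫⁻ x, ‖u x‖ₑ)) := by
        exact mul_le_mul_right (add_le_add
          (mul_le_mul_right (hT K k C₀ C₁ h u hum hu) _)
          (mul_le_mul_right (weakL1_hlMax_le hN _) _)) _
    _ = ENNReal.ofReal (2 * (Q₁ * (W * (C₀ + C₁ + ‖symbol K‖)) + b * 5 ^ N)) *
          ∫⁻ x, ‖u x‖ₑ := by
        rw [ENNReal.ofReal_mul zero_le_two, ENNReal.ofReal_add (by positivity) (by positivity),
          ENNReal.ofReal_mul hQ₁0, ENNReal.ofReal_mul hb0, ENNReal.ofReal_ofNat]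
        ring
    _ ≤ _ := by
        refine mul_le_mul_left (ENNReal.ofReal_le_ofReal ?_) _
        have h1 : 0 ≤ W * Q₂ := by positivity
        have h2 : 0 ≤ 6 ^ (N + 1) * m * 5 ^ N * (Q₁ * ‖symbol K‖) := by positivity
        rw [hb]
        linarith

/-- The `L²` bound for the maximal function of `K * u`, which is dominated by a multiple of the
Hardy-Littlewood maximal function of `K * u`. -/
theorem eLpNorm_maximalFunction_le (hN : 0 < N) (K : 𝓢'(RN N, ℂ)) {ι : Type*}
    {ρ : ι → RN N → ℂ} {Q : ℝ≥0∞} (hQt : Q ≠ ∞) (hQ : ∀ ν, eLpNorm (ρ ν) ∞ volume ≤ Q)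
    (hsupp : ∀ ν, ∀ᵐ x, x ∉ ball (0 : RN N) 1 → ρ ν x = 0)
    (u : Lp ℂ 2 (volume : Measure (RN N))) :
    eLpNorm (maximalFunction ρ (convL2 K u)) 2 volume ≤
      ENNReal.ofReal ((volume (ball (0 : RN N) 1)).toReal * (8 * 5 ^ N)) * Q * ‖symbol K‖ₑ *
        eLpNorm u 2 volume := by
  set v := convL2 K u with hv
  have hω : volume (ball (0 : RN N) 1) ≠ ∞ := measure_ball_lt_top.ne
  have hpt : ∀ x, maximalFunction ρ v x ≤
      Q * volume (ball (0 : RN N) 1) * hlMax (fun y => ‖v y‖ₑ) x := fun x =>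
    iSup_le fun ν => iSup₂_le fun ε hε => enorm_integral_dilate_mul_le hQt (hQ ν) (hsupp ν) v hε x
  have hsq : ∀ f : RN N → ℝ≥0∞, eLpNorm f 2 volume ^ 2 = ∫⁻ x, f x ^ 2 := by
    intro f
    rw [eLpNorm_eq_lintegral_rpow_enorm_toReal (by norm_num) (by norm_num),
      ← ENNReal.rpow_natCast, ← ENNReal.rpow_mul]
    simp
  have hsq' : eLpNorm v 2 volume ^ 2 = ∫⁻ x, ‖v x‖ₑ ^ 2 := by
    rw [lintegral_enorm_sq_eq]
  have hvn : eLpNorm v 2 volume ≤ ‖symbol K‖ₑ * eLpNorm u 2 volume := by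
    rw [← Lp.enorm_def, ← Lp.enorm_def, ← ofReal_norm, ← ofReal_norm, ← ofReal_norm,
      ← ENNReal.ofReal_mul (norm_nonneg _)]
    exact ENNReal.ofReal_le_ofReal (norm_convL2_le K u)
  -- the square root of `8 * 5 ^ N` is bounded by `8 * 5 ^ N` itself
  have h5 : (1 : ℝ≥0∞) ≤ ENNReal.ofReal (8 * 5 ^ N) := by
    rw [ENNReal.one_le_ofReal]
    have : (1 : ℝ) ≤ 5 ^ N := one_le_pow₀ (by norm_num)
    linarith
  have key : eLpNorm (maximalFunction ρ v) 2 volume ≤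
      Q * volume (ball (0 : RN N) 1) * (ENNReal.ofReal (8 * 5 ^ N) * eLpNorm v 2 volume) := by
    refine (ENNReal.pow_le_pow_left_iff two_ne_zero).1 ?_
    calc eLpNorm (maximalFunction ρ v) 2 volume ^ 2
        = ∫⁻ x, maximalFunction ρ v x ^ 2 := hsq _
      _ ≤ ∫⁻ x, (Q * volume (ball (0 : RN N) 1)) ^ 2 * hlMax (fun y => ‖v y‖ₑ) x ^ 2 := by
          refine lintegral_mono fun x => ?_
          rw [← mul_pow]
          exact pow_le_pow_left' (hpt x) 2
      _ = (Q * volume (ball (0 : RN N) 1)) ^ 2 * ∫⁻ x, hlMax (fun y => ‖v y‖ₑ) x ^ 2 :=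
          lintegral_const_mul' _ _ (by finiteness)
      _ ≤ (Q * volume (ball (0 : RN N) 1)) ^ 2 *
            (ENNReal.ofReal (8 * 5 ^ N) ^ 2 * eLpNorm v 2 volume ^ 2) := by
          refine mul_le_mul_right ?_ _
          rw [hsq']
          refine (lintegral_hlMax_sq_le hN (measurable_enorm_coeFn v)).trans ?_
          exact mul_le_mul_left (le_self_pow h5 two_ne_zero) _
      _ = _ := by ring
  refine key.trans ?_
  rw [ENNReal.ofReal_mul ENNReal.toReal_nonneg, ENNReal.ofReal_toReal hω]
  calc _ ≤ Q * volume (ball (0 : RN N) 1) *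
        (ENNReal.ofReal (8 * 5 ^ N) * (‖symbol K‖ₑ * eLpNorm u 2 volume)) :=
        mul_le_mul_right (mul_le_mul_right hvn _) _
    _ = _ := by ring

/-! ### Approximation of finite measures -/

/-- A complex measure has a density of modulus one with respect to its total variation. -/
theorem exists_density {X : Type*} [MeasurableSpace X] (u : ComplexMeasure X) :
    ∃ h : X → ℂ, Integrable h u.variation ∧ ∫⁻ x, ‖h x‖ₑ ∂u.variation = u.variation univ ∧
      ∀ f : X → ℂ, Integrable f u.variation →
        VectorMeasure.integral u f (ContinuousLinearMap.mul ℝ ℂ) =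
          ∫ x, f x * h x ∂u.variation := by
  set μ := u.variation with hμ
  have hac : ∀ s, MeasurableSet s → μ.toENNRealVectorMeasure s = 0 → u s = 0 := by
    intro s hs h0
    rw [Measure.toENNRealVectorMeasure_apply_measurable hs] at h0
    rw [← enorm_eq_zero, ← le_zero_iff, ← h0]
    exact u.enorm_measure_le_variation s
  have hre : μ.withDensityᵥ ((ComplexMeasure.re u).rnDeriv μ) = ComplexMeasure.re u := by
    refine SignedMeasure.withDensityᵥ_rnDeriv_eq _ μ
      (VectorMeasure.AbsolutelyContinuous.mk fun s hs h0 => ?_)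
    change (u s).re = 0
    rw [hac s hs h0, Complex.zero_re]
  have him : μ.withDensityᵥ ((ComplexMeasure.im u).rnDeriv μ) = ComplexMeasure.im u := by
    refine SignedMeasure.withDensityᵥ_rnDeriv_eq _ μ
      (VectorMeasure.AbsolutelyContinuous.mk fun s hs h0 => ?_)
    change (u s).im = 0
    rw [hac s hs h0, Complex.zero_im]
  set h := u.rnDeriv μ with hh
  have hi : Integrable h μ := ComplexMeasure.integrable_rnDeriv u μ
  have hu : μ.withDensityᵥ h = u := by
    ext s hs
    rw [withDensityᵥ_apply hi hs]
    apply Complex.ext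
    · rw [← RCLike.re_eq_complex_re, ← integral_re hi.integrableOn]
      change ∫ x in s, (ComplexMeasure.re u).rnDeriv μ x ∂μ = ComplexMeasure.re u s
      conv_rhs => rw [← hre]
      rw [withDensityᵥ_apply (SignedMeasure.integrable_rnDeriv _ _) hs]
    · rw [← RCLike.im_eq_complex_im, ← integral_im hi.integrableOn]
      change ∫ x in s, (ComplexMeasure.im u).rnDeriv μ x ∂μ = ComplexMeasure.im u s
      conv_rhs => rw [← him]
      rw [withDensityᵥ_apply (SignedMeasure.integrable_rnDeriv _ _) hs]
  have hvar : μ.withDensity (fun x => ‖h x‖ₑ) = μ := by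
    rw [← Measure.variation_withDensityᵥ hi, hu]
  have h1 : ∀ᵐ x ∂μ, ‖h x‖ₑ = 1 := by
    refine (withDensity_eq_iff_of_sigmaFinite (g := 1) hi.1.enorm aemeasurable_const).1 ?_
    rw [hvar, withDensity_one]
  have h1' : ∀ᵐ x ∂μ, ‖h x‖ ≤ 1 := by
    filter_upwards [h1] with x hx
    rw [← toReal_enorm, hx, ENNReal.toReal_one]
  refine ⟨h, hi, ?_, fun f hf => ?_⟩
  · rw [← setLIntegral_univ, ← withDensity_apply _ MeasurableSet.univ, hvar]
  have hmul : ∀ f : X → ℂ, Integrable f μ → Integrable (fun x => f x * h x) μ := fun f hf =>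
    hf.mul_bdd (c := 1) hi.1 h1'
  refine Integrable.induction (μ := μ) (fun f => VectorMeasure.integral u f
    (ContinuousLinearMap.mul ℝ ℂ) = ∫ x, f x * h x ∂μ) ?_ ?_ ?_ ?_ hf
  · intro c s hs hμs
    rw [VectorMeasure.integral_eq_setToFun, setToFun_indicator_const _ hs hμs.ne]
    have e1 : ∫ x, s.indicator (fun _ => c) x * h x ∂μ = ∫ x in s, c * h x ∂μ := by
      rw [← integral_indicator hs]
      congr 1
      ext x
      by_cases hx : x ∈ s <;> simp [hx]
    rw [e1, integral_const_mul, ← withDensityᵥ_apply hi hs, hu]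
    rfl
  · intro f g _ hf hg h1 h2
    simp only [Pi.add_apply, add_mul]
    rw [VectorMeasure.integral_add hf hg, integral_add (hmul f hf) (hmul g hg), h1, h2]
  · refine isClosed_eq VectorMeasure.continuous_integral ?_
    refine LipschitzWith.continuous (K := 1) (LipschitzWith.of_dist_le_mul fun f g => ?_)
    rw [NNReal.coe_one, one_mul, dist_eq_norm, ← integral_sub (hmul f (L1.integrable_coeFn f))
      (hmul g (L1.integrable_coeFn g)), dist_eq_norm, L1.norm_eq_integral_norm]
    refine norm_integral_le_of_norm_le (L1.integrable_coeFn (f - g)).norm ?_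
    filter_upwards [Lp.coeFn_sub f g, h1'] with x hx hx1
    rw [hx, Pi.sub_apply, ← sub_mul, norm_mul]
    exact mul_le_of_le_one_right (norm_nonneg _) hx1
  · intro f g hfg _ h1
    rw [← VectorMeasure.integral_congr_ae hfg, h1]
    refine integral_congr_ae ?_
    filter_upwards [hfg] with x hx
    rw [hx]

open ContinuousLinearMap in
open scoped Convolution in
/-- The mollification of the measure `h μ` by a bump function, as a square integrable function. -/
theorem exists_mollification (φ : ContDiffBump (0 : RN N)) {μ : Measure (RN N)} [IsFiniteMeasure μ]
    {h : RN N → ℂ} (hh : Integrable h μ) :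
    ∃ v : Lp ℂ 2 (volume : Measure (RN N)), Integrable v ∧
      eLpNorm v 1 volume ≤ ∫⁻ x, ‖h x‖ₑ ∂μ ∧
      ∀ (G : RN N → ℂ) (M : ℝ), Continuous G → (∀ x, ‖G x‖ ≤ M) →
        ∫ y, G y * v y = ∫ z, (φ.normed volume ⋆[lsmul ℝ ℝ, volume] G) z * h z ∂μ := by
  set η := φ.normed volume with hη
  have hηc : Continuous η := φ.continuous_normed
  have hηi : Integrable η := φ.integrable_normed
  have hη0 : ∀ x, 0 ≤ η x := φ.nonneg_normed
  obtain ⟨B, hB⟩ : ∃ B, ∀ x, η x ≤ B := ⟨_, φ.normed_le_div_measure_closedBall_rIn volume⟩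
  -- the mollification of `h μ` is `y ↦ ∫ z, F (y, z) ∂μ`
  set F : RN N × RN N → ℂ := fun p => η (p.1 - p.2) • h p.2 with hF
  have hηm : Continuous fun p : RN N × RN N => η (p.1 - p.2) := by fun_prop
  have hFm : AEStronglyMeasurable F (volume.prod μ) :=
    hηm.aestronglyMeasurable.smul hh.1.comp_snd
  have hsec : ∀ z, ∫⁻ y, ‖F (y, z)‖ₑ = ‖h z‖ₑ := by
    intro z
    simp only [hF, enorm_smul]
    rw [lintegral_mul_const' _ _ enorm_ne_top,
      lintegral_sub_right_eq_self (fun y => ‖η y‖ₑ) z]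
    have : ∫⁻ y, ‖η y‖ₑ = ENNReal.ofReal (∫ y, η y) := by
      rw [ofReal_integral_eq_lintegral_ofReal hηi (Eventually.of_forall hη0)]
      exact lintegral_congr fun y => Real.enorm_of_nonneg (hη0 y)
    rw [this, hη, φ.integral_normed, ENNReal.ofReal_one, one_mul]
  have hFl : ∫⁻ p, ‖F p‖ₑ ∂(volume.prod μ) = ∫⁻ z, ‖h z‖ₑ ∂μ := by
    rw [lintegral_prod_symm _ hFm.enorm]
    exact lintegral_congr hsec
  have hFi : Integrable F (volume.prod μ) := ⟨hFm, by
    rw [HasFiniteIntegral, hFl]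
    exact hh.2⟩
  set w : RN N → ℂ := fun y => ∫ z, F (y, z) ∂μ with hw
  have hwi : Integrable w := hFi.integral_prod_left
  have hwB : ∀ y, ‖w y‖ ≤ B * ∫ z, ‖h z‖ ∂μ := by
    intro y
    rw [← integral_const_mul]
    refine norm_integral_le_of_norm_le (hh.norm.const_mul B) (Eventually.of_forall fun z => ?_)
    rw [norm_smul, Real.norm_of_nonneg (hη0 _)]
    exact mul_le_mul_of_nonneg_right (hB _) (norm_nonneg _)
  have hw2 : MemLp w 2 volume := by
    refine ⟨hwi.aestronglyMeasurable, ?_⟩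
    rw [eLpNorm_lt_top_iff_lintegral_rpow_enorm_lt_top (by norm_num) (by norm_num)]
    simp only [ENNReal.toReal_ofNat, ENNReal.rpow_ofNat]
    calc ∫⁻ y, ‖w y‖ₑ ^ 2
        ≤ ∫⁻ y, ENNReal.ofReal (B * ∫ z, ‖h z‖ ∂μ) * ‖w y‖ₑ := by
          refine lintegral_mono fun y => ?_
          rw [sq]
          refine mul_le_mul_left ?_ _
          rw [← ofReal_norm]
          exact ENNReal.ofReal_le_ofReal (hwB y)
      _ = ENNReal.ofReal (B * ∫ z, ‖h z‖ ∂μ) * ∫⁻ y, ‖w y‖ₑ :=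
          lintegral_const_mul' _ _ ENNReal.ofReal_ne_top
      _ < ∞ := ENNReal.mul_lt_top ENNReal.ofReal_lt_top hwi.2
  have hv := hw2.coeFn_toLp
  refine ⟨hw2.toLp w, hwi.congr hv.symm, ?_, fun G M hG hM => ?_⟩
  · rw [eLpNorm_congr_ae hv, eLpNorm_one_eq_lintegral_enorm, ← hFl,
      lintegral_prod _ hFm.enorm]
    exact lintegral_mono fun y => enorm_integral_le_lintegral_enorm _
  have hGF : Integrable (fun p : RN N × RN N => G p.1 * F p) (volume.prod μ) :=
    hFi.bdd_mul (c := M) (hG.comp continuous_fst).aestronglyMeasurable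
      (Eventually.of_forall fun p => hM p.1)
  calc ∫ y, G y * hw2.toLp w y = ∫ y, G y * w y := by
        refine integral_congr_ae ?_
        filter_upwards [hv] with y hy
        rw [hy]
    _ = ∫ y, ∫ z, G y * F (y, z) ∂μ := by
        simp only [hw, integral_const_mul]
    _ = ∫ z, (∫ y, G y * F (y, z)) ∂μ := integral_integral_swap hGF
    _ = _ := by
        congr 1
        ext z
        rw [convolution_lsmul_swap, ← integral_mul_const]
        congr 1
        ext y
        simp only [hF]
        rw [← neg_sub z y, hη, φ.normed_neg]
        simp only [Complex.real_smul]
        ring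

/-- A complex measure is a weak limit of functions in `L¹ ∩ L²` whose `L¹` norms are bounded by its
total variation. -/
theorem exists_tendsto_integral (u : ComplexMeasure (RN N)) :
    ∃ v : ℕ → Lp ℂ 2 (volume : Measure (RN N)), (∀ n, Integrable (v n)) ∧
      (∀ n, eLpNorm (v n) 1 volume ≤ u.variation univ) ∧
      ∀ (G : RN N → ℂ) (M : ℝ), Continuous G → (∀ x, ‖G x‖ ≤ M) →
        Tendsto (fun n => ∫ y, G y * v n y) atTop
          (𝓝 (VectorMeasure.integral u G (ContinuousLinearMap.mul ℝ ℂ))) := by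
  obtain ⟨h, hi, hl, hint⟩ := exists_density u
  have hr : ∀ n : ℕ, (0 : ℝ) < 1 / (n + 1) := fun n => by positivity
  let φ : ℕ → ContDiffBump (0 : RN N) := fun n =>
    ⟨1 / (n + 1) / 2, 1 / (n + 1), half_pos (hr n), half_lt_self (hr n)⟩
  have hφ : Tendsto (fun n => (φ n).rOut) atTop (𝓝 0) := tendsto_one_div_add_atTop_nhds_zero_nat
  choose v hvi hvl hv using fun n => exists_mollification (φ n) hi
  refine ⟨v, hvi, fun n => (hvl n).trans hl.le, fun G M hG hM => ?_⟩
  have hGi : Integrable G u.variation :=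
    Integrable.of_bound hG.aestronglyMeasurable M (Eventually.of_forall hM)
  simp only [fun n => hv n G M hG hM, hint G hGi]
  refine tendsto_integral_of_dominated_convergence (fun z => M * ‖h z‖) (fun n => ?_)
    (hi.norm.const_mul M) (fun n => Eventually.of_forall fun z => ?_)
    (Eventually.of_forall fun z => ?_)
  · refine AEStronglyMeasurable.mul ?_ hi.1
    refine (HasCompactSupport.continuous_convolution_left _ (φ n).hasCompactSupport_normed
      (φ n).continuous_normed hG.locallyIntegrable).aestronglyMeasurable
  · rw [norm_mul]
    refine mul_le_mul_of_nonneg_right ?_ (norm_nonneg _)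
    rw [convolution_def]
    refine (norm_integral_le_of_norm_le ((φ n).integrable_normed.mul_const M)
      (Eventually.of_forall fun t => ?_)).trans (le_of_eq ?_)
    · rw [ContinuousLinearMap.lsmul_apply, norm_smul,
        Real.norm_of_nonneg ((φ n).nonneg_normed t)]
      exact mul_le_mul_of_nonneg_left (hM _) ((φ n).nonneg_normed t)
    · rw [integral_mul_const, (φ n).integral_normed, one_mul]
  · exact (ContDiffBump.convolution_tendsto_right_of_continuous hφ hG z).mul_const _

/-! ### The maximal function of `K * u` for a measure `u` -/

/-- The value of `K * u` on the test function `f_ε(x - ·)`, in terms of the bounded continuous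
function `K * f_ε`. -/
theorem convMeasure_testFunction {K : 𝓢'(RN N, ℂ)} (hK : HasBoundedSymbol K)
    (u : ComplexMeasure (RN N)) {f : RN N → ℂ} (hs : ContDiff ℝ ((⊤ : ℕ∞) : WithTop ℕ∞) f)
    (hc : HasCompactSupport f) {ε : ℝ} (hε : 0 < ε) (x : RN N) :
    convMeasure K u (testFunction f hs hc ε hε x) =
      VectorMeasure.integral u
        (fun z => convSchwartz K (schwartzDilate (hc.toSchwartzMap hs) ε hε) (x - z))
        (ContinuousLinearMap.mul ℝ ℂ) := by
  rw [convMeasure_apply]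
  congr 1
  ext z
  -- both sides are the value of `K` on the Schwartz function `σ : y ↦ f_ε(x - z - y)`
  let σ := testFunction f hs hc ε hε (x - z)
  let τ : 𝓢(RN N, ℂ) :=
    SchwartzMap.compCLMOfContinuousLinearEquiv ℂ (ContinuousLinearEquiv.neg ℝ) σ
  rw [reflect, convSchwartz_eq_apply (τ := τ) (hasBoundedSymbol_rescale hK (-1) (by norm_num)),
    convSchwartz_eq_apply (τ := σ) hK, rescale_apply_eq]
  · intro y
    change σ y = σ (-((-1 : ℝ)⁻¹ • y))
    congr 1
    simp
  · intro y
    rfl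
  · intro y
    change dilate f ε (x - z - -y) = dilate f ε (x - (z - y))
    congr 1
    abel

theorem measurable_maximalFunctionDistrib {K : 𝓢'(RN N, ℂ)} (hK : HasBoundedSymbol K)
    (u : ComplexMeasure (RN N)) {ι : Type*} {ρ : ι → RN N → ℂ}
    (hs : ∀ ν, ContDiff ℝ ((⊤ : ℕ∞) : WithTop ℕ∞) (ρ ν)) (hc : ∀ ν, HasCompactSupport (ρ ν)) :
    Measurable (maximalFunctionDistrib ρ hs hc (convMeasure K u)) := by
  refine LowerSemicontinuous.measurable ?_
  refine lowerSemicontinuous_iSup fun ν => lowerSemicontinuous_iSup fun ε =>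
    lowerSemicontinuous_iSup fun hε => ?_
  simp only [convMeasure_testFunction hK]
  refine Continuous.lowerSemicontinuous (Continuous.enorm ?_)
  have hG := continuous_convSchwartz K (schwartzDilate ((hc ν).toSchwartzMap (hs ν)) ε hε)
  refine VectorMeasure.continuous_of_dominated (fun x => ?_)
    (fun x => Eventually.of_forall fun z => norm_convSchwartz_le K _ _)
    (integrable_const _) (Eventually.of_forall fun z => ?_)
  · exact (hG.comp (continuous_const.sub continuous_id)).aestronglyMeasurable
  · exact hG.comp (continuous_id.sub continuous_const)

/-- A weak type bound for `L¹ ∩ L²` functions implies the same bound for finite measures. -/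
theorem weakL1_maximalFunctionDistrib_le {K : 𝓢'(RN N, ℂ)} (hK : HasBoundedSymbol K)
    {ι : Type*} {ρ : ι → RN N → ℂ}
    (hs : ∀ ν, ContDiff ℝ ((⊤ : ℕ∞) : WithTop ℕ∞) (ρ ν)) (hc : ∀ ν, HasCompactSupport (ρ ν))
    {A : ℝ≥0∞} (hA : ∀ v : Lp ℂ 2 (volume : Measure (RN N)), Integrable v →
      weakL1 (maximalFunction ρ (convL2 K v)) ≤ A * eLpNorm v 1 volume)
    (u : ComplexMeasure (RN N)) :
    weakL1 (maximalFunctionDistrib ρ hs hc (convMeasure K u)) ≤ A * u.variation univ := by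
  obtain ⟨v, hvi, hvl, hv⟩ := exists_tendsto_integral u
  refine iSup₂_le fun r hr => ?_
  -- the superlevel set of the limit is contained in the lower limit of the superlevel sets
  set S : ℕ → Set (RN N) := fun n =>
    ⋂ m ≥ n, {x | ENNReal.ofReal r < maximalFunction ρ (convL2 K (v m)) x} with hS
  have hmono : Monotone S := fun n m hnm x hx => by
    simp only [hS, mem_iInter] at hx ⊢
    exact fun i hi => hx i (hnm.trans hi)
  have hsub : {x | ENNReal.ofReal r < maximalFunctionDistrib ρ hs hc (convMeasure K u) x} ⊆
      ⋃ n, S n := by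
    intro x hx
    rw [mem_ofPred_eq, maximalFunctionDistrib] at hx
    simp only [lt_iSup_iff] at hx
    obtain ⟨ν, ε, hε, hlt⟩ := hx
    set ψ := schwartzDilate ((hc ν).toSchwartzMap (hs ν)) ε hε with hψ
    rw [convMeasure_testFunction hK] at hlt
    have hlim := hv (fun z => convSchwartz K ψ (x - z)) _
      ((continuous_convSchwartz K ψ).comp (continuous_const.sub continuous_id))
      (fun z => norm_convSchwartz_le K ψ _)
    obtain ⟨n, hn⟩ := eventually_atTop.1 (hlim.enorm.eventually (lt_mem_nhds hlt))
    refine mem_iUnion.2 ⟨n, ?_⟩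
    simp only [hS, mem_iInter]
    intro m hm
    refine (hn m hm).trans_le ?_
    rw [← integral_mul_convL2]
    exact le_iSup_of_le ν (le_iSup₂_of_le ε hε le_rfl)
  refine (mul_le_mul_right (measure_mono hsub) _).trans ?_
  rw [hmono.measure_iUnion, ENNReal.mul_iSup]
  refine iSup_le fun n => ?_
  calc ENNReal.ofReal r * volume (S n)
      ≤ ENNReal.ofReal r * volume {x | ENNReal.ofReal r < maximalFunction ρ (convL2 K (v n)) x} :=
        mul_le_mul_right (measure_mono (biInter_subset_of_mem (mem_Ici.2 le_rfl))) _
    _ ≤ weakL1 (maximalFunction ρ (convL2 K (v n))) := le_weakL1 _ hr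
    _ ≤ A * eLpNorm (v n) 1 volume := hA (v n) (hvi n)
    _ ≤ A * u.variation univ := mul_le_mul_right (hvl n) _

end SingularMaximal

end

theorem theorem3p3 (N : ℕ) (hN : 0 < N) :
    ∃ C C' : ℝ,
      ∀ (K : 𝓢'(RN N, ℂ)) (k : RN N → ℂ) (C₀ C₁ : ℝ), IsFundamentalKernel K k C₀ C₁ →
      ∀ (ι : Type*) (ρ : ι → RN N → ℂ) (Q₁ Q₂ : ℝ)
        (hρ : ∀ ν, MemLp (ρ ν) ∞ volume)
        (hsupp : ∀ ν, ∀ᵐ x, x ∉ Metric.ball (0 : RN N) 1 → ρ ν x = 0),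
      (∀ ν, eLpNorm (ρ ν) 1 volume ≤ ENNReal.ofReal Q₁) →
      (∀ (ε : ℝ) (hε : 0 < ε) (ν : ι), ∃ g : BoundedContinuousFunction (RN N) ℂ,
        convL2 (rescale ε hε.ne' K) ((memLp_two_of_unitBall (hρ ν) (hsupp ν)).toLp (ρ ν))
          =ᵐ[volume] g ∧ ‖g‖ ≤ Q₂) →
      -- (i) weak estimate for integrable functions
      (∀ u : Lp ℂ 2 (volume : Measure (RN N)), Integrable u →
        Measurable (maximalFunction ρ (convL2 K u)) ∧
        weakL1 (maximalFunction ρ (convL2 K u)) ≤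
          ENNReal.ofReal (C * (Q₂ + Q₁ * (C₀ + C₁ + ‖symbol K‖))) * eLpNorm u 1 volume) ∧
      -- (ii) weak estimate for finite measures, with the same constant
      (∀ (hs : ∀ ν, ContDiff ℝ ((⊤ : ℕ∞) : WithTop ℕ∞) (ρ ν)) (hc : ∀ ν, HasCompactSupport (ρ ν))
          (u : ComplexMeasure (RN N)),
        Measurable (maximalFunctionDistrib ρ hs hc (convMeasure K u)) ∧
        weakL1 (maximalFunctionDistrib ρ hs hc (convMeasure K u)) ≤
          ENNReal.ofReal (C * (Q₂ + Q₁ * (C₀ + C₁ + ‖symbol K‖))) * u.variation Set.univ) ∧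
      -- (iii) strong estimate
      (∀ Q₃ : ℝ≥0∞, Q₃ = ⨆ ν, eLpNorm (ρ ν) ∞ volume → Q₃ ≠ ∞ →
        ∀ u : Lp ℂ 2 (volume : Measure (RN N)),
          Measurable (maximalFunction ρ (convL2 K u)) ∧
          eLpNorm (maximalFunction ρ (convL2 K u)) 2 volume ≤
            ENNReal.ofReal C' * Q₃ * ‖symbol K‖ₑ * eLpNorm u 2 volume) := by
  obtain ⟨C, hC⟩ := exists_weakL1_maximalFunction_le hN
  refine ⟨C, (volume (Metric.ball (0 : RN N) 1)).toReal * (8 * 5 ^ N),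
    fun K k C₀ C₁ h ι ρ Q₁ Q₂ hρ hsupp hQ₁ hQ₂ => ?_⟩
  have hweak := hC K k C₀ C₁ h ι ρ Q₁ Q₂ hρ hsupp hQ₁ hQ₂
  have hmeas := fun u : Lp ℂ 2 (volume : Measure (RN N)) =>
    measurable_maximalFunction
      (fun ν => memLp_two_of_unitBall (hρ ν) (hsupp ν)) (convL2 K u)
  refine ⟨fun u hu => ⟨hmeas u, hweak u hu⟩, fun hs hc u =>
    ⟨measurable_maximalFunctionDistrib h.boundedSymbol u hs hc,
      weakL1_maximalFunctionDistrib_le h.boundedSymbol hs hc hweak u⟩,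
    fun Q₃ hQ₃ hQt u => ⟨hmeas u, ?_⟩⟩
  exact eLpNorm_maximalFunction_le hN K hQt
    (fun ν => hQ₃ ▸ le_iSup (fun ν => eLpNorm (ρ ν) ∞ volume) ν) hsupp u
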